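/- **Setting.** Fix a linearly ordered set $D$ of values with at least two elements and an element $?\notin D$ (undefined). Thresholds are real numbers in $[0,1)$. *Algorithms.* An algorithm with coordinators and timestamps has rounds $1,\dots,r$ (together: a phase) and an index $\mathbf{ir}$ with $1\le \mathbf{ir}<r$. Each round has a type, $\mathtt{every}$, $\mathtt{lr}$ (leader receive) or $\mathtt{ls}$ (leader send), and a list of conditional instructions: at most one instruction "if $\mathtt{uni}(H)\wedge |H|>\mathit{thr}_u^i\cdot|\Pi|$ then $x:=\mathtt{op}(H)$", followed by instructions "if $\mathtt{mult}(H)\wedge |H|>\mathit{thr}_m^{i,j}\cdot|\Pi|$ then $x:=\mathtt{op}(H)$" with non-increasing thresholds $\mathit{thr}_m^{i,1}\ge\dots\ge\mathit{thr}_m^{i,k}$. Here $|\Pi|$ is the number $n$ of processes; $\mathtt{uni}$, $\mathtt{mult}$ say that $H$ contains exactly one, respectively more than one, value. We put $\mathit{thr}_u^i=-1$ (resp. $\mathit{thr}_m^{i,k}=-1$) if round $i$ has no $\mathtt{uni}$ (resp. $\mathtt{mult}$) instruction. The operation is $\mathrm{maxts}$ (smallest value among those with the most recent timestamp) in round 1,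 and $\min$ or $\mathrm{smor}$ (smallest most frequent value) in the other rounds. A phase predicate $\psi=(\psi_1,\dots,\psi_r)$ consists of conjunctions of atomic predicates: $\varphi_=$ (all processes receive the same multiset, timestamps included in round 1), $\varphi_{c}$ (every process receives a multiset of size $>c\cdot n$) and $\varphi_{\mathtt{ls}}$ (the leader reaches everybody). $\mathit{thr}_i(\psi)$ is the constant $c$ of the conjunct $\varphi_c$ of $\psi_i$, or $-1$ if there is none. The communication predicate is $(\mathsf G\overline\psi)\wedge \mathsf F(\psi^1\wedge \mathsf F(\psi^2\wedge\cdots\mathsf F\psi^k))$, with global predicate $\overline\psi$ and sporadic predicates $\psi^1,\dots,\psi^k$, each of which implies $\overline\psi$. *Semantics.* A state $(f,t,d)$ of $n$ processes consists of the tuples of values of $\mathit{inp}$ (in $D$), of their timestamps (in $\mathbb N$), and of values of $\mathit{dec}$ (in $D\cup\{?\}$). A phase with number $m$ runs through tuples $f_0=f,f_1,\dots,f_r$ of elements of $D\cup\{?\}$, where $f_i$ results from $f_{i-1}$ by round $i$ under $\psi_i$. - In an $\mathtt{every}$ round each process $p$ receives a sub-multiset $H_p$ of the multiset of all sent values (with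 timestamps in round 1), such that $(H_p)_p$ satisfies $\psi_i$ (occurrences of $?$ count for the size); it executes the first instruction whose condition holds for $H_p\setminus\{?\}$ and gets $?$ if there is none. - In an $\mathtt{lr}$ round $f_i$ is $?$ everywhere except at one arbitrary process, whose entry is any $e\in D\cup\{?\}$ that some process could obtain if the round were of type $\mathtt{every}$. - In an $\mathtt{ls}$ round without $\mathtt{uni}$ instruction, $f_i$ is $?$ everywhere. In an $\mathtt{ls}$ round with one: if $\psi_i$ contains $\varphi_{\mathtt{ls}}$, then all entries of $f_i$ equal $e$, where $e$ is the entry of the process selected in round $i-1$ if that round is of type $\mathtt{lr}$, and any entry of $f_{i-1}$ otherwise; if $\psi_i$ does not contain $\varphi_{\mathtt{ls}}$, then every entry of $f_i$ is $e$ or $?$, for some entry $e$ of $f_{i-1}$. After the phase, a process $p$ with $f_{\mathbf{ir}}(p)\ne{?}$ has $\mathit{inp}=f_{\mathbf{ir}}(p)$ with timestamp $m$, the others keep $\mathit{inp}$ and its timestamp; and $\mathit{dec}$, if it was $?$, becomes $f_r(p)$. An execution is an infinite sequence of phases numbered $1,2,\dots$, starting with arbitrary $\mathit{inp}$ in $D$,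 all timestamps $0$ and all $\mathit{dec}={?}$, in which there are phases with numbers $m_1<\dots<m_k$ such that phase $m_j$ is under $\overline\psi\wedge\psi^j$ and all other phases are under $\overline\psi$. The algorithm *solves consensus* if for every $n$ and every execution with $n$ processes, in every state any two values of $\mathit{dec}$ other than $?$ are equal (agreement), and in some state no $\mathit{dec}$ is $?$ (termination). *Notions.* A *c-equalizer* is a conjunction containing $\varphi_=$ or $\varphi_{\mathtt{ls}}$. An $\mathtt{ls}$ round $i$ is *c-solo-safe* w.r.t. $\psi$ if $\psi_i$ contains $\varphi_{\mathtt{ls}}$, and *c-preserving* otherwise. A round $i$ of another type is *c-preserving* w.r.t. $\psi$ if it has no $\mathtt{uni}$ instruction, or no $\mathtt{mult}$ instruction, or $\mathit{thr}_i(\psi)<\max(\mathit{thr}_u^i,\mathit{thr}_m^{i,k})$; it is *c-solo-safe* if $0\le\mathit{thr}_u^i\le\mathit{thr}_i(\psi)$. $\psi$ is a *c-decider* if all rounds are c-solo-safe w.r.t. $\psi$. With $\overline{\mathit{thr}}=\max(1-\mathit{thr}_u^1,\,1-\mathit{thr}_m^{1,k}/2)$, $\psi$ is a *c-unifier* if (i)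 $\mathit{thr}_1(\psi)\ge\mathit{thr}_m^{1,k}$ and either $\mathit{thr}_1(\psi)\ge\mathit{thr}_u^1$ or $\mathit{thr}_1(\psi)\ge\overline{\mathit{thr}}$, and (ii) there is $i$ with $1\le i\le\mathbf{ir}$ such that $\psi_i$ is a c-equalizer, rounds $2,\dots,i$ are not c-preserving and rounds $i+1,\dots,\mathbf{ir}$ are c-solo-safe w.r.t. $\psi$. It is a *strong c-unifier* if moreover $\mathit{thr}_u^1\le\mathit{thr}_1(\psi)$. **Theorem.** Let an algorithm with coordinators and timestamps satisfy: 1. Every $\mathtt{lr}$ round is immediately followed by an $\mathtt{ls}$ round; neither round $\mathbf{ir}$ nor round $r$ is of type $\mathtt{lr}$; $\mathtt{ls}$ rounds have no $\mathtt{mult}$ instruction; $\varphi_{\mathtt{ls}}$ is used only in $\mathtt{ls}$ rounds, and $\varphi_=$ is not used in $\mathtt{ls}$ rounds. 2. For every round $i$ such that rounds $1,\dots,i-1$ are not c-preserving w.r.t. $\overline\psi$: $\mathit{thr}_u^i\ge\mathit{thr}_i(\overline\psi)$ if round $i$ has a $\mathtt{uni}$ instruction, and $\mathit{thr}_m^{i,k}\ge\mathit{thr}_i(\overline\psi)$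 if it has a $\mathtt{mult}$ instruction. 3. No component of $\overline\psi$ is a c-equalizer; round $\mathbf{ir}$ has no $\mathtt{mult}$ instruction; and, if round $\mathbf{ir}$ is not of type $\mathtt{ls}$ and has a $\mathtt{uni}$ instruction, then $\mathit{thr}_u^{\mathbf{ir}}\ge 1/2$. Then the algorithm solves consensus if and only if - round $1$ and round $\mathbf{ir}+1$ are not of type $\mathtt{ls}$; - every round has a $\mathtt{uni}$ instruction, the first round has a $\mathtt{mult}$ instruction, $\mathit{thr}_m^{1,k}\ge 1-\mathit{thr}_u^{\mathbf{ir}+1}$ and $\mathit{thr}_u^1\ge 1-\mathit{thr}_u^{\mathbf{ir}+1}$; and - there are $i\le j$ such that $\psi^i$ is a strong c-unifier and $\psi^j$ is a c-decider. -/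

import Mathlib

namespace HeardOf

/-! ### The language: rounds, communication predicates, algorithms -/

/-- Threshold constants: real numbers `c` with `0 ≤ c < 1`. -/
abbrev Threshold : Type := Set.Ico (0 : ℝ) 1

/-- Types of rounds: `every`, `lr` (leader receive), `ls` (leader send). -/
inductive RoundKind
  | every
  | lr
  | ls
  deriving DecidableEq

/-- Operations: minimal value, smallest most frequent value, smallest value among those with the
most recent timestamp. -/
inductive Op
  | min
  | smor
  | maxts

/-- The threshold and the operation of a conditional instruction. -/
structure Instr where
  thr : Threshold
  op : Op

/-- The text of a round: its type, at most one instruction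
`if uni(H) ∧ |H| > thr⬝|Π| then x := op(H)`, followed by a list of instructions
`if mult(H) ∧ |H| > thr⬝|Π| then x := op(H)`.
A test without a size requirement is the one with threshold `0`. -/
structure Round where
  kind : RoundKind
  uni : Option Instr
  mult : List Instr

/-- A conjunction of atomic communication predicates for one round: `equal` says whether `φ_=` is a
conjunct, `leader` whether `φ_ls` is a conjunct, and `thr` is the constant `c` of the conjunct `φ_c`
(the largest one if there are several), or `⊥` if there is no such conjunct. -/
@[ext]
structure RoundPred where
  equal : Bool
  leader : Bool
  thr : WithBot Threshold

/-- Conjunction. -/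
noncomputable def RoundPred.and (φ ψ : RoundPred) : RoundPred where
  equal := φ.equal || ψ.equal
  leader := φ.leader || ψ.leader
  thr := φ.thr ⊔ ψ.thr

/-- `φ.Implies ψ`: every conjunct of `ψ` is a consequence of a conjunct of `φ`. -/
def RoundPred.Implies (φ ψ : RoundPred) : Prop :=
  (ψ.equal = true → φ.equal = true) ∧ (ψ.leader = true → φ.leader = true) ∧ ψ.thr ≤ φ.thr

/-- The threshold constant of a conjunction, `-1` if it has none. -/
noncomputable def RoundPred.thrVal (φ : RoundPred) : ℝ :=
  WithBot.recBotCoe (-1) (fun c : Threshold => (c : ℝ)) φ.thr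

/-- A conjunction having `φ_=` or `φ_ls` as a conjunct. -/
def RoundPred.CEqualizer (φ : RoundPred) : Prop := φ.equal = true ∨ φ.leader = true

/-- Communication predicates for a phase with `r` rounds; only the components `1, …, r` matter. -/
abbrev PhasePred : Type := ℕ → RoundPred

/-- An algorithm with coordinators and timestamps: the number `r` of rounds in a phase, the index
`ir` of the round in which `inp` is updated, the rounds `1, …, r` (the values of `round` at other
indices are irrelevant), and the communication predicate
`(G glob) ∧ F (spor 0 ∧ F (spor 1 ∧ ⋯ F (spor (k-1)) ⋯))`. -/
structure Algorithm where
  r : ℕ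
  ir : ℕ
  round : ℕ → Round
  glob : PhasePred
  k : ℕ
  spor : Fin k → PhasePred
  /-- `inp` is updated before the last round -/
  one_le_ir : 1 ≤ ir
  ir_lt_r : ir < r
  /-- the thresholds of the `mult` instructions of a round are non-increasing -/
  mult_sorted : ∀ i, 1 ≤ i → i ≤ r →
    (round i).mult.Pairwise (fun I J => (J.thr : ℝ) ≤ (I.thr : ℝ))
  /-- `maxts` is the operation of all instructions of the first round and of no other one -/
  op_uni : ∀ i, 1 ≤ i → i ≤ r → ∀ I, (round i).uni = some I → (I.op = Op.maxts ↔ i = 1)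
  op_mult : ∀ i, 1 ≤ i → i ≤ r → ∀ I ∈ (round i).mult, (I.op = Op.maxts ↔ i = 1)

/-! ### Semantics -/

section Semantics

variable {D : Type*} [LinearOrder D] {n : ℕ}

/-- The values among which an operation picks the smallest one.  The multiset consists of pairs
(value, timestamp). -/
def Op.candidates (op : Op) (K : Multiset (D × ℕ)) : Finset D :=
  match op with
  | .min => (K.map Prod.fst).toFinset
  | .smor => (K.map Prod.fst).toFinset.filter
      (fun d => ∀ e ∈ K.map Prod.fst, (K.map Prod.fst).count e ≤ (K.map Prod.fst).count d)
  | .maxts => ((K.filter (fun x => ∀ y ∈ K, y.2 ≤ x.2)).map Prod.fst).toFinset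

/-- The result of an operation (undefined only on the empty multiset). -/
def Op.eval (op : Op) (K : Multiset (D × ℕ)) : Option D :=
  if h : (op.candidates K).Nonempty then some ((op.candidates K).min' h) else none

/-- Messages: `none` stands for the undefined value `?`, and `some (d, τ)` is the value `d` with
timestamp `τ`. -/
abbrev Msg (D : Type*) : Type _ := Option (D × ℕ)

/-- The multiset `H - {?}`. -/
def defined (H : Multiset (Msg D)) : Multiset (D × ℕ) := H.filterMap id

/-- The number of distinct values (timestamps are ignored). -/
def numValues (K : Multiset (D × ℕ)) : ℕ := (K.map Prod.fst).toFinset.card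

open Classical in
/-- The value `update(H)` to which a process sets its variable upon receiving `H`, when there are
`n` processes: the first instruction whose condition holds for `H - {?}` is executed. -/
noncomputable def Round.update (R : Round) (n : ℕ) (H : Multiset (Msg D)) : Option D :=
  if numValues (defined H) = 1 then
    match R.uni.filter
        (fun I => decide ((I.thr : ℝ) * n < ((defined H).card : ℝ))) with
    | some I => I.op.eval (defined H)
    | none => none
  else if 1 < numValues (defined H) then
    match R.mult.find? (fun I => decide ((I.thr : ℝ) * n < ((defined H).card : ℝ))) with
    | some I => I.op.eval (defined H)
    | none => none
  else none

/-- The tuple of received multisets satisfies the conjuncts `φ_=` and `φ_c`. -/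
def RoundPred.Sat (φ : RoundPred) (H : Fin n → Multiset (Msg D)) : Prop :=
  (φ.equal = true → ∀ p q, H p = H q) ∧
  (∀ c : Threshold, φ.thr = (c : WithBot Threshold) → ∀ p, (c : ℝ) * n < ((H p).card : ℝ))

/-- The messages sent in round `i`: in the first round values are sent with their timestamps, in the
other rounds there are no timestamps (a dummy `0` is used). -/
def messages (i : ℕ) (t : Fin n → ℕ) (f : Fin n → Option D) : Multiset (Msg D) :=
  (Finset.univ : Finset (Fin n)).val.map
    (fun p => (f p).map (fun d => (d, if i = 1 then t p else 0)))

/-- A transition of round `i` when every process receives. -/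
def Algorithm.EveryStep (A : Algorithm) (i : ℕ) (φ : RoundPred) (t : Fin n → ℕ)
    (f f' : Fin n → Option D) : Prop :=
  ∃ H : Fin n → Multiset (Msg D), φ.Sat H ∧ (∀ p, H p ≤ messages i t f) ∧
    ∀ p, f' p = (A.round i).update n (H p)

/-- The values that some process can obtain in round `i`. -/
def Algorithm.fire (A : Algorithm) (i : ℕ) (φ : RoundPred) (t : Fin n → ℕ)
    (f : Fin n → Option D) : Set (Option D) :=
  {d | ∃ f', A.EveryStep i φ t f f' ∧ ∃ p, f' p = d}

/-- The tuple all of whose entries are `d`. -/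
def solo (n : ℕ) (d : Option D) : Fin n → Option D := fun _ => d

/-- The tuple whose entry at `q` is `d` and whose other entries are `?`. -/
def one (q : Fin n) (d : Option D) : Fin n → Option D := Function.update (fun _ => none) q d

/-- A transition of a round of type `ls`.  Without an instruction nothing can be set; otherwise
the leader is the process selected in the preceding round, if that is an `lr` round, and arbitrary
if not.  If `φ_ls` is not required, then some processes may miss the value. -/
def Algorithm.LsStep (A : Algorithm) (i : ℕ) (φ : RoundPred) (f f' : Fin n → Option D) : Prop :=
  if (A.round i).uni = none then f' = solo n none
  else if φ.leader = true then
    if 1 < i ∧ (A.round (i - 1)).kind = .lr then ∃ q d, f = one q d ∧ f' = solo n d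
    else ∃ d ∈ Set.range f, f' = solo n d
  else ∃ d ∈ Set.range f, ∀ p, f' p = d ∨ f' p = none

/-- The transition of round `i` under `φ`, where `t` is the tuple of timestamps of `inp` (used in the
first round only). -/
def Algorithm.RoundStep (A : Algorithm) (i : ℕ) (φ : RoundPred) (t : Fin n → ℕ)
    (f f' : Fin n → Option D) : Prop :=
  match (A.round i).kind with
  | .every => A.EveryStep i φ t f f'
  | .lr => ∃ d ∈ A.fire i φ t f, ∃ q, f' = one q d
  | .ls => A.LsStep i φ f f'

/-- A state: the variables `inp`, their timestamps, and the variables `dec`. -/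
structure State (n : ℕ) (D : Type*) where
  inp : Fin n → D
  ts : Fin n → ℕ
  dec : Fin n → Option D

/-- The transition of the phase with number `m` under `π`. -/
def Algorithm.PhaseStep (A : Algorithm) (m : ℕ) (π : PhasePred) (s s' : State n D) : Prop :=
  ∃ x : ℕ → Fin n → Option D,
    (∀ p, x 0 p = some (s.inp p)) ∧
    (∀ i, 1 ≤ i → i ≤ A.r → A.RoundStep i (π i) s.ts (x (i - 1)) (x i)) ∧
    (∀ p, s'.inp p = (x A.ir p).getD (s.inp p)) ∧
    (∀ p, s'.ts p = if (x A.ir p).isSome then m else s.ts p) ∧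
    (∀ p, s'.dec p = (s.dec p).or (x A.r p))

/-- Executions respecting the communication predicate.  Phases are numbered `1, 2, …`, and phase
`l + 1` leads from `σ l` to `σ (l + 1)`.  The sporadic predicates hold, in their order, in distinct
phases, and all the other phases are transitions under the global predicate. -/
def Algorithm.IsExecution (A : Algorithm) (σ : ℕ → State n D) : Prop :=
  (∀ p, (σ 0).ts p = 0) ∧ (∀ p, (σ 0).dec p = none) ∧
  ∃ m : Fin A.k → ℕ, StrictMono m ∧
    (∀ j, A.PhaseStep (m j + 1) (fun i => (A.glob i).and (A.spor j i)) (σ (m j)) (σ (m j + 1))) ∧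
    (∀ l, (∀ j, m j ≠ l) → A.PhaseStep (l + 1) A.glob (σ l) (σ (l + 1)))

end Semantics

/-- In every state of every execution, any two decided processes have decided on the same value. -/
def Algorithm.Agreement (A : Algorithm) (D : Type*) [LinearOrder D] : Prop :=
  ∀ (n : ℕ) (σ : ℕ → State n D), A.IsExecution σ → ∀ l p q,
    (σ l).dec p = (σ l).dec q ∨ (σ l).dec p = none ∨ (σ l).dec q = none

/-- Every execution has a state in which all processes have decided. -/
def Algorithm.Termination (A : Algorithm) (D : Type*) [LinearOrder D] : Prop :=
  ∀ (n : ℕ) (σ : ℕ → State n D), A.IsExecution σ → ∃ l, ∀ p, (σ l).dec p ≠ none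

/-- The algorithm solves consensus, for values from `D`. -/
def Algorithm.SolvesConsensus (A : Algorithm) (D : Type*) [LinearOrder D] : Prop :=
  A.Agreement D ∧ A.Termination D

/-! ### Notions of the characterization -/

/-- The threshold of the `uni` instruction, `-1` if there is none. -/
noncomputable def Round.thrU (R : Round) : ℝ :=
  match R.uni with
  | none => -1
  | some I => (I.thr : ℝ)

/-- The threshold of the last `mult` instruction, which is the minimal one, and `-1` if there is
none. -/
noncomputable def Round.thrM (R : Round) : ℝ :=
  match R.mult.getLast? with
  | none => -1
  | some I => (I.thr : ℝ)

namespace Algorithm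

/-- Round `i` is c-preserving with respect to `π`. -/
def CPreserving (A : Algorithm) (π : PhasePred) (i : ℕ) : Prop :=
  match (A.round i).kind with
  | .ls => (π i).leader = false
  | _ => (A.round i).uni = none ∨ (A.round i).mult = [] ∨
      (π i).thrVal < max (A.round i).thrU (A.round i).thrM

/-- Round `i` is c-solo-safe with respect to `π`. -/
def CSoloSafe (A : Algorithm) (π : PhasePred) (i : ℕ) : Prop :=
  match (A.round i).kind with
  | .ls => (π i).leader = true
  | _ => 0 ≤ (A.round i).thrU ∧ (A.round i).thrU ≤ (π i).thrVal

/-- The border threshold. -/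
noncomputable def borderThr (A : Algorithm) : ℝ :=
  max (1 - (A.round 1).thrU) (1 - (A.round 1).thrM / 2)

/-- All rounds are c-solo-safe. -/
def CDecider (A : Algorithm) (π : PhasePred) : Prop :=
  ∀ i, 1 ≤ i → i ≤ A.r → A.CSoloSafe π i

/-- c-unifiers. -/
def CUnifier (A : Algorithm) (π : PhasePred) : Prop :=
  (A.round 1).thrM ≤ (π 1).thrVal ∧
  ((A.round 1).thrU ≤ (π 1).thrVal ∨ A.borderThr ≤ (π 1).thrVal) ∧
  ∃ i, 1 ≤ i ∧ i ≤ A.ir ∧ (π i).CEqualizer ∧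
    (∀ j, 2 ≤ j → j ≤ i → ¬ A.CPreserving π j) ∧
    (∀ j, i + 1 ≤ j → j ≤ A.ir → A.CSoloSafe π j)

/-- Strong c-unifiers. -/
def StrongCUnifier (A : Algorithm) (π : PhasePred) : Prop :=
  A.CUnifier π ∧ (A.round 1).thrU ≤ (π 1).thrVal

/-- Syntactic t-safety. -/
structure TSafe (A : Algorithm) : Prop where
  uni : ∀ i, 1 ≤ i → i ≤ A.r → (A.round i).uni ≠ none
  mult : (A.round 1).mult ≠ []
  const_mult : 1 - (A.round (A.ir + 1)).thrU ≤ (A.round 1).thrM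
  const_uni : 1 - (A.round (A.ir + 1)).thrU ≤ (A.round 1).thrU

/-- Convention on the communication predicate: every sporadic predicate implies the global one. -/
def SporadicImpliesGlobal (A : Algorithm) : Prop :=
  ∀ j i, 1 ≤ i → i ≤ A.r → (A.spor j i).Implies (A.glob i)

/-- Syntactic assumptions on `lr` and `ls` rounds. -/
structure LeaderAssumption (A : Algorithm) : Prop where
  /-- an `lr` round is immediately followed by an `ls` round -/
  lr_ls : ∀ i, 1 ≤ i → i < A.r → (A.round i).kind = .lr → (A.round (i + 1)).kind = .ls
  /-- `inp` and `dec` are not updated in `lr` rounds -/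
  ir_kind : (A.round A.ir).kind ≠ .lr
  last_kind : (A.round A.r).kind ≠ .lr
  /-- `ls` rounds have no `mult` instruction -/
  ls_mult : ∀ i, 1 ≤ i → i ≤ A.r → (A.round i).kind = .ls → (A.round i).mult = []
  /-- `φ_ls` is used only in `ls` rounds, and `φ_=` is not used in `ls` rounds -/
  glob_leader : ∀ i, 1 ≤ i → i ≤ A.r → (A.glob i).leader = true → (A.round i).kind = .ls
  glob_equal : ∀ i, 1 ≤ i → i ≤ A.r → (A.glob i).equal = true → (A.round i).kind ≠ .ls
  spor_leader : ∀ j i, 1 ≤ i → i ≤ A.r → (A.spor j i).leader = true → (A.round i).kind = .ls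
  spor_equal : ∀ j i, 1 ≤ i → i ≤ A.r → (A.spor j i).equal = true → (A.round i).kind ≠ .ls

/-- Instructions that are never executed because of the global predicate have been removed. -/
def ThresholdAssumption (A : Algorithm) : Prop :=
  ∀ i, 1 ≤ i → i ≤ A.r → (∀ j, 1 ≤ j → j < i → ¬ A.CPreserving A.glob j) →
    ((A.round i).uni ≠ none → (A.glob i).thrVal ≤ (A.round i).thrU) ∧
    ((A.round i).mult ≠ [] → (A.glob i).thrVal ≤ (A.round i).thrM)

/-- The syntactic restrictions: the global predicate has no c-equalizer; the round updating `inp`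
has no `mult` instruction, and, unless it is an `ls` round (where no thresholds are used), its
`uni` instruction has a threshold of at least `1/2`. -/
structure Restrictions (A : Algorithm) : Prop where
  no_equalizer : ∀ i, 1 ≤ i → i ≤ A.r → ¬ (A.glob i).CEqualizer
  ir_mult : (A.round A.ir).mult = []
  ir_uni : (A.round A.ir).kind ≠ .ls → (A.round A.ir).uni ≠ none → 1 / 2 ≤ (A.round A.ir).thrU

end Algorithm

end HeardOf

/-!
The argument has two halves.

*Sufficiency.*  Round `ir` yields at most one value, since it has no `mult` instruction and,
unless it is an `ls` round, its `uni` instruction needs a majority.  If somebody decides, this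
value passes round `ir + 1`, so more than `thr_u^{ir+1} * n` processes have adopted it with the newest
timestamp (`Locked`).  By the
inequalities of `TSafe` every multiset on which an instruction of round 1 acts contains one of these
timestamps, so that `maxts` returns the locked value from then on (`Locked.round_one`); hence
agreement (`agreement_of_tSafe`).  A strong c-unifier keeps everybody supplied with values until its
c-equalizer makes them equal, and the c-solo-safe rounds after it deliver the common value to all
values of `inp` (`PhaseStep.unify`); a c-decider then delivers it to all values of `dec`.

*Necessity.*  If some round has no `uni` instruction, then processes that start with the same value
never decide.  The other executions constructed have a large even number `n` of processes
(`Large`), two values `a < b`, and received multisets given by sets of senders.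

For termination, start with one process having `a` and all others `b`, all timestamps being `0`.
If a round has both kinds of instructions and no equality is required, then every tuple of `a`s and
`b`s is a possible outcome, for a suitable input (`exists_flexible`, `flexible_one`).  So one can
proceed to the first round up to `ir` that is c-preserving or a c-equalizer (`erase_or_equalize`).
A c-preserving round may erase all values, and the state does not change.  After a c-equalizer the
common value can be erased in any later round that is not c-solo-safe.  Hence the state may remain
as it is until the first strong c-unifier, and if no c-decider follows, then no decision is ever
taken (`exists_unifier_decider_of_termination`).  Round 1 is c-preserving under all predicates if it
has no `mult` instruction, and then the state never changes (`mult_ne_nil_of_termination`).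

For agreement, two phases under the global predicate suffice.  If a value `e` occurs exactly
`⌊thr_u * n⌋ + 1` times and the other entries are undefined, then a process can be made to obtain
`e` or nothing, at will, according to whether one occurrence is missing from what it receives
(`roundStep_pattern`).  As round `ir` has no `mult` instruction, each of the values `a`, `b` can be
brought into this form (`spreads_of_flexible`).  So a single process can decide on `e` while only a
critical number of processes adopt `e`.  If one of the conditions on round 1, on round `ir + 1` or
on the thresholds of round 1 fails, then the next phase may ignore those processes and lead to a
decision on the other value (`Spreads.not_agreement`).
-/

/-! ### Operations and the `update` function -/

namespace HeardOf

variable {D : Type*} [LinearOrder D] {n : ℕ}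

lemma Op.eval_eq_some {op : Op} {K : Multiset (D × ℕ)} {a : D} (ha : a ∈ op.candidates K)
    (hmin : ∀ b ∈ op.candidates K, a ≤ b) : op.eval K = some a := by
  have h : (op.candidates K).Nonempty := ⟨a, ha⟩
  rw [Op.eval, dif_pos h]
  exact congrArg some (le_antisymm (Finset.min'_le _ _ ha) (Finset.le_min' _ _ _ hmin))

lemma Op.mem_candidates_of_eval {op : Op} {K : Multiset (D × ℕ)} {a : D}
    (h : op.eval K = some a) : a ∈ op.candidates K := by
  unfold Op.eval at h
  split_ifs at h with hne
  obtain rfl := Option.some.inj h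
  exact Finset.min'_mem _ _

lemma Op.exists_mem_of_mem_candidates {op : Op} {K : Multiset (D × ℕ)} {a : D}
    (h : a ∈ op.candidates K) : ∃ x ∈ K, x.1 = a := by
  cases op
  · simpa [Op.candidates] using h
  · simp only [Op.candidates, Finset.mem_filter, Multiset.mem_toFinset, Multiset.mem_map] at h
    exact h.1
  · simp only [Op.candidates, Multiset.mem_toFinset, Multiset.mem_map, Multiset.mem_filter] at h
    obtain ⟨x, hx, rfl⟩ := h
    exact ⟨x, hx.1, rfl⟩

lemma Op.candidates_nonempty (op : Op) {K : Multiset (D × ℕ)} (hK : K ≠ 0) :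
    (op.candidates K).Nonempty := by
  obtain ⟨x, hx⟩ := Multiset.exists_mem_of_ne_zero hK
  cases op
  · exact ⟨x.1, by simpa [Op.candidates] using ⟨x.2, hx⟩⟩
  · obtain ⟨d, hd, hmax⟩ := Finset.exists_max_image (K.map Prod.fst).toFinset
      (fun d => (K.map Prod.fst).count d) ⟨x.1, by simpa using ⟨x.2, hx⟩⟩
    refine ⟨d, ?_⟩
    simp only [Op.candidates, Finset.mem_filter]
    exact ⟨hd, fun e he => hmax e (Multiset.mem_toFinset.2 he)⟩
  · obtain ⟨y, hy, hmax⟩ := Finset.exists_max_image K.toFinset Prod.snd ⟨x, by simpa using hx⟩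
    refine ⟨y.1, ?_⟩
    simp only [Op.candidates, Multiset.mem_toFinset, Multiset.mem_map, Multiset.mem_filter]
    exact ⟨y, ⟨Multiset.mem_toFinset.1 hy, fun z hz => hmax z (Multiset.mem_toFinset.2 hz)⟩, rfl⟩

lemma Op.eval_ne_none (op : Op) {K : Multiset (D × ℕ)} (hK : K ≠ 0) : op.eval K ≠ none := by
  simp [Op.eval, op.candidates_nonempty hK]

lemma Op.eval_const (op : Op) {K : Multiset (D × ℕ)} {d : D} (hK : K ≠ 0)
    (hd : ∀ x ∈ K, x.1 = d) : op.eval K = some d := by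
  have h : ∀ b ∈ op.candidates K, b = d := fun b hb => by
    obtain ⟨x, hx, rfl⟩ := Op.exists_mem_of_mem_candidates hb
    exact hd x hx
  obtain ⟨b, hb⟩ := op.candidates_nonempty hK
  obtain rfl := h b hb
  exact Op.eval_eq_some hb fun c hc => (h c hc).ge

lemma Op.eval_min {K : Multiset (D × ℕ)} {x : D × ℕ} (hx : x ∈ K) (hle : ∀ y ∈ K, x.1 ≤ y.1) :
    Op.min.eval K = some x.1 := by
  refine Op.eval_eq_some ?_ fun b hb => ?_
  · simpa [Op.candidates] using ⟨x.2, hx⟩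
  · obtain ⟨y, hy, rfl⟩ := Op.exists_mem_of_mem_candidates hb
    exact hle y hy

lemma Op.eval_maxts {K : Multiset (D × ℕ)} {x : D × ℕ} (hx : x ∈ K) (hle : ∀ y ∈ K, x.1 ≤ y.1)
    (hts : ∀ y ∈ K, y.2 ≤ x.2) : Op.maxts.eval K = some x.1 := by
  refine Op.eval_eq_some ?_ fun b hb => ?_
  · simp only [Op.candidates, Multiset.mem_toFinset, Multiset.mem_map, Multiset.mem_filter]
    exact ⟨x, ⟨hx, hts⟩, rfl⟩
  · obtain ⟨y, hy, rfl⟩ := Op.exists_mem_of_mem_candidates hb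
    exact hle y hy

lemma Op.eval_smor {K : Multiset (D × ℕ)} {x : D × ℕ} (hx : x ∈ K)
    (hlt : ∀ y ∈ K, y.1 ≠ x.1 → (K.map Prod.fst).count y.1 < (K.map Prod.fst).count x.1) :
    Op.smor.eval K = some x.1 := by
  refine Op.eval_eq_some ?_ fun b hb => ?_
  · simp only [Op.candidates, Finset.mem_filter, Multiset.mem_toFinset, Multiset.mem_map]
    refine ⟨⟨x, hx, rfl⟩, ?_⟩
    rintro e ⟨y, hy, rfl⟩
    by_cases h : y.1 = x.1
    · rw [h]
    · exact (hlt y hy h).le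
  · obtain ⟨y, hy, rfl⟩ := Op.exists_mem_of_mem_candidates hb
    by_cases h : y.1 = x.1
    · exact h.ge
    · simp only [Op.candidates, Finset.mem_filter] at hb
      exact absurd (hb.2 x.1 (Multiset.mem_map_of_mem _ hx)) (not_le.2 (hlt y hy h))

lemma one_lt_numValues_iff {K : Multiset (D × ℕ)} :
    1 < numValues K ↔ ∃ x ∈ K, ∃ y ∈ K, x.1 ≠ y.1 := by
  rw [numValues, Finset.one_lt_card]
  simp

lemma numValues_eq_one {K : Multiset (D × ℕ)} {d : D} (hK : K ≠ 0) (hd : ∀ x ∈ K, x.1 = d) :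
    numValues K = 1 := by
  refine le_antisymm (not_lt.1 fun h => ?_) ?_
  · obtain ⟨x, hx, y, hy, hxy⟩ := one_lt_numValues_iff.1 h
    exact hxy ((hd x hx).trans (hd y hy).symm)
  · obtain ⟨x, hx⟩ := Multiset.exists_mem_of_ne_zero hK
    exact Finset.card_pos.2 ⟨x.1, by simpa using ⟨x.2, hx⟩⟩

lemma Round.thrU_eq {R : Round} {I : Instr} (h : R.uni = some I) : R.thrU = (I.thr : ℝ) := by
  simp [Round.thrU, h]

lemma Round.thrU_nonneg {R : Round} (h : R.uni ≠ none) : 0 ≤ R.thrU := by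
  obtain ⟨I, hI⟩ := Option.ne_none_iff_exists'.1 h
  rw [Round.thrU_eq hI]
  exact I.thr.2.1

lemma Round.thrU_lt_one (R : Round) : R.thrU < 1 := by
  unfold Round.thrU
  split
  · norm_num
  · exact Subtype.prop (p := fun x : ℝ => x ∈ Set.Ico (0 : ℝ) 1) _ |>.2

lemma Round.thrM_lt_one (R : Round) : R.thrM < 1 := by
  unfold Round.thrM
  split
  · norm_num
  · exact Subtype.prop (p := fun x : ℝ => x ∈ Set.Ico (0 : ℝ) 1) _ |>.2

lemma Round.exists_thrM {R : Round} (h : R.mult ≠ []) : ∃ I ∈ R.mult, (I.thr : ℝ) = R.thrM := by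
  refine ⟨R.mult.getLast h, List.getLast_mem h, ?_⟩
  simp [Round.thrM, List.getLast?_eq_getLast_of_ne_nil h]

lemma Round.thrM_nonneg {R : Round} (h : R.mult ≠ []) : 0 ≤ R.thrM := by
  obtain ⟨I, -, hI⟩ := R.exists_thrM h
  exact hI ▸ I.thr.2.1

/-- The `mult` instructions being sorted, the last one has the smallest threshold. -/
lemma Round.thrM_le {R : Round} (hs : R.mult.Pairwise (fun I J => (J.thr : ℝ) ≤ (I.thr : ℝ)))
    {I : Instr} (hI : I ∈ R.mult) : R.thrM ≤ (I.thr : ℝ) := by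
  have hne : R.mult ≠ [] := List.ne_nil_of_mem hI
  simp only [Round.thrM, List.getLast?_eq_getLast_of_ne_nil hne]
  rw [← List.dropLast_append_getLast hne, List.pairwise_append] at hs
  rw [← List.dropLast_append_getLast hne, List.mem_append] at hI
  rcases hI with hI | hI
  · exact hs.2.2 I hI _ (by simp)
  · rw [List.mem_singleton.1 hI]

lemma Round.update_of_const {R : Round} {H : Multiset (Msg D)} {d : D} (hR : R.uni ≠ none)
    (hd : ∀ x ∈ defined H, x.1 = d) (hc : R.thrU * n < (defined H).card) :
    R.update n H = some d := by
  obtain ⟨I, hI⟩ := Option.ne_none_iff_exists'.1 hR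
  have hK : defined H ≠ 0 := by
    rintro h
    rw [h, Multiset.card_zero, Nat.cast_zero] at hc
    exact absurd hc (not_lt.2 (mul_nonneg (R.thrU_nonneg hR) (Nat.cast_nonneg n)))
  rw [Round.thrU_eq hI] at hc
  rw [Round.update, if_pos (numValues_eq_one hK hd), hI]
  split
  · exact Op.eval_const _ hK hd
  · rename_i hf
    exact absurd (by simpa using hc) (Option.filter_eq_none_iff.1 hf I rfl)

/-- The two ways in which a process obtains a value. -/
lemma Round.update_cases {R : Round} {H : Multiset (Msg D)} {d : D} (h : R.update n H = some d) :
    (∃ I, R.uni = some I ∧ (I.thr : ℝ) * n < (defined H).card ∧ I.op.eval (defined H) = some d ∧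
      ∀ x ∈ defined H, x.1 = d) ∨
    (∃ I ∈ R.mult, (I.thr : ℝ) * n < (defined H).card ∧ I.op.eval (defined H) = some d ∧
      1 < numValues (defined H)) := by
  unfold Round.update at h
  split_ifs at h with h1 h2
  · left
    split at h
    · rename_i I hI
      rw [Option.filter_eq_some_iff] at hI
      refine ⟨I, hI.1, by simpa using hI.2, h, fun x hx => ?_⟩
      obtain ⟨y, hy, rfl⟩ := Op.exists_mem_of_mem_candidates (Op.mem_candidates_of_eval h)
      by_contra hne
      exact absurd (one_lt_numValues_iff.2 ⟨x, hx, y, hy, hne⟩) (by omega)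
    · cases h
  · right
    split at h
    · rename_i I hI
      exact ⟨I, List.mem_of_find?_eq_some hI, by simpa using List.find?_some hI, h, h2⟩
    · cases h

lemma Round.exists_mem_of_update {R : Round} {H : Multiset (Msg D)} {d : D}
    (h : R.update n H = some d) : ∃ x ∈ defined H, x.1 = d := by
  rcases R.update_cases h with ⟨I, -, -, h, -⟩ | ⟨I, -, -, h, -⟩ <;>
  exact Op.exists_mem_of_mem_candidates (Op.mem_candidates_of_eval h)

lemma Round.update_eq_none_of_const {R : Round} {H : Multiset (Msg D)} {d : D}
    (hd : ∀ x ∈ defined H, x.1 = d) (hc : R.uni ≠ none → ((defined H).card : ℝ) ≤ R.thrU * n) :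
    R.update n H = none := by
  by_contra hne
  obtain ⟨e, he⟩ := Option.ne_none_iff_exists'.1 hne
  rcases R.update_cases he with ⟨I, hI, h1, -⟩ | ⟨I, -, -, -, h⟩
  · rw [Round.thrU_eq hI] at hc
    exact absurd (hc (by simp [hI])) (not_le.2 h1)
  · obtain ⟨x, hx, y, hy, hxy⟩ := one_lt_numValues_iff.1 h
    exact hxy ((hd x hx).trans (hd y hy).symm)

lemma Round.update_eq_none_of_mixed {R : Round} {H : Multiset (Msg D)}
    (hs : R.mult.Pairwise (fun I J => (J.thr : ℝ) ≤ (I.thr : ℝ)))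
    (hmix : ∃ x ∈ defined H, ∃ y ∈ defined H, x.1 ≠ y.1)
    (hc : R.mult ≠ [] → ((defined H).card : ℝ) ≤ R.thrM * n) :
    R.update n H = none := by
  by_contra hne
  obtain ⟨e, he⟩ := Option.ne_none_iff_exists'.1 hne
  rcases R.update_cases he with ⟨I, -, -, -, h⟩ | ⟨I, hI, h1, -⟩
  · obtain ⟨x, hx, y, hy, hxy⟩ := hmix
    exact hxy ((h x hx).trans (h y hy).symm)
  · have h2 := hc (List.ne_nil_of_mem hI)
    have h3 := mul_le_mul_of_nonneg_right (R.thrM_le hs hI) (Nat.cast_nonneg (α := ℝ) n)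
    linarith

lemma Round.update_of_mixed {R : Round} {H : Multiset (Msg D)} (hR : R.mult ≠ [])
    (hmix : ∃ x ∈ defined H, ∃ y ∈ defined H, x.1 ≠ y.1)
    (hc : R.thrM * n < (defined H).card) :
    ∃ I ∈ R.mult, R.update n H = I.op.eval (defined H) := by
  obtain ⟨J, hJ, hJt⟩ := R.exists_thrM hR
  have h2 := one_lt_numValues_iff.2 hmix
  rw [Round.update, if_neg (by omega), if_pos h2]
  cases hf : R.mult.find? (fun I => decide ((I.thr : ℝ) * n < ((defined H).card : ℝ))) with
  | none =>
    rw [List.find?_eq_none] at hf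
    exact absurd (hJt ▸ hc) (by simpa using hf J hJ)
  | some I => exact ⟨I, List.mem_of_find?_eq_some hf, by convert rfl⟩

lemma Round.update_of_mixed_head {R : Round} {H : Multiset (Msg D)} {I : Instr} {l : List Instr}
    (hR : R.mult = I :: l) (hmix : ∃ x ∈ defined H, ∃ y ∈ defined H, x.1 ≠ y.1)
    (hc : (I.thr : ℝ) * n < (defined H).card) :
    R.update n H = I.op.eval (defined H) := by
  have h2 := one_lt_numValues_iff.2 hmix
  rw [Round.update, if_neg (by omega), if_pos h2, hR, List.find?_cons_of_pos (by simpa using hc)]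

/-- A process receiving enough defined values obtains one. -/
lemma Round.update_ne_none {R : Round} {H : Multiset (Msg D)} (hU : R.uni ≠ none)
    (hM : R.mult ≠ []) (hcU : R.thrU * n < (defined H).card) (hcM : R.thrM * n < (defined H).card) :
    R.update n H ≠ none := by
  have hK : defined H ≠ 0 := by
    rintro h
    rw [h, Multiset.card_zero, Nat.cast_zero] at hcU
    exact absurd hcU (not_lt.2 (mul_nonneg (R.thrU_nonneg hU) (Nat.cast_nonneg n)))
  by_cases hmix : ∃ x ∈ defined H, ∃ y ∈ defined H, x.1 ≠ y.1
  · obtain ⟨I, -, hI⟩ := R.update_of_mixed hM hmix hcM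
    rw [hI]
    exact I.op.eval_ne_none hK
  · push Not at hmix
    obtain ⟨x, hx⟩ := Multiset.exists_mem_of_ne_zero hK
    rw [R.update_of_const hU (fun y hy => hmix y hy x hx) hcU]
    simp

end HeardOf

/-! ### Received multisets and round transitions -/

namespace HeardOf

variable {D : Type*} {n : ℕ}

/-- The message that process `p` sends in round `i`, as in `messages`. -/
def message (i : ℕ) (t : Fin n → ℕ) (f : Fin n → Option D) (p : Fin n) : Msg D :=
  (f p).map (fun d => (d, if i = 1 then t p else 0))

lemma message_eq_some {i : ℕ} {t : Fin n → ℕ} {f : Fin n → Option D} {p : Fin n} {x : D × ℕ} :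
    message i t f p = some x ↔ f p = some x.1 ∧ (if i = 1 then t p else 0) = x.2 := by
  obtain ⟨d, τ⟩ := x
  cases h : f p <;> simp [message, h]

lemma mem_defined {H : Multiset (Msg D)} {x : D × ℕ} : x ∈ defined H ↔ some x ∈ H := by
  simp [defined]

lemma mem_messages {i : ℕ} {t : Fin n → ℕ} {f : Fin n → Option D} {y : Msg D} :
    y ∈ messages i t f ↔ ∃ p, message i t f p = y := by
  simp [messages, message]

lemma card_filter_defined_map (s : Multiset (Fin n)) (g : Fin n → Msg D) (P : D × ℕ → Prop)
    [DecidablePred P] [DecidablePred fun p => ∃ x, g p = some x ∧ P x] :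
    ((defined (s.map g)).filter P).card = (s.filter fun p => ∃ x, g p = some x ∧ P x).card := by
  induction s using Multiset.induction_on with
  | empty => simp [defined]
  | cons p s ih =>
    rw [Multiset.map_cons]
    cases h : g p with
    | none =>
      rw [Multiset.filter_cons_of_neg _ (by simp [h]), ← ih]
      simp [defined]
    | some x =>
      by_cases hP : P x
      · rw [Multiset.filter_cons_of_pos _ ⟨x, h, hP⟩, Multiset.card_cons, ← ih]
        simp [defined, hP]
      · rw [Multiset.filter_cons_of_neg _ (by simp [h, hP]), ← ih]
        simp [defined, hP]

/-- If all defined messages in a received multiset satisfy `P`, then there are at most as many of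
them as there are senders of such messages. -/
lemma card_defined_le {i : ℕ} {t : Fin n → ℕ} {f : Fin n → Option D} {H : Multiset (Msg D)}
    (hH : H ≤ messages i t f) {P : D × ℕ → Prop} (hP : ∀ x ∈ defined H, P x)
    {S : Finset (Fin n)} (hS : ∀ p x, message i t f p = some x → P x → p ∈ S) :
    (defined H).card ≤ S.card := by
  classical
  have h1 : defined H ≤ defined (messages i t f) := Multiset.filterMap_le_filterMap _ hH
  have h2 := Multiset.filter_le_filter P h1
  rw [Multiset.filter_eq_self.2 hP] at h2
  refine (Multiset.card_le_card h2).trans ((card_filter_defined_map _ _ _).trans_le ?_)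
  refine Finset.card_le_card (s := Finset.univ.filter _) fun p hp => ?_
  obtain ⟨x, hx, hPx⟩ := (Finset.mem_filter.1 hp).2
  exact hS p x hx hPx

lemma card_defined_of_forall_ne_none {H : Multiset (Msg D)} (h : ∀ y ∈ H, y ≠ none) :
    (defined H).card = H.card := by
  induction H using Multiset.induction_on with
  | empty => rfl
  | cons y H ih =>
    cases y with
    | none => exact absurd rfl (h none (by simp))
    | some x =>
      have := ih fun y hy => h y (Multiset.mem_cons_of_mem hy)
      rw [Multiset.card_cons, ← this]
      simp [defined]

lemma card_defined_of_full {i : ℕ} {t : Fin n → ℕ} {f : Fin n → Option D} {H : Multiset (Msg D)}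
    (hH : H ≤ messages i t f) (hf : ∀ p, f p ≠ none) : (defined H).card = H.card := by
  refine card_defined_of_forall_ne_none fun y hy => ?_
  obtain ⟨p, rfl⟩ := mem_messages.1 (Multiset.mem_of_le hH hy)
  simpa [message] using hf p

lemma exists_sender {i : ℕ} {t : Fin n → ℕ} {f : Fin n → Option D} {H : Multiset (Msg D)}
    (hH : H ≤ messages i t f) {x : D × ℕ} (hx : x ∈ defined H) :
    ∃ p, f p = some x.1 ∧ (if i = 1 then t p else 0) = x.2 := by
  obtain ⟨p, hp⟩ := mem_messages.1 (Multiset.mem_of_le hH (mem_defined.1 hx))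
  exact ⟨p, message_eq_some.1 hp⟩

lemma RoundPred.thrVal_lt_one (φ : RoundPred) : φ.thrVal < 1 := by
  unfold RoundPred.thrVal
  cases φ.thr with
  | bot => norm_num [WithBot.recBotCoe]
  | coe c => exact c.2.2

lemma RoundPred.Sat.lt_card {φ : RoundPred} {H : Fin n → Multiset (Msg D)} (h : φ.Sat H) {c : ℝ}
    (h0 : 0 ≤ c) (hc : c ≤ φ.thrVal) (p : Fin n) : c * n < (H p).card := by
  cases hφ : φ.thr with
  | bot =>
    simp only [RoundPred.thrVal, hφ, WithBot.recBotCoe_bot] at hc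
    linarith
  | coe u =>
    simp only [RoundPred.thrVal, hφ, WithBot.recBotCoe_coe] at hc
    exact (mul_le_mul_of_nonneg_right hc (Nat.cast_nonneg n)).trans_lt (h.2 u hφ p)

lemma one_apply {q p : Fin n} {d : Option D} : one q d p = if p = q then d else none := by
  simp [one, Function.update_apply]

lemma one_none (q : Fin n) : one q (none : Option D) = solo n none := by
  funext p; simp [one_apply, solo]

variable [LinearOrder D] {A : Algorithm} {i : ℕ} {φ : RoundPred} {t : Fin n → ℕ}
  {f f' : Fin n → Option D}

lemma Algorithm.RoundStep.exists_update (h : A.RoundStep i φ t f f')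
    (hk : (A.round i).kind ≠ .ls) {p : Fin n} {d : D} (hp : f' p = some d) :
    ∃ H ≤ messages i t f, (A.round i).update n H = some d := by
  unfold Algorithm.RoundStep at h
  split at h
  · obtain ⟨H, -, hH, hf'⟩ := h
    exact ⟨H p, hH p, by rw [← hf', hp]⟩
  · obtain ⟨e, ⟨g, ⟨H, -, hH, hg⟩, p', hp'⟩, q, rfl⟩ := h
    rw [one_apply] at hp
    split_ifs at hp
    exact ⟨H p', hH p', by rw [← hg, hp', hp]⟩
  · contradiction

/-- No round creates values. -/
lemma Algorithm.RoundStep.exists_eq_some (h : A.RoundStep i φ t f f') {p : Fin n} {d : D}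
    (hp : f' p = some d) : ∃ q, f q = some d := by
  by_cases hk : (A.round i).kind = .ls
  · simp only [Algorithm.RoundStep, hk, Algorithm.LsStep] at h
    split_ifs at h
    · rw [h] at hp; cases hp
    · obtain ⟨q, e, rfl, rfl⟩ := h
      exact ⟨q, by simpa [one_apply, solo] using hp⟩
    · obtain ⟨e, ⟨q, rfl⟩, rfl⟩ := h
      exact ⟨q, hp⟩
    · obtain ⟨e, ⟨q, rfl⟩, h⟩ := h
      rcases h p with h | h
      · exact ⟨q, h ▸ hp⟩
      · rw [h] at hp; cases hp
  · obtain ⟨H, hH, hu⟩ := h.exists_update hk hp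
    obtain ⟨x, hx, rfl⟩ := Round.exists_mem_of_update hu
    obtain ⟨q, hq, -⟩ := exists_sender hH hx
    exact ⟨q, hq⟩

lemma Algorithm.PhaseStep.congr {m : ℕ} {π π' : PhasePred} {s s' : State n D}
    (h : A.PhaseStep m π s s') (hπ : ∀ i, 1 ≤ i → i ≤ A.r → π i = π' i) :
    A.PhaseStep m π' s s' := by
  obtain ⟨x, h0, h1, h2⟩ := h
  exact ⟨x, h0, fun i hi hr => hπ i hi hr ▸ h1 i hi hr, h2⟩

/-- A sporadic predicate absorbs the global one. -/
lemma Algorithm.SporadicImpliesGlobal.and_eq (h : A.SporadicImpliesGlobal) (j : Fin A.k)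
    (h1 : 1 ≤ i) (hr : i ≤ A.r) : (A.glob i).and (A.spor j i) = A.spor j i := by
  obtain ⟨he, hl, ht⟩ := h j i h1 hr
  ext1
  · simpa [RoundPred.and] using he
  · simpa [RoundPred.and] using hl
  · exact sup_eq_right.2 ht

end HeardOf

/-! ### Sufficiency: agreement -/

namespace HeardOf

variable {D : Type*} [LinearOrder D] {n : ℕ} {A : Algorithm}

open Classical in
/-- The value `d` is locked: the processes whose timestamp is at least some `m` all have value `d`,
and there are more of them than the `uni` threshold of round `ir + 1` requires. -/
def Algorithm.Locked (A : Algorithm) (s : State n D) (d : D) : Prop :=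
  ∃ m, (∀ p, m ≤ s.ts p → s.inp p = d) ∧
    (A.round (A.ir + 1)).thrU * n < (Finset.univ.filter fun p => m ≤ s.ts p).card

/-- If a value is locked, then no other value survives round 1: a multiset that is large enough for
an instruction to apply contains a locked value, and `maxts` returns it. -/
lemma Algorithm.Locked.round_one {s : State n D} {d : D} (hl : A.Locked s d)
    (hS : A.TSafe) (hk : (A.round 1).kind ≠ .ls) {φ : RoundPred} {f f' : Fin n → Option D}
    (hf : ∀ p, f p = some (s.inp p)) (h : A.RoundStep 1 φ s.ts f f') {p : Fin n} {e : D}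
    (hp : f' p = some e) : e = d := by
  classical
  obtain ⟨m, hm, hcard⟩ := hl
  have hr : 1 ≤ A.r := A.one_le_ir.trans A.ir_lt_r.le
  obtain ⟨H, hH, hu⟩ := h.exists_update hk hp
  obtain ⟨c, hc, hlt, hmem⟩ : ∃ c : ℝ, 1 - (A.round (A.ir + 1)).thrU ≤ c ∧
      c * n < (defined H).card ∧ e ∈ Op.maxts.candidates (defined H) := by
    rcases Round.update_cases hu with ⟨I, hI, h1, h2, -⟩ | ⟨I, hI, h1, h2, -⟩
    · refine ⟨I.thr, Round.thrU_eq hI ▸ hS.const_uni, h1, ?_⟩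
      rw [← (A.op_uni 1 le_rfl hr I hI).2 rfl]
      exact Op.mem_candidates_of_eval h2
    · refine ⟨I.thr, hS.const_mult.trans (Round.thrM_le (A.mult_sorted 1 le_rfl hr) hI), h1, ?_⟩
      rw [← (A.op_mult 1 le_rfl hr I hI).2 rfl]
      exact Op.mem_candidates_of_eval h2
  have hhit : ∃ y ∈ defined H, m ≤ y.2 := by
    by_contra! hno
    have h1 := card_defined_le hH (P := fun x => x.2 < m) hno
      (S := Finset.univ.filter fun p => ¬ m ≤ s.ts p) fun q x hq hlt => by
        simp only [Finset.mem_filter, Finset.mem_univ, true_and, not_le]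
        have := (message_eq_some.1 hq).2
        rw [if_pos rfl] at this
        rwa [this]
    have h3 := Finset.card_filter_add_card_filter_not (s := (Finset.univ : Finset (Fin n)))
      (fun p => m ≤ s.ts p)
    rw [Finset.card_univ, Fintype.card_fin] at h3
    have h4 : ((defined H).card : ℝ) +
        (Finset.univ.filter fun p => m ≤ s.ts p).card ≤ n := by
      exact_mod_cast (by omega : (defined H).card +
        (Finset.univ.filter fun p => m ≤ s.ts p).card ≤ n)
    nlinarith [mul_le_mul_of_nonneg_right hc (Nat.cast_nonneg (α := ℝ) n)]
  obtain ⟨y, hy, hym⟩ := hhit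
  simp only [Op.candidates, Multiset.mem_toFinset, Multiset.mem_map, Multiset.mem_filter] at hmem
  obtain ⟨x, ⟨hx, hmax⟩, rfl⟩ := hmem
  obtain ⟨q, hq, hqt⟩ := exists_sender hH hx
  rw [if_pos rfl] at hqt
  rw [hf, Option.some_inj] at hq
  rw [← hq]
  exact hm q (hqt ▸ hym.trans (hmax y hy))

/-- In round `ir` at most one value is obtained. -/
lemma Algorithm.RoundStep.ir_unique (hR : A.Restrictions)
    (hS : A.TSafe) {φ : RoundPred} {t : Fin n → ℕ} {f f' : Fin n → Option D}
    (h : A.RoundStep A.ir φ t f f') {p q : Fin n} {d e : D} (hp : f' p = some d)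
    (hq : f' q = some e) : d = e := by
  classical
  have huni := hS.uni _ A.one_le_ir A.ir_lt_r.le
  by_cases hk : (A.round A.ir).kind = .ls
  · simp only [Algorithm.RoundStep, hk, Algorithm.LsStep, if_neg huni] at h
    split_ifs at h
    · obtain ⟨-, c, -, rfl⟩ := h
      exact Option.some_inj.1 (hp.symm.trans hq)
    · obtain ⟨c, -, rfl⟩ := h
      exact Option.some_inj.1 (hp.symm.trans hq)
    · obtain ⟨c, -, h⟩ := h
      have h1 := (h p).resolve_right (by simp [hp])
      have h2 := (h q).resolve_right (by simp [hq])
      exact Option.some_inj.1 ((hp.symm.trans (h1.trans h2.symm)).trans hq)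
  · have key : ∀ p d, f' p = some d →
        (n : ℝ) < 2 * (Finset.univ.filter fun p => f p = some d).card := by
      intro p d hp
      obtain ⟨H, hH, hu⟩ := h.exists_update hk hp
      rcases Round.update_cases hu with ⟨I, hI, h1, -, hc⟩ | ⟨I, hI, -⟩
      · have h2 := hR.ir_uni hk huni
        rw [Round.thrU_eq hI] at h2
        have h3 := card_defined_le hH (P := fun x => x.1 = d) hc
          (S := Finset.univ.filter fun p => f p = some d) fun q x hq hx => by
            simpa [← hx] using (message_eq_some.1 hq).1
        have h5 : ((defined H).card : ℝ) ≤
            (Finset.univ.filter fun p => f p = some d).card := by exact_mod_cast h3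
        have h6 := mul_le_mul_of_nonneg_right h2 (Nat.cast_nonneg (α := ℝ) n)
        linarith
      · simp [hR.ir_mult] at hI
    by_contra hne
    have hdisj : Disjoint (Finset.univ.filter fun p => f p = some d)
        (Finset.univ.filter fun p => f p = some e) := by
      refine Finset.disjoint_left.2 fun q h1 h2 => hne ?_
      simp only [Finset.mem_filter, Finset.mem_univ, true_and] at h1 h2
      exact Option.some_inj.1 (h1.symm.trans h2)
    have h1 := Finset.card_le_univ ((Finset.univ.filter fun p => f p = some d) ∪
        (Finset.univ.filter fun p => f p = some e))
    rw [Finset.card_union_of_disjoint hdisj, Fintype.card_fin] at h1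
    have h2 : ((Finset.univ.filter fun p => f p = some d).card : ℝ) +
        (Finset.univ.filter fun p => f p = some e).card ≤ n := by exact_mod_cast h1
    have h3 := key p d hp
    have h4 := key q e hq
    linarith

/-- A value that survives round `ir + 1` has been adopted by many processes in round `ir`. -/
lemma Algorithm.RoundStep.lt_card {i : ℕ} {φ : RoundPred} {t : Fin n → ℕ}
    {f f' : Fin n → Option D} (h : A.RoundStep i φ t f f')
    (hk : (A.round i).kind ≠ .ls) {d : D} (hf : ∀ p e, f p = some e → e = d) {p : Fin n}
    {e : D} (hp : f' p = some e) : (A.round i).thrU * n <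
      (Finset.univ.filter fun p => f p = some d).card := by
  classical
  obtain ⟨H, hH, hu⟩ := h.exists_update hk hp
  have hc : ∀ x ∈ defined H, x.1 = d := fun x hx => by
    obtain ⟨q, hq, -⟩ := exists_sender hH hx
    exact hf q _ hq
  rcases Round.update_cases hu with ⟨I, hI, h1, -⟩ | ⟨I, -, -, -, h1⟩
  · rw [Round.thrU_eq hI]
    refine h1.trans_le ?_
    exact Nat.cast_le.2 (card_defined_le hH (P := fun x => x.1 = d) hc fun q x hq hx => by
      simpa [← hx] using (message_eq_some.1 hq).1)
  · obtain ⟨x, hx, y, hy, hxy⟩ := one_lt_numValues_iff.1 h1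
    exact absurd ((hc x hx).trans (hc y hy).symm) hxy

/-- If all values before some round are equal to `d`, then so are the later ones. -/
lemma values_eq_of_le {π : PhasePred} {t : Fin n → ℕ} {x : ℕ → Fin n → Option D}
    (hx : ∀ i, 1 ≤ i → i ≤ A.r → A.RoundStep i (π i) t (x (i - 1)) (x i)) {P : D → Prop} {i j : ℕ}
    (hij : i ≤ j) (hj : j ≤ A.r) (hi : ∀ p e, x i p = some e → P e) :
    ∀ p e, x j p = some e → P e := by
  induction j, hij using Nat.le_induction with
  | base => exact hi
  | succ j hij ih =>
    intro p e hp
    obtain ⟨q, hq⟩ := (hx (j + 1) (by omega) hj).exists_eq_some hp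
    exact ih (by omega) q e hq

lemma Algorithm.PhaseStep.locked_of_locked {m : ℕ} {π : PhasePred} {s s' : State n D} {d : D}
    (h : A.PhaseStep m π s s') (hts : ∀ p, s.ts p ≤ m) (hS : A.TSafe)
    (hk : (A.round 1).kind ≠ .ls) (hl : A.Locked s d) :
    A.Locked s' d ∧ ∀ p, s'.dec p = s.dec p ∨ s'.dec p = some d := by
  obtain ⟨x, h0, hx, hinp, hts', hdec⟩ := h
  have hir := A.one_le_ir
  have hr := A.ir_lt_r
  have h1 : ∀ p e, x 1 p = some e → e = d := fun p e hp =>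
    hl.round_one hS hk h0 (hx 1 le_rfl (by omega)) hp
  have hxir := values_eq_of_le hx hir hr.le h1
  have hxr := values_eq_of_le hx (by omega) le_rfl h1
  constructor
  · obtain ⟨k, hk1, hk2⟩ := hl
    refine ⟨k, fun p hp => ?_, hk2.trans_le (Nat.cast_le.2 (Finset.card_le_card fun p hp => ?_))⟩
    · rw [hinp]
      cases hxp : x A.ir p with
      | none =>
        rw [hts', hxp] at hp
        exact hk1 p (by simpa using hp)
      | some e => exact hxir p e hxp
    · simp only [Finset.mem_filter, Finset.mem_univ, true_and] at hp ⊢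
      rw [hts']
      split_ifs
      · exact hp.trans (hts p)
      · exact hp
  · intro p
    rw [hdec]
    cases s.dec p with
    | some e => exact Or.inl rfl
    | none =>
      cases hxp : x A.r p with
      | none => exact Or.inl rfl
      | some e => exact Or.inr (by rw [hxr p e hxp]; rfl)

/-- A phase in which some process decides locks the value of the decision. -/
lemma Algorithm.PhaseStep.locked_of_decision {m : ℕ} {π : PhasePred} {s s' : State n D}
    (h : A.PhaseStep (m + 1) π s s') (hts : ∀ p, s.ts p ≤ m) (hS : A.TSafe)
    (hR : A.Restrictions) (hk : (A.round (A.ir + 1)).kind ≠ .ls)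
    (hdec : ∀ p, s.dec p = none) :
    (∀ p, s'.dec p = none) ∨
      ∃ d, A.Locked s' d ∧ ∀ p, s'.dec p = none ∨ s'.dec p = some d := by
  obtain ⟨x, h0, hx, hinp, hts', hdec'⟩ := h
  have hir := A.one_le_ir
  have hr := A.ir_lt_r
  by_cases hno : ∀ p, x A.r p = none
  · left
    intro p
    rw [hdec', hdec, hno]; rfl
  right
  push Not at hno
  obtain ⟨p₀, hp₀⟩ := hno
  obtain ⟨d, hd⟩ := Option.ne_none_iff_exists'.1 hp₀
  have hxir : ∀ p e, x A.ir p = some e → e = d := by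
    obtain ⟨q, hq⟩ : ∃ q, x A.ir q = some d := by
      by_contra! hne
      exact values_eq_of_le hx hr.le le_rfl (P := fun e => e ≠ d)
        (fun p e hp he => hne p (he ▸ hp)) p₀ d hd rfl
    intro p e hp
    exact (hx A.ir hir hr.le).ir_unique hR hS hp hq
  have hxr := values_eq_of_le hx hr.le le_rfl hxir
  obtain ⟨q, e, hq⟩ : ∃ q e, x (A.ir + 1) q = some e := by
    by_contra! hne
    exact values_eq_of_le hx (i := A.ir + 1) hr le_rfl (P := fun _ => False)
      (fun p e hp => hne p e hp) p₀ d hd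
  have hcard := (hx (A.ir + 1) (by omega) hr).lt_card hk (by simpa using hxir) hq
  rw [Nat.add_sub_cancel] at hcard
  refine ⟨d, ⟨m + 1, fun p hp => ?_, hcard.trans_le (Nat.cast_le.2 ?_)⟩, fun p => ?_⟩
  · rw [hinp]
    cases hxp : x A.ir p with
    | some e => exact hxir p e hxp
    | none =>
      have := hts p
      rw [hts', hxp] at hp
      simp at hp
      omega
  · refine Finset.card_le_card fun p hp => ?_
    simp only [Finset.mem_filter, Finset.mem_univ, true_and] at hp ⊢
    rw [hts', hp]; simp
  · rw [hdec', hdec]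
    cases hxp : x A.r p with
    | none => exact Or.inl rfl
    | some e => exact Or.inr (by rw [hxr p e hxp]; rfl)

lemma Algorithm.IsExecution.exists_phaseStep {σ : ℕ → State n D} (h : A.IsExecution σ) (l : ℕ) :
    ∃ π, A.PhaseStep (l + 1) π (σ l) (σ (l + 1)) := by
  obtain ⟨-, -, m, -, h1, h2⟩ := h
  by_cases hl : ∃ j, m j = l
  · obtain ⟨j, rfl⟩ := hl
    exact ⟨_, h1 j⟩
  · push Not at hl
    exact ⟨_, h2 l hl⟩

theorem Algorithm.agreement_of_tSafe (hS : A.TSafe) (hR : A.Restrictions)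
    (hk1 : (A.round 1).kind ≠ .ls) (hk : (A.round (A.ir + 1)).kind ≠ .ls) : A.Agreement D := by
  intro n σ hσ
  have key : ∀ l, (∀ p, (σ l).ts p ≤ l) ∧ ((∀ p, (σ l).dec p = none) ∨
      ∃ d, A.Locked (σ l) d ∧ ∀ p, (σ l).dec p = none ∨ (σ l).dec p = some d) := by
    intro l
    induction l with
    | zero => exact ⟨fun p => (hσ.1 p).le, Or.inl hσ.2.1⟩
    | succ l ih =>
      obtain ⟨hts, ih⟩ := ih
      obtain ⟨π, hstep⟩ := hσ.exists_phaseStep l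
      refine ⟨fun p => ?_, ?_⟩
      · obtain ⟨x, -, -, -, hts', -⟩ := hstep
        rw [hts']
        split_ifs
        · exact le_rfl
        · exact (hts p).trans (Nat.le_succ l)
      · rcases ih with ih | ⟨d, hl, hd⟩
        · exact hstep.locked_of_decision hts hS hR hk ih
        · obtain ⟨h1, h2⟩ := hstep.locked_of_locked
            (fun p => (hts p).trans (Nat.le_succ l)) hS hk1 hl
          refine Or.inr ⟨d, h1, fun p => ?_⟩
          rcases h2 p with h | h
          · rw [h]; exact hd p
          · exact Or.inr h
  intro l p q
  rcases (key l).2 with h | ⟨d, -, h⟩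
  · exact Or.inr (Or.inl (h p))
  · rcases h p with hp | hp
    · exact Or.inr (Or.inl hp)
    · rcases h q with hq | hq
      · exact Or.inr (Or.inr hq)
      · exact Or.inl (hp.trans hq.symm)

end HeardOf

/-! ### Sufficiency: termination -/

namespace HeardOf

variable {D : Type*} {n : ℕ} {A : Algorithm}

/-- After round `i` the value `d` is known wherever the type of the round allows it: at one process
if round `i` is an `lr` round, and everywhere otherwise.  At `i = 0`, before the first round, it is
known everywhere. -/
def Algorithm.Carries (A : Algorithm) (i : ℕ) (d : D) (f : Fin n → Option D) : Prop :=
  (1 ≤ i ∧ (A.round i).kind = .lr ∧ ∃ q, f = one q (some d)) ∨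
    ((i = 0 ∨ (A.round i).kind ≠ .lr) ∧ f = solo n (some d))

/-- After round `i` values are known wherever the type of the round allows it. -/
def Algorithm.Full (A : Algorithm) (i : ℕ) (f : Fin n → Option D) : Prop :=
  (1 ≤ i ∧ (A.round i).kind = .lr ∧ ∃ q d, f = one q (some d)) ∨
    ((i = 0 ∨ (A.round i).kind ≠ .lr) ∧ ∀ p, f p ≠ none)

lemma Algorithm.Carries.full {i : ℕ} {d : D} {f : Fin n → Option D} (h : A.Carries i d f) :
    A.Full i f := by
  rcases h with ⟨h1, h2, q, h3⟩ | ⟨h1, rfl⟩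
  · exact Or.inl ⟨h1, h2, q, d, h3⟩
  · exact Or.inr ⟨h1, fun p => by simp [solo]⟩

lemma Algorithm.Carries.eq_solo {i : ℕ} {d : D} {f : Fin n → Option D} (h : A.Carries i d f)
    (hk : (A.round i).kind ≠ .lr) : f = solo n (some d) := by
  rcases h with ⟨-, h, -⟩ | ⟨-, h⟩
  · exact absurd h hk
  · exact h

/-- An `lr` round is followed by an `ls` round, so in the other rounds everybody sends a value. -/
lemma Algorithm.Full.ne_none (hL : A.LeaderAssumption) {i : ℕ} {f : Fin n → Option D}
    (h : A.Full i f) (hi : i < A.r) (hk : (A.round (i + 1)).kind ≠ .ls) (p : Fin n) :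
    f p ≠ none := by
  rcases h with ⟨h1, h2, -⟩ | ⟨-, h⟩
  · exact absurd (hL.lr_ls i h1 hi h2) hk
  · exact h p

lemma Algorithm.Carries.solo_of_next (hL : A.LeaderAssumption) {i : ℕ} {d : D}
    {f : Fin n → Option D} (h : A.Carries i d f) (hi : i < A.r)
    (hk : (A.round (i + 1)).kind ≠ .ls) : f = solo n (some d) := by
  rcases h with ⟨h1, h2, -⟩ | ⟨-, h⟩
  · exact absurd (hL.lr_ls i h1 hi h2) hk
  · exact h

variable [LinearOrder D]

/-- In an `ls` round with `φ_ls` everybody receives the same value. -/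
lemma Algorithm.Full.exists_solo_of_leader {i : ℕ} {π : PhasePred} {t : Fin n → ℕ}
    {f f' : Fin n → Option D} (h : A.Full i f) (huni : (A.round (i + 1)).uni ≠ none)
    (hk : (A.round (i + 1)).kind = .ls) (hl : (π (i + 1)).leader = true)
    (hstep : A.RoundStep (i + 1) (π (i + 1)) t f f') :
    ∃ d p, f p = some d ∧ f' = solo n (some d) := by
  simp only [Algorithm.RoundStep, hk, Algorithm.LsStep, if_neg huni, if_pos hl,
    Nat.add_sub_cancel] at hstep
  split_ifs at hstep with hlr
  · obtain ⟨q, e, rfl, rfl⟩ := hstep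
    rcases h with ⟨-, -, q', d, hq⟩ | ⟨h1, -⟩
    · have h2 := congrFun hq q'
      simp only [one_apply, if_true] at h2
      split_ifs at h2 with hqq
      exact ⟨d, q, by simp [one_apply, h2], by rw [h2]⟩
    · rcases h1 with h1 | h1
      · omega
      · exact absurd hlr.2 h1
  · obtain ⟨e, ⟨q, rfl⟩, rfl⟩ := hstep
    rcases h with ⟨h1, h2, -⟩ | ⟨-, h⟩
    · exact absurd ⟨by omega, h2⟩ hlr
    · obtain ⟨d, hd⟩ := Option.ne_none_iff_exists'.1 (h q)
      exact ⟨d, q, hd, by rw [hd]⟩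

lemma Algorithm.Carries.succ_of_soloSafe (hL : A.LeaderAssumption) {i : ℕ} {d : D} {π : PhasePred}
    {t : Fin n → ℕ} {f f' : Fin n → Option D} (h : A.Carries i d f) (hi : i < A.r)
    (huni : (A.round (i + 1)).uni ≠ none) (hs : A.CSoloSafe π (i + 1))
    (hstep : A.RoundStep (i + 1) (π (i + 1)) t f f') : A.Carries (i + 1) d f' := by
  by_cases hk : (A.round (i + 1)).kind = .ls
  · simp only [Algorithm.CSoloSafe, hk] at hs
    obtain ⟨e, p, he, rfl⟩ := h.full.exists_solo_of_leader huni hk hs hstep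
    refine Or.inr ⟨Or.inr (by simp [hk]), ?_⟩
    rcases h with ⟨-, -, q, rfl⟩ | ⟨-, rfl⟩
    · rw [one_apply] at he
      split_ifs at he
      rw [he]
    · rw [← he]; rfl
  · have hs' : 0 ≤ (A.round (i + 1)).thrU ∧ (A.round (i + 1)).thrU ≤ (π (i + 1)).thrVal := by
      revert hs
      cases hkk : (A.round (i + 1)).kind <;> simp_all [Algorithm.CSoloSafe]
    obtain rfl := h.solo_of_next hL hi hk
    have key : ∀ (H : Fin n → Multiset (Msg D)) p, (π (i + 1)).Sat H →
        H p ≤ messages (i + 1) t (solo n (some d)) →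
        (A.round (i + 1)).update n (H p) = some d := by
      intro H p hsat hH
      refine Round.update_of_const huni (fun x hx => ?_) ?_
      · obtain ⟨q, hq, -⟩ := exists_sender hH hx
        exact (Option.some_inj.1 hq).symm
      · rw [card_defined_of_full hH (by simp [solo])]
        exact hsat.lt_card hs'.1 hs'.2 p
    unfold Algorithm.RoundStep at hstep
    split at hstep
    · obtain ⟨H, hsat, hH, hf'⟩ := hstep
      refine Or.inr ⟨Or.inr (by simp_all), funext fun p => ?_⟩
      rw [hf', key H p hsat (hH p)]; rfl
    · obtain ⟨e, ⟨g, ⟨H, hsat, hH, hg⟩, p, hp⟩, q, rfl⟩ := hstep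
      refine Or.inl ⟨by omega, by assumption, q, ?_⟩
      rw [← hp, hg, key H p hsat (hH p)]
    · contradiction

/-- In a round that is not c-preserving, everybody who may receive something obtains a value. If
the predicate of the round is moreover a c-equalizer, then all obtain the same value. -/
lemma Algorithm.Full.succ (hL : A.LeaderAssumption) {i : ℕ} {π : PhasePred}
    {t : Fin n → ℕ} {f f' : Fin n → Option D} (hn : 0 < n) (h : A.Full i f) (hi : i < A.r)
    (huni : (A.round (i + 1)).uni ≠ none)
    (hls : (A.round (i + 1)).kind = .ls → (π (i + 1)).leader = true)
    (hleader : (π (i + 1)).leader = true → (A.round (i + 1)).kind = .ls)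
    (hmult : (A.round (i + 1)).kind ≠ .ls → (A.round (i + 1)).mult ≠ [] ∧
      (A.round (i + 1)).thrU ≤ (π (i + 1)).thrVal ∧ (A.round (i + 1)).thrM ≤ (π (i + 1)).thrVal)
    (hstep : A.RoundStep (i + 1) (π (i + 1)) t f f') :
    A.Full (i + 1) f' ∧ ((π (i + 1)).CEqualizer → ∃ d, A.Carries (i + 1) d f') := by
  by_cases hk : (A.round (i + 1)).kind = .ls
  · obtain ⟨e, p, -, rfl⟩ := h.exists_solo_of_leader huni hk (hls hk) hstep
    have hc : A.Carries (i + 1) e (solo n (some e)) := Or.inr ⟨Or.inr (by simp [hk]), rfl⟩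
    exact ⟨hc.full, fun _ => ⟨e, hc⟩⟩
  · obtain ⟨hM, hcU, hcM⟩ := hmult hk
    have hf := h.ne_none hL hi hk
    have key : ∀ (H : Fin n → Multiset (Msg D)) p, (π (i + 1)).Sat H →
        H p ≤ messages (i + 1) t f → (A.round (i + 1)).update n (H p) ≠ none := by
      intro H p hsat hH
      refine Round.update_ne_none huni hM ?_ ?_ <;> rw [card_defined_of_full hH hf]
      · exact hsat.lt_card (Round.thrU_nonneg huni) hcU p
      · exact hsat.lt_card (Round.thrM_nonneg hM) hcM p
    unfold Algorithm.RoundStep at hstep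
    split at hstep
    · obtain ⟨H, hsat, hH, hf'⟩ := hstep
      refine ⟨Or.inr ⟨Or.inr (by simp_all), fun p => hf' p ▸ key H p hsat (hH p)⟩, fun heq => ?_⟩
      have heq := hsat.1 (heq.resolve_right fun h => hk (hleader h))
      obtain ⟨d, hd⟩ := Option.ne_none_iff_exists'.1 (key H ⟨0, hn⟩ hsat (hH _))
      refine ⟨d, Or.inr ⟨Or.inr (by simp_all), funext fun p => ?_⟩⟩
      rw [hf', heq p ⟨0, hn⟩, hd]; rfl
    · obtain ⟨e, ⟨g, ⟨H, hsat, hH, hg⟩, p, hp⟩, q, rfl⟩ := hstep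
      obtain ⟨d, hd⟩ := Option.ne_none_iff_exists'.1 (key H p hsat (hH p))
      have hc : A.Carries (i + 1) d (one q e) :=
        Or.inl ⟨by omega, by assumption, q, by rw [← hp, hg, hd]⟩
      exact ⟨hc.full, fun _ => ⟨d, hc⟩⟩
    · contradiction

lemma Algorithm.mult_ne_nil_of_not_cPreserving {π : PhasePred} {i : ℕ}
    (h : ¬ A.CPreserving π i) (hk : (A.round i).kind ≠ .ls) :
    (A.round i).mult ≠ [] ∧ (A.round i).thrU ≤ (π i).thrVal ∧
      (A.round i).thrM ≤ (π i).thrVal := by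
  unfold Algorithm.CPreserving at h
  split at h
  · contradiction
  · push Not at h
    exact ⟨h.2.1, max_le_iff.1 h.2.2⟩

lemma Algorithm.leader_of_not_cPreserving {π : PhasePred} {i : ℕ}
    (h : ¬ A.CPreserving π i) (hk : (A.round i).kind = .ls) : (π i).leader = true := by
  simpa [Algorithm.CPreserving, hk] using h

lemma carries_of_soloSafe (hL : A.LeaderAssumption) {π : PhasePred} {t : Fin n → ℕ}
    {x : ℕ → Fin n → Option D} (huni : ∀ i, 1 ≤ i → i ≤ A.r → (A.round i).uni ≠ none)
    (hx : ∀ i, 1 ≤ i → i ≤ A.r → A.RoundStep i (π i) t (x (i - 1)) (x i)) {i j : ℕ} {d : D}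
    (hij : i ≤ j) (hj : j ≤ A.r) (hs : ∀ k, i + 1 ≤ k → k ≤ j → A.CSoloSafe π k)
    (hi : A.Carries i d (x i)) : A.Carries j d (x j) := by
  induction j, hij using Nat.le_induction with
  | base => exact hi
  | succ j hij ih =>
    exact (ih (by omega) fun k h1 h2 => hs k h1 (by omega)).succ_of_soloSafe hL (by omega)
      (huni _ (by omega) hj) (hs _ (by omega) le_rfl) (hx (j + 1) (by omega) hj)

/-- After a phase under a strong c-unifier all processes have the same value, and they have decided
on it if the predicate is also a c-decider. -/
lemma Algorithm.PhaseStep.unify (hL : A.LeaderAssumption) (hS : A.TSafe)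
    (hk1 : (A.round 1).kind ≠ .ls) {π : PhasePred} (hn : 0 < n)
    (hleader : ∀ i, 1 ≤ i → i ≤ A.r → (π i).leader = true → (A.round i).kind = .ls)
    (hU : A.StrongCUnifier π) {m : ℕ} {s s' : State n D} (h : A.PhaseStep m π s s') :
    (∃ d, ∀ p, s'.inp p = d) ∧ (A.CDecider π → ∀ p, s'.dec p ≠ none) := by
  obtain ⟨x, h0, hx, hinp, -, hdec⟩ := h
  obtain ⟨⟨hM, -, i, hi1, hir, heq, hpres, hsafe⟩, hUthr⟩ := hU
  have hr := A.ir_lt_r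
  have step : ∀ j, j < i → A.Full j (x j) → A.Full (j + 1) (x (j + 1)) ∧
      ((π (j + 1)).CEqualizer → ∃ d, A.Carries (j + 1) d (x (j + 1))) := by
    intro j hj hfull
    refine hfull.succ hL hn (by omega) (hS.uni _ (by omega) (by omega)) (fun hk => ?_)
      (hleader _ (by omega) (by omega)) (fun hk => ?_) (hx (j + 1) (by omega) (by omega))
    · cases j with
      | zero => exact absurd hk hk1
      | succ j => exact A.leader_of_not_cPreserving (hpres _ (by omega) hj) hk
    · cases j with
      | zero => exact ⟨hS.mult, hUthr, hM⟩
      | succ j => exact A.mult_ne_nil_of_not_cPreserving (hpres _ (by omega) hj) hk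
  have hfull : ∀ j, j < i → A.Full j (x j) := by
    intro j
    induction j with
    | zero => exact fun _ => Or.inr ⟨Or.inl rfl, fun p => by simp [h0]⟩
    | succ j ih => exact fun hj => (step j (by omega) (ih (by omega))).1
  obtain ⟨j, rfl⟩ : ∃ j, i = j + 1 := ⟨i - 1, by omega⟩
  obtain ⟨d, hd⟩ := (step j (by omega) (hfull j (by omega))).2 heq
  have hir' := carries_of_soloSafe hL hS.uni hx hir hr.le hsafe hd
  refine ⟨⟨d, fun p => ?_⟩, fun hD p => ?_⟩
  · rw [hinp, hir'.eq_solo hL.ir_kind]; rfl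
  · have := carries_of_soloSafe hL hS.uni hx hr.le le_rfl
      (fun k h1 h2 => hD k (by omega) h2) hir'
    rw [hdec, this.eq_solo hL.last_kind]
    cases s.dec p <;> simp [solo]

/-- If all processes have the same value, then they keep it, and they decide in a phase under a
c-decider. -/
lemma Algorithm.PhaseStep.decide (hL : A.LeaderAssumption) (hS : A.TSafe)
    {π : PhasePred} {m : ℕ} {s s' : State n D} (h : A.PhaseStep m π s s') {d : D}
    (hs : ∀ p, s.inp p = d) :
    (∀ p, s'.inp p = d) ∧ (A.CDecider π → ∀ p, s'.dec p ≠ none) := by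
  obtain ⟨x, h0, hx, hinp, -, hdec⟩ := h
  have hr := A.ir_lt_r
  have hval := values_eq_of_le hx (Nat.zero_le A.ir) hr.le (P := fun e => e = d)
    fun p e hp => by rw [h0, hs] at hp; exact (Option.some_inj.1 hp).symm
  refine ⟨fun p => ?_, fun hD p => ?_⟩
  · rw [hinp]
    cases hxp : x A.ir p with
    | none => exact hs p
    | some e => exact hval p e hxp
  · have h1 : A.Carries 0 d (x 0) :=
      Or.inr ⟨Or.inl rfl, funext fun p => by rw [h0, hs]; rfl⟩
    have := carries_of_soloSafe hL hS.uni hx (Nat.zero_le A.r) le_rfl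
      (fun k h1 h2 => hD k (by omega) h2) h1
    rw [hdec, this.eq_solo hL.last_kind]
    cases s.dec p <;> simp [solo]

theorem Algorithm.termination_of_unifier_decider (hImp : A.SporadicImpliesGlobal)
    (hL : A.LeaderAssumption) (hS : A.TSafe) (hk1 : (A.round 1).kind ≠ .ls) {i j : Fin A.k}
    (hij : i ≤ j) (hU : A.StrongCUnifier (A.spor i)) (hD : A.CDecider (A.spor j)) :
    A.Termination D := by
  intro n σ hσ
  rcases Nat.eq_zero_or_pos n with rfl | hn
  · exact ⟨0, fun p => p.elim0⟩
  have hphase := hσ.exists_phaseStep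
  obtain ⟨-, -, m, hm, hspor, -⟩ := hσ
  have hspor' : ∀ j, A.PhaseStep (m j + 1) (A.spor j) (σ (m j)) (σ (m j + 1)) := fun j =>
    (hspor j).congr fun i h1 h2 => hImp.and_eq j h1 h2
  refine ⟨m j + 1, ?_⟩
  obtain ⟨⟨d, hd⟩, hdec⟩ := (hspor' i).unify hL hS hk1 hn (hL.spor_leader i) hU
  rcases hij.eq_or_lt with rfl | hlt
  · exact hdec hD
  have hkeep : ∀ l, m i + 1 ≤ l → ∀ p, (σ l).inp p = d := by
    intro l hl
    induction l, hl using Nat.le_induction with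
    | base => exact hd
    | succ l _ ih =>
      obtain ⟨π, hπ⟩ := hphase l
      exact (hπ.decide hL hS ih).1
  exact ((hspor' j).decide hL hS (hkeep _ (hm hlt))).2 hD

end HeardOf

/-! ### Necessity: building transitions and phases -/

namespace HeardOf

variable {D : Type*} {n : ℕ}

/-- The multiset received in round `i` by a process that hears exactly of the processes in `T`. -/
def received (i : ℕ) (t : Fin n → ℕ) (f : Fin n → Option D) (T : Finset (Fin n)) :
    Multiset (Msg D) :=
  T.val.map (message i t f)

lemma received_le (i : ℕ) (t : Fin n → ℕ) (f : Fin n → Option D) (T : Finset (Fin n)) :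
    received i t f T ≤ messages i t f :=
  Multiset.map_le_map (Finset.val_le_iff.2 T.subset_univ)

lemma mem_defined_received {i : ℕ} {t : Fin n → ℕ} {f : Fin n → Option D} {T : Finset (Fin n)}
    {x : D × ℕ} : x ∈ defined (received i t f T) ↔
      ∃ p ∈ T, f p = some x.1 ∧ (if i = 1 then t p else 0) = x.2 := by
  simp only [mem_defined, received, Multiset.mem_map, Finset.mem_val, message_eq_some]

lemma card_received (i : ℕ) (t : Fin n → ℕ) (f : Fin n → Option D) (T : Finset (Fin n)) :
    (received i t f T).card = T.card := by
  simp [received]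

lemma card_defined_received (i : ℕ) (t : Fin n → ℕ) (f : Fin n → Option D) (T : Finset (Fin n)) :
    (defined (received i t f T)).card = (T.filter fun p => (f p).isSome).card := by
  classical
  have h := card_filter_defined_map T.val (message i t f) (fun _ => True)
  rw [Multiset.filter_eq_self.2 (fun _ _ => trivial)] at h
  rw [received, h, Finset.card, Finset.filter_val]
  refine congrArg _ (Multiset.filter_congr fun p _ => ?_)
  cases hf : f p <;> simp [message, hf]

lemma card_defined_received_some (i : ℕ) (t : Fin n → ℕ) (g : Fin n → D) (T : Finset (Fin n)) :
    (defined (received i t (fun p => some (g p)) T)).card = T.card := by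
  simp [card_defined_received]

variable [LinearOrder D] {A : Algorithm}

/-- What a process obtains in round `i` if it hears exactly of the processes in `T`. -/
noncomputable def Algorithm.obtain (A : Algorithm) (i : ℕ) (t : Fin n → ℕ) (f : Fin n → Option D)
    (T : Finset (Fin n)) : Option D :=
  (A.round i).update n (received i t f T)

lemma Algorithm.everyStep_of_senders {i : ℕ} {φ : RoundPred} {t : Fin n → ℕ}
    {f : Fin n → Option D} (T : Fin n → Finset (Fin n))
    (hT : ∀ p, φ.thrVal * n < (T p).card) (heq : φ.equal = true → ∀ p q, T p = T q) :
    A.EveryStep i φ t f fun p => A.obtain i t f (T p) := by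
  refine ⟨fun p => received i t f (T p), ⟨fun h p q => congrArg (received i t f) (heq h p q),
    fun c hc p => ?_⟩,
    fun p => received_le _ _ _ _, fun p => rfl⟩
  rw [card_received]
  simpa [RoundPred.thrVal, hc] using hT p

lemma Algorithm.lrStep_of_senders {i : ℕ} {φ : RoundPred} {t : Fin n → ℕ}
    {f : Fin n → Option D} {T : Finset (Fin n)} (hk : (A.round i).kind = .lr)
    (hT : φ.thrVal * n < T.card) (q : Fin n) :
    A.RoundStep i φ t f (one q (A.obtain i t f T)) := by
  simp only [Algorithm.RoundStep, hk]
  exact ⟨_, ⟨_, Algorithm.everyStep_of_senders (fun _ => T) (fun _ => hT) fun _ _ _ => rfl, q, rfl⟩,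
    q, rfl⟩

/-- If some process may obtain nothing, then it is possible that all obtain nothing. -/
lemma Algorithm.roundStep_none_of_senders {i : ℕ} {φ : RoundPred} {t : Fin n → ℕ}
    {f : Fin n → Option D} (hn : 0 < n) {T : Finset (Fin n)} (hk : (A.round i).kind ≠ .ls)
    (hT : φ.thrVal * n < T.card) (h : A.obtain i t f T = none) :
    A.RoundStep i φ t f (solo n none) := by
  cases hkk : (A.round i).kind with
  | every =>
    simp only [Algorithm.RoundStep, hkk]
    have := A.everyStep_of_senders (i := i) (φ := φ) (t := t) (f := f) (fun _ => T) (fun _ => hT)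
      fun _ _ _ => rfl
    rwa [h] at this
  | lr =>
    have := A.lrStep_of_senders (t := t) (f := f) hkk hT ⟨0, hn⟩
    rwa [h, one_none] at this
  | ls => exact absurd hkk hk

/-- If some process may obtain `d`, then it is possible that `d` is carried on. -/
lemma Algorithm.exists_carries_of_senders {i : ℕ} {φ : RoundPred} {t : Fin n → ℕ}
    {f : Fin n → Option D} (hn : 0 < n) (hi : 1 ≤ i) {T : Finset (Fin n)}
    (hk : (A.round i).kind ≠ .ls) (hT : φ.thrVal * n < T.card) {d : D}
    (h : A.obtain i t f T = some d) : ∃ f', A.RoundStep i φ t f f' ∧ A.Carries i d f' := by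
  cases hkk : (A.round i).kind with
  | every =>
    refine ⟨solo n (some d), ?_, Or.inr ⟨Or.inr (by simp [hkk]), rfl⟩⟩
    simp only [Algorithm.RoundStep, hkk]
    have := A.everyStep_of_senders (i := i) (φ := φ) (t := t) (f := f) (fun _ => T) (fun _ => hT)
      fun _ _ _ => rfl
    rwa [h] at this
  | lr =>
    have := A.lrStep_of_senders (t := t) (f := f) hkk hT ⟨0, hn⟩
    rw [h] at this
    exact ⟨_, this, Or.inl ⟨hi, hkk, _, rfl⟩⟩
  | ls => exact absurd hkk hk

lemma Algorithm.lsStep_none {i : ℕ} {φ : RoundPred} {t : Fin n → ℕ} {f : Fin n → Option D}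
    (hn : 0 < n) (hk : (A.round i).kind = .ls) (hl : φ.leader = false) :
    A.RoundStep i φ t f (solo n none) := by
  simp only [Algorithm.RoundStep, hk, Algorithm.LsStep, hl, Bool.false_eq_true,
    if_false]
  split_ifs
  · exact ⟨_, ⟨⟨0, hn⟩, rfl⟩, fun _ => Or.inr rfl⟩

/-! ### Sequences of rounds -/

/-- The rounds `i + 1, …, j` may lead from `f` to `g`. -/
def Algorithm.Path (A : Algorithm) (π : PhasePred) (t : Fin n → ℕ) (i : ℕ) (f : Fin n → Option D)
    (j : ℕ) (g : Fin n → Option D) : Prop :=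
  ∃ x : ℕ → Fin n → Option D, i ≤ j ∧ x i = f ∧ x j = g ∧
    ∀ k, i < k → k ≤ j → A.RoundStep k (π k) t (x (k - 1)) (x k)

section Path

variable {π : PhasePred} {t : Fin n → ℕ}

lemma Algorithm.Path.refl (i : ℕ) (f : Fin n → Option D) : A.Path π t i f i f :=
  ⟨fun _ => f, le_rfl, rfl, rfl, fun _ h1 h2 => absurd h1 (not_lt.2 h2)⟩

lemma Algorithm.Path.trans {i j k : ℕ} {f g h : Fin n → Option D} (h1 : A.Path π t i f j g)
    (h2 : A.Path π t j g k h) : A.Path π t i f k h := by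
  obtain ⟨x, hij, hxi, hxj, hx⟩ := h1
  obtain ⟨y, hjk, hyj, hyk, hy⟩ := h2
  refine ⟨fun l => if l ≤ j then x l else y l, hij.trans hjk, by simp [hij, hxi], ?_,
    fun l hl1 hl2 => ?_⟩
  · by_cases hkj : k ≤ j
    · obtain rfl := le_antisymm hkj hjk
      simp [hxj, ← hyj, hyk]
    · simp [hkj, hyk]
  · rcases lt_trichotomy l (j + 1) with hl | rfl | hl
    · simpa [show l ≤ j by omega, show l - 1 ≤ j by omega] using hx l hl1 (by omega)
    · simpa [hxj, ← hyj] using hy (j + 1) (by omega) hl2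
    · simpa [show ¬ l ≤ j by omega, show ¬ l - 1 ≤ j by omega] using hy l (by omega) hl2

lemma Algorithm.RoundStep.path {i : ℕ} {f g : Fin n → Option D}
    (h : A.RoundStep (i + 1) (π (i + 1)) t f g) : A.Path π t i f (i + 1) g := by
  refine ⟨fun l => if l ≤ i then f else g, by omega, by simp, by simp, fun k h1 h2 => ?_⟩
  obtain rfl : k = i + 1 := by omega
  simpa using h

/-- The state after a phase with number `m` in which round `ir` leads to `f` and the last round
leads to `g`. -/
def State.next (s : State n D) (m : ℕ) (f g : Fin n → Option D) : State n D where
  inp p := (f p).getD (s.inp p)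
  ts p := if (f p).isSome then m else s.ts p
  dec p := (s.dec p).or (g p)

lemma Algorithm.Path.phaseStep {s : State n D} {f g : Fin n → Option D} (m : ℕ)
    (h1 : A.Path π s.ts 0 (fun p => some (s.inp p)) A.ir f) (h2 : A.Path π s.ts A.ir f A.r g) :
    A.PhaseStep m π s (s.next m f g) := by
  obtain ⟨x, hij, hxi, hxj, hx⟩ := h1
  obtain ⟨y, hjk, hyj, hyk, hy⟩ := h2
  refine ⟨fun l => if l ≤ A.ir then x l else y l, by simp [hxi], fun l hl1 hl2 => ?_, ?_, ?_, ?_⟩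
  · rcases lt_trichotomy l (A.ir + 1) with hl | rfl | hl
    · simpa [show l ≤ A.ir by omega, show l - 1 ≤ A.ir by omega] using hx l hl1 (by omega)
    · simpa [hxj, ← hyj] using hy (A.ir + 1) (by omega) hl2
    · simpa [show ¬ l ≤ A.ir by omega, show ¬ l - 1 ≤ A.ir by omega] using hy l (by omega) hl2
  · simp [hxj, State.next]
  · simp [hxj, State.next]
  · simp [not_le.2 A.ir_lt_r, hyk, State.next]

end Path

/-! ### Large numbers of processes -/

/-- The global predicate and the sporadic ones. -/
def Algorithm.preds (A : Algorithm) : Set PhasePred := insert A.glob (Set.range A.spor)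

/-- The constants to be separated by multiples of `1 / n`. -/
noncomputable def Algorithm.constants (A : Algorithm) : Set ℝ :=
  {0, 1, 1 - (A.round (A.ir + 1)).thrU} ∪ ⋃ i ∈ Set.Icc 1 A.r,
    ({(A.round i).thrU, (A.round i).thrM} ∪
      (fun I : Instr => (I.thr : ℝ)) '' {I | I ∈ (A.round i).mult} ∪
      (fun π : PhasePred => (π i).thrVal) '' A.preds)

/-- The number `n` of processes is even, and large compared to the distances of the constants. -/
def Algorithm.Large (A : Algorithm) (n : ℕ) : Prop :=
  Even n ∧ ∀ c ∈ A.constants, ∀ u ∈ A.constants, c < u → c * n + 3 ≤ u * n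

lemma Algorithm.exists_large (A : Algorithm) : ∃ n, A.Large n := by
  have hfin : A.constants.Finite := by
    refine Set.Finite.union (Set.toFinite _) ((Set.finite_Icc 1 A.r).biUnion fun i _ => ?_)
    refine Set.Finite.union (Set.Finite.union (Set.toFinite _) ?_) ?_
    · exact (List.finite_toSet _).image _
    · exact ((Set.finite_range _).insert _).image _
  have hev : ∀ᶠ n : ℕ in Filter.atTop, ∀ c ∈ A.constants, ∀ u ∈ A.constants,
      c < u → c * n + 3 ≤ u * n := by
    refine (Filter.eventually_all_finite hfin).2 fun c _ =>
      (Filter.eventually_all_finite hfin).2 fun u _ => ?_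
    by_cases hcu : c < u
    · obtain ⟨N, hN⟩ := exists_nat_ge (3 / (u - c))
      filter_upwards [Filter.eventually_ge_atTop N] with n hn _
      have h1 : 3 / (u - c) ≤ n := hN.trans (Nat.cast_le.2 hn)
      rw [div_le_iff₀ (sub_pos.2 hcu)] at h1
      linarith
    · exact Filter.Eventually.of_forall fun n h => absurd h hcu
  obtain ⟨N, hN⟩ := Filter.eventually_atTop.1 hev
  exact ⟨2 * N, even_two_mul N, hN _ (by omega)⟩

section Large

variable {i : ℕ}

lemma Algorithm.thrU_mem_constants (h1 : 1 ≤ i) (hr : i ≤ A.r) :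
    (A.round i).thrU ∈ A.constants :=
  Or.inr (Set.mem_biUnion (show i ∈ Set.Icc 1 A.r from ⟨h1, hr⟩) (Or.inl (Or.inl (Or.inl rfl))))

lemma Algorithm.thrM_mem_constants (h1 : 1 ≤ i) (hr : i ≤ A.r) :
    (A.round i).thrM ∈ A.constants :=
  Or.inr (Set.mem_biUnion (show i ∈ Set.Icc 1 A.r from ⟨h1, hr⟩) (Or.inl (Or.inl (Or.inr rfl))))

lemma Algorithm.thr_mem_constants (h1 : 1 ≤ i) (hr : i ≤ A.r) {I : Instr}
    (hI : I ∈ (A.round i).mult) : (I.thr : ℝ) ∈ A.constants :=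
  Or.inr (Set.mem_biUnion (show i ∈ Set.Icc 1 A.r from ⟨h1, hr⟩)
    (Or.inl (Or.inr (Set.mem_image_of_mem _ hI))))

lemma Algorithm.thrVal_mem_constants (h1 : 1 ≤ i) (hr : i ≤ A.r) {π : PhasePred}
    (hπ : π ∈ A.preds) : (π i).thrVal ∈ A.constants :=
  Or.inr (Set.mem_biUnion (show i ∈ Set.Icc 1 A.r from ⟨h1, hr⟩)
    (Or.inr (Set.mem_image_of_mem (fun π : PhasePred => (π i).thrVal) hπ)))

lemma Algorithm.Large.add_three_le (hn : A.Large n) {c : ℝ} (hc : c ∈ A.constants) (hc1 : c < 1) :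
    c * n + 3 ≤ n := by
  simpa using hn.2 c hc 1 (Or.inl (Or.inr (Or.inl rfl))) hc1

lemma Algorithm.Large.four_le (hn : A.Large n) : 4 ≤ n := by
  have h := hn.add_three_le (c := 0) (Or.inl (Or.inl rfl)) one_pos
  have h3 : 3 ≤ n := by
    rw [zero_mul, zero_add] at h
    exact_mod_cast h
  obtain ⟨k, hk⟩ := hn.1
  omega

end Large

end HeardOf

/-! ### Necessity: possible outcomes of a round -/

namespace HeardOf

variable {D : Type*} {n : ℕ} {i : ℕ} {t : Fin n → ℕ}

lemma exists_ne_of_mixed {g : Fin n → D} {T : Finset (Fin n)} {p q : Fin n} (hp : p ∈ T)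
    (hq : q ∈ T) (hpq : g p ≠ g q) :
    ∃ x ∈ defined (received i t (fun p => some (g p)) T),
      ∃ y ∈ defined (received i t (fun p => some (g p)) T), x.1 ≠ y.1 :=
  ⟨(g p, _), mem_defined_received.2 ⟨p, hp, rfl, rfl⟩, (g q, _),
    mem_defined_received.2 ⟨q, hq, rfl, rfl⟩, hpq⟩

/-- The tuple in which process `p₀` has value `a` and all others have value `b`. -/
def almostSolo (p₀ : Fin n) (a b : D) : Fin n → D := fun p => if p = p₀ then a else b

lemma almostSolo_self (p₀ : Fin n) (a b : D) : almostSolo p₀ a b p₀ = a := if_pos rfl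

lemma almostSolo_of_ne {p₀ p : Fin n} (h : p ≠ p₀) (a b : D) : almostSolo p₀ a b p = b := if_neg h

lemma almostSolo_eq (p₀ p : Fin n) (a b : D) :
    almostSolo p₀ a b p = a ∨ almostSolo p₀ a b p = b := by
  by_cases h : p = p₀ <;> simp [almostSolo, h]

variable [LinearOrder D] {A : Algorithm} {π : PhasePred}

lemma Algorithm.obtain_const {f : Fin n → Option D} {T : Finset (Fin n)} {d : D}
    (huni : (A.round i).uni ≠ none) (hT : ∀ p ∈ T, f p = some d ∨ f p = none)
    (hc : (A.round i).thrU * n < (T.filter fun p => (f p).isSome).card) :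
    A.obtain i t f T = some d := by
  refine Round.update_of_const huni (fun x hx => ?_) (by rwa [card_defined_received])
  obtain ⟨p, hp, hpx, -⟩ := mem_defined_received.1 hx
  rcases hT p hp with h | h <;> rw [h] at hpx
  · exact (Option.some_inj.1 hpx).symm
  · cases hpx

lemma Algorithm.obtain_const_some {g : Fin n → D} {T : Finset (Fin n)} {d : D}
    (huni : (A.round i).uni ≠ none) (hT : ∀ p ∈ T, g p = d)
    (hc : (A.round i).thrU * n < T.card) :
    A.obtain i t (fun p => some (g p)) T = some d :=
  A.obtain_const huni (fun p hp => Or.inl (by rw [hT p hp])) (by simpa using hc)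

lemma Algorithm.obtain_none_of_const {f : Fin n → Option D} {T : Finset (Fin n)} {d : D}
    (hT : ∀ p ∈ T, f p = some d ∨ f p = none)
    (hc : ((T.filter fun p => (f p).isSome).card : ℝ) ≤ (A.round i).thrU * n) :
    A.obtain i t f T = none := by
  refine Round.update_eq_none_of_const (d := d) (fun x hx => ?_)
    fun _ => by rwa [card_defined_received]
  obtain ⟨p, hp, hpx, -⟩ := mem_defined_received.1 hx
  rcases hT p hp with h | h <;> rw [h] at hpx
  · exact (Option.some_inj.1 hpx).symm
  · cases hpx

lemma Algorithm.obtain_none_of_mixed (h1 : 1 ≤ i) (hr : i ≤ A.r) {g : Fin n → D}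
    {T : Finset (Fin n)} {p q : Fin n} (hp : p ∈ T) (hq : q ∈ T) (hpq : g p ≠ g q)
    (hc : (A.round i).mult ≠ [] → (T.card : ℝ) ≤ (A.round i).thrM * n) :
    A.obtain i t (fun p => some (g p)) T = none :=
  Round.update_eq_none_of_mixed (A.mult_sorted i h1 hr) (exists_ne_of_mixed hp hq hpq)
    fun h => by rw [card_defined_received_some]; exact hc h

/-- In the first round, a value that is at most all others and has a most recent timestamp is
obtained from a mixed multiset. -/
lemma Algorithm.obtain_maxts (hr : 1 ≤ A.r) {g : Fin n → D} {T : Finset (Fin n)} {p q : Fin n}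
    (hM : (A.round 1).mult ≠ []) (hp : p ∈ T) (hq : q ∈ T) (hpq : g p ≠ g q)
    (hc : (A.round 1).thrM * n < T.card) (hle : ∀ q ∈ T, g p ≤ g q)
    (hts : ∀ q ∈ T, t q ≤ t p) : A.obtain 1 t (fun p => some (g p)) T = some (g p) := by
  obtain ⟨I, hI, hIe⟩ := Round.update_of_mixed (n := n) hM
    (exists_ne_of_mixed (i := 1) (t := t) hp hq hpq) (by rwa [card_defined_received_some])
  rw [(A.op_mult 1 le_rfl hr I hI).2 rfl] at hIe
  refine hIe.trans (Op.eval_maxts (x := (g p, t p))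
    (mem_defined_received.2 ⟨p, hp, rfl, if_pos rfl⟩)
    (fun y hy => ?_) fun y hy => ?_)
  · obtain ⟨q, hq, h, -⟩ := mem_defined_received.1 hy
    rw [← Option.some_inj.1 h]
    exact hle q hq
  · obtain ⟨q, hq, -, h⟩ := mem_defined_received.1 hy
    rw [← h, if_pos rfl]
    exact hts q hq

/-- Both `a` and `b` may be obtained from `f` in round `i`. -/
def Algorithm.Flexible (A : Algorithm) (i : ℕ) (φ : RoundPred) (t : Fin n → ℕ)
    (f : Fin n → Option D) (a b : D) : Prop :=
  ∀ e, e = a ∨ e = b → ∃ T : Finset (Fin n), φ.thrVal * n < T.card ∧ A.obtain i t f T = some e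

lemma Algorithm.Flexible.roundStep {φ : RoundPred} {f : Fin n → Option D} {a b : D}
    (h : A.Flexible i φ t f a b) (hk : (A.round i).kind = .every) (he : φ.equal = false)
    {g : Fin n → D} (hg : ∀ p, g p = a ∨ g p = b) :
    A.RoundStep i φ t f fun p => some (g p) := by
  choose T hT1 hT2 using fun p => h (g p) (hg p)
  have := A.everyStep_of_senders (i := i) (φ := φ) (t := t) (f := f) T hT1 (by simp [he])
  simp only [hT2] at this
  simpa [Algorithm.RoundStep, hk] using this

/-- In a round with both kinds of instructions all outcomes are possible, for a suitable input: if
the first `mult` instruction has operation `min`, then a single process should have the smaller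
value; if it has operation `smor`, then one half of the processes should have either value. -/
lemma Algorithm.exists_flexible (hn : A.Large n) (h2 : 2 ≤ i) (hr : i ≤ A.r)
    (hπ : π ∈ A.preds) (huni : (A.round i).uni ≠ none) (hM : (A.round i).mult ≠ []) {a b : D}
    (hab : a < b) : ∃ g : Fin n → D, (∀ p, g p = a ∨ g p = b) ∧
      A.Flexible i (π i) t (fun p => some (g p)) a b := by
  classical
  have h4 := hn.four_le
  have h1 : 1 ≤ i := by omega
  obtain ⟨I, l, hIl⟩ := List.exists_cons_of_ne_nil hM
  have hI : I ∈ (A.round i).mult := by simp [hIl]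
  have hcard : ∀ T : Finset (Fin n), n ≤ T.card + 1 → (π i).thrVal * n < T.card ∧
      (A.round i).thrU * n < T.card ∧ (I.thr : ℝ) * n < T.card := by
    intro T hT
    have h5 : (n : ℝ) ≤ T.card + 1 := by exact_mod_cast hT
    have := hn.add_three_le (A.thrVal_mem_constants h1 hr hπ) (π i).thrVal_lt_one
    have := hn.add_three_le (A.thrU_mem_constants h1 hr) (A.round i).thrU_lt_one
    have := hn.add_three_le (A.thr_mem_constants h1 hr hI) I.thr.2.2
    exact ⟨by linarith, by linarith, by linarith⟩
  have herase : ∀ p : Fin n, n ≤ (Finset.univ.erase p).card + 1 := fun p => by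
    rw [Finset.card_erase_of_mem (Finset.mem_univ p), Finset.card_univ, Fintype.card_fin]; omega
  have huniv : n ≤ (Finset.univ : Finset (Fin n)).card + 1 := by simp
  cases hop : I.op with
  | min =>
    let p₀ : Fin n := ⟨0, by omega⟩
    let p₁ : Fin n := ⟨1, by omega⟩
    have hne : p₁ ≠ p₀ := by simp [p₀, p₁]
    refine ⟨fun p => if p = p₀ then a else b, fun p => by by_cases h : p = p₀ <;> simp [h], ?_⟩
    rintro e (rfl | rfl)
    · refine ⟨Finset.univ, (hcard _ huniv).1, ?_⟩
      refine (Round.update_of_mixed_head (n := n) hIl (exists_ne_of_mixed (p := p₀) (q := p₁)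
        (Finset.mem_univ _) (Finset.mem_univ _) (by simp [hne, hab.ne])) ?_).trans ?_
      · rw [card_defined_received_some]; exact (hcard _ huniv).2.2
      · rw [hop]
        refine Op.eval_min (x := (e, _)) (mem_defined_received.2
          ⟨p₀, Finset.mem_univ _, by simp, rfl⟩) fun y hy => ?_
        obtain ⟨q, -, hq, -⟩ := mem_defined_received.1 hy
        rw [← Option.some_inj.1 hq]
        split_ifs
        exacts [le_rfl, hab.le]
    · refine ⟨Finset.univ.erase p₀, (hcard _ (herase _)).1, ?_⟩
      exact A.obtain_const_some huni (fun p hp => by simp [Finset.ne_of_mem_erase hp])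
        (hcard _ (herase _)).2.1
  | smor =>
    obtain ⟨h, hh⟩ := hn.1
    obtain ⟨S, -, hS⟩ := Finset.exists_subset_card_eq
      (show h ≤ (Finset.univ : Finset (Fin n)).card by simp; omega)
    have hSc : Sᶜ.card = h := by rw [Finset.card_compl, Fintype.card_fin, hS]; omega
    obtain ⟨p, hp, p', hp', hpp⟩ := Finset.one_lt_card.1 (show 1 < S.card by omega)
    obtain ⟨q, hq, q', hq', hqq⟩ := Finset.one_lt_card.1 (show 1 < Sᶜ.card by omega)
    rw [Finset.mem_compl] at hq hq'
    have hpq : p ≠ q := fun h => hq (h ▸ hp)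
    have hpq' : p' ≠ q := fun h => hq (h ▸ hp')
    let g : Fin n → D := fun p => if p ∈ S then a else b
    have hga : ∀ p, g p = a ↔ p ∈ S := fun p => by by_cases hpS : p ∈ S <;> simp [g, hpS, hab.ne']
    have hgb : ∀ p, g p = b ↔ p ∈ Sᶜ := fun p => by by_cases hpS : p ∈ S <;> simp [g, hpS, hab.ne]
    have hg : ∀ p, g p = a ∨ g p = b := fun p => by by_cases hpS : p ∈ S <;> simp [g, hpS]
    have hcount : ∀ (T : Finset (Fin n)) (d : D),
        ((defined (received i t (fun p => some (g p)) T)).map Prod.fst).count d =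
          (T.filter fun p => g p = d).card := by
      intro T d
      have h0 : (defined (received i t (fun p => some (g p)) T)).map Prod.fst = T.val.map g := by
        rw [defined, received, Multiset.filterMap_map, Multiset.map_filterMap,
          ← Multiset.filterMap_eq_map]
        rfl
      rw [h0, Multiset.count_map, Finset.card, Finset.filter_val]
      exact congrArg _ (Multiset.filter_congr fun p _ => eq_comm)
    -- one occurrence of the value of `y` is missing, so that the other value wins
    have key : ∀ x y : Fin n, g x ≠ g y → x ∈ Finset.univ.erase y →
        (∃ y', y' ≠ y ∧ g y' = g y) →
        ∃ T : Finset (Fin n), (π i).thrVal * n < T.card ∧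
          A.obtain i t (fun p => some (g p)) T = some (g x) := by
      rintro x y hxy hx ⟨y', hy', hgy⟩
      refine ⟨Finset.univ.erase y, (hcard _ (herase _)).1, ?_⟩
      refine (Round.update_of_mixed_head (n := n) hIl (exists_ne_of_mixed (p := x) (q := y')
        hx (Finset.mem_erase.2 ⟨hy', Finset.mem_univ _⟩) (by rwa [hgy])) ?_).trans ?_
      · rw [card_defined_received_some]; exact (hcard _ (herase _)).2.2
      rw [hop]
      refine Op.eval_smor (x := (g x, _)) (mem_defined_received.2 ⟨x, hx, rfl, rfl⟩)
        fun z hz hzx => ?_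
      obtain ⟨w, -, hw, -⟩ := mem_defined_received.1 hz
      rw [Option.some_inj] at hw
      rw [hcount, hcount, ← hw]
      rw [← hw] at hzx
      have hwy : g w = g y := by
        rcases hg w with h1 | h1 <;> rcases hg x with h2 | h2 <;> rcases hg y with h3 | h3 <;>
          simp_all
      have hca : (Finset.univ.filter fun p => g p = a).card = h := by
        rw [← hS]; congr 1; ext p; simp [hga]
      have hcb : (Finset.univ.filter fun p => g p = b).card = h := by
        rw [← hSc]; congr 1; ext p; simp [hgb]
      have hall : ∀ z, (Finset.univ.filter fun p => g p = g z).card = h := fun z => by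
        rcases hg z with h1 | h1 <;> rw [h1] <;> assumption
      rw [hwy, Finset.filter_erase, Finset.filter_erase, Finset.card_erase_of_mem (by simp),
        Finset.erase_eq_of_notMem (by simpa using hxy.symm), hall, hall]
      omega
    refine ⟨g, hg, ?_⟩
    have e1 : g p = a := (hga p).2 hp
    have e1' : g p' = a := (hga p').2 hp'
    have e2 : g q = b := (hgb q).2 (Finset.mem_compl.2 hq)
    have e2' : g q' = b := (hgb q').2 (Finset.mem_compl.2 hq')
    rintro e (rfl | rfl)
    · rw [← e1]
      exact key p q (by rw [e1, e2]; exact hab.ne) (by simp [hpq]) ⟨q', hqq.symm, by rw [e2, e2']⟩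
    · rw [← e2]
      exact key q p (by rw [e1, e2]; exact hab.ne') (by simp [hpq.symm])
        ⟨p', hpp.symm, by rw [e1, e1']⟩
  | maxts => exact absurd ((A.op_mult i h1 hr I hI).1 hop) (by omega)

/-- A round that is c-preserving may erase all values if all but one of them are equal. -/
lemma Algorithm.CPreserving.roundStep_none (hn : A.Large n) (h1 : 1 ≤ i) (hr : i ≤ A.r)
    (hπ : π ∈ A.preds) (huni : (A.round i).uni ≠ none) {a b : D} (hab : a ≠ b) (p₀ : Fin n)
    (h : A.CPreserving π i) :
    A.RoundStep i (π i) t (fun p => some (almostSolo p₀ a b p)) (solo n none) := by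
  classical
  have h4 := hn.four_le
  by_cases hk : (A.round i).kind = .ls
  · exact A.lsStep_none (by omega) hk (by simpa [Algorithm.CPreserving, hk] using h)
  have hlt := (π i).thrVal_lt_one
  have hvc := A.thrVal_mem_constants h1 hr hπ
  have hcompl : ({p₀}ᶜ : Finset (Fin n)).card = n - 1 := by
    rw [Finset.card_compl, Fintype.card_fin, Finset.card_singleton]
  obtain ⟨p₁, hp₁⟩ : ∃ p₁, p₁ ∈ ({p₀}ᶜ : Finset (Fin n)) := by
    apply Finset.card_pos.1; omega
  have hp₁' : p₁ ≠ p₀ := by simpa using hp₁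
  have hne : almostSolo p₀ a b p₀ ≠ almostSolo p₀ a b p₁ := by
    rwa [almostSolo_self, almostSolo_of_ne hp₁']
  rcases (show (A.round i).mult = [] ∨ (π i).thrVal < (A.round i).thrU ∨
      ((A.round i).mult ≠ [] ∧ (π i).thrVal < (A.round i).thrM) by
    by_cases hM : (A.round i).mult = []
    · exact Or.inl hM
    unfold Algorithm.CPreserving at h
    split at h
    · contradiction
    · rcases h with h | h | h
      · exact absurd h huni
      · exact Or.inl h
      · rcases lt_max_iff.1 h with h | h
        · exact Or.inr (Or.inl h)
        · exact Or.inr (Or.inr ⟨hM, h⟩)) with hM | hU | ⟨hM, hlM⟩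
  · refine A.roundStep_none_of_senders (T := Finset.univ) (by omega) hk ?_
      (A.obtain_none_of_mixed h1 hr (Finset.mem_univ p₀) (Finset.mem_univ p₁) hne
        fun h => absurd hM h)
    have := hn.add_three_le hvc hlt
    rw [Finset.card_univ, Fintype.card_fin]
    linarith
  · -- a number of equal values between the two thresholds
    have hgap := hn.2 _ hvc _ (A.thrU_mem_constants h1 hr) hU
    have hUn := hn.add_three_le (A.thrU_mem_constants h1 hr) (A.round i).thrU_lt_one
    have h0 := mul_nonneg ((A.round i).thrU_nonneg huni) (Nat.cast_nonneg (α := ℝ) n)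
    have hfl := Nat.floor_le h0
    have hfl' := Nat.lt_floor_add_one ((A.round i).thrU * n)
    have hfn : ⌊(A.round i).thrU * n⌋₊ ≤ ({p₀}ᶜ : Finset (Fin n)).card := by
      rw [hcompl]
      have : (⌊(A.round i).thrU * n⌋₊ : ℝ) + 3 ≤ n := by linarith
      have : ⌊(A.round i).thrU * n⌋₊ + 3 ≤ n := by exact_mod_cast this
      omega
    obtain ⟨T, hT, hTc⟩ := Finset.exists_subset_card_eq hfn
    refine A.roundStep_none_of_senders (T := T) (by omega) hk (by rw [hTc]; linarith) ?_
    refine A.obtain_none_of_const (d := b) (fun p hp => Or.inl ?_) ?_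
    · rw [almostSolo_of_ne (by simpa using hT hp)]
    · simpa [hTc] using hfl
  · -- a mixed multiset whose size is between the two thresholds
    have hgap := hn.2 _ hvc _ (A.thrM_mem_constants h1 hr) hlM
    have hMn := hn.add_three_le (A.thrM_mem_constants h1 hr) (A.round i).thrM_lt_one
    have h0 := mul_nonneg ((A.round i).thrM_nonneg hM) (Nat.cast_nonneg (α := ℝ) n)
    have hfl := Nat.floor_le h0
    have hfl' := Nat.lt_floor_add_one ((A.round i).thrM * n)
    rcases ((A.round i).thrM_nonneg hM).eq_or_lt with hz | hpos
    · -- threshold `0`: receiving nothing is allowed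
      refine A.roundStep_none_of_senders (T := ∅) (by omega) hk ?_
        (A.obtain_none_of_const (d := b) (by simp) ?_)
      · rw [← hz] at hgap
        simp only [Finset.card_empty, Nat.cast_zero]
        linarith
      · simpa using mul_nonneg ((A.round i).thrU_nonneg huni) (Nat.cast_nonneg (α := ℝ) n)
    have h3 := hn.2 0 (Or.inl (Or.inl rfl)) _ (A.thrM_mem_constants h1 hr) hpos
    have h3f : 3 ≤ ⌊(A.round i).thrM * n⌋₊ := Nat.le_floor (by push_cast; linarith)
    have hfn : ⌊(A.round i).thrM * n⌋₊ ≤ (Finset.univ : Finset (Fin n)).card := by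
      rw [Finset.card_univ, Fintype.card_fin]
      have : (⌊(A.round i).thrM * n⌋₊ : ℝ) ≤ n := by linarith
      exact_mod_cast this
    obtain ⟨T, hpT, -, hTc⟩ := Finset.exists_subsuperset_card_eq (s := {p₀, p₁})
      (Finset.subset_univ _) (Finset.card_le_two.trans (by omega)) hfn
    refine A.roundStep_none_of_senders (T := T) (by omega) hk (by rw [hTc]; linarith) ?_
    exact A.obtain_none_of_mixed h1 hr (hpT (by simp)) (hpT (by simp)) hne
      fun _ => by rw [hTc]; exact hfl

lemma Algorithm.Carries.exists_succ (hL : A.LeaderAssumption) (hn : A.Large n) {d : D}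
    {φ : RoundPred} {f : Fin n → Option D} (h : A.Carries i d f) (hi : i < A.r)
    (huni : (A.round (i + 1)).uni ≠ none) :
    ∃ f', A.RoundStep (i + 1) φ t f f' ∧ A.Carries (i + 1) d f' := by
  have h4 := hn.four_le
  by_cases hk : (A.round (i + 1)).kind = .ls
  · refine ⟨solo n (some d), ?_, Or.inr ⟨Or.inr (by simp [hk]), rfl⟩⟩
    have hmem : some d ∈ Set.range f := by
      rcases h with ⟨-, -, q, rfl⟩ | ⟨-, rfl⟩
      · exact ⟨q, by simp [one_apply]⟩
      · exact ⟨⟨0, by omega⟩, rfl⟩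
    simp only [Algorithm.RoundStep, hk, Algorithm.LsStep, if_neg huni, Nat.add_sub_cancel]
    split_ifs with hl hlr
    · rcases h with ⟨-, -, q, rfl⟩ | ⟨h1, -⟩
      · exact ⟨q, _, rfl, rfl⟩
      · rcases h1 with rfl | h1
        · omega
        · exact absurd hlr.2 h1
    · exact ⟨_, hmem, rfl⟩
    · exact ⟨_, hmem, fun p => Or.inl rfl⟩
  · obtain rfl := h.solo_of_next hL hi hk
    have hn0 : (0 : ℝ) < n := by exact_mod_cast (by omega : 0 < n)
    refine A.exists_carries_of_senders (T := Finset.univ) (by omega) (by omega) hk ?_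
      (A.obtain_const_some huni (fun _ _ => rfl) ?_) <;>
    rw [Finset.card_univ, Fintype.card_fin]
    · exact mul_lt_of_lt_one_left hn0 φ.thrVal_lt_one
    · exact mul_lt_of_lt_one_left hn0 (Round.thrU_lt_one _)

/-- A round that is not c-solo-safe may erase all values if they are equal. -/
lemma Algorithm.Carries.roundStep_none (hL : A.LeaderAssumption) (hn : A.Large n) {d : D}
    {f : Fin n → Option D} (h : A.Carries i d f) (hi : i < A.r) (hπ : π ∈ A.preds)
    (huni : (A.round (i + 1)).uni ≠ none) (hs : ¬ A.CSoloSafe π (i + 1)) :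
    A.RoundStep (i + 1) (π (i + 1)) t f (solo n none) := by
  have h4 := hn.four_le
  by_cases hk : (A.round (i + 1)).kind = .ls
  · exact A.lsStep_none (by omega) hk (by simpa [Algorithm.CSoloSafe, hk] using hs)
  obtain rfl := h.solo_of_next hL hi hk
  have h0 := (A.round (i + 1)).thrU_nonneg huni
  have hU : (π (i + 1)).thrVal < (A.round (i + 1)).thrU := by
    unfold Algorithm.CSoloSafe at hs
    split at hs
    · contradiction
    · exact not_le.1 fun h => hs ⟨h0, h⟩
  have hgap := hn.2 _ (A.thrVal_mem_constants (by omega) hi hπ) _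
    (A.thrU_mem_constants (by omega) hi) hU
  have hUn := hn.add_three_le (A.thrU_mem_constants (by omega) hi) (A.round (i + 1)).thrU_lt_one
  have hfl := Nat.floor_le (mul_nonneg h0 (Nat.cast_nonneg (α := ℝ) n))
  have hfl' := Nat.lt_floor_add_one ((A.round (i + 1)).thrU * n)
  have hfn : ⌊(A.round (i + 1)).thrU * n⌋₊ ≤ (Finset.univ : Finset (Fin n)).card := by
    rw [Finset.card_univ, Fintype.card_fin]
    have : (⌊(A.round (i + 1)).thrU * n⌋₊ : ℝ) ≤ n := by linarith
    exact_mod_cast this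
  obtain ⟨T, -, hTc⟩ := Finset.exists_subset_card_eq hfn
  refine A.roundStep_none_of_senders (T := T) (by omega) hk (by rw [hTc]; linarith)
    (A.obtain_none_of_const (d := d) (fun p _ => Or.inl rfl) ?_)
  simpa [solo, hTc] using hfl

lemma Algorithm.roundStep_none_none (hn : A.Large n) (φ : RoundPred)
    (huni : (A.round i).uni ≠ none) :
    A.RoundStep i φ t (solo n (none : Option D)) (solo n none) := by
  have h4 := hn.four_le
  have hn0 : (0 : ℝ) < n := by exact_mod_cast (by omega : 0 < n)
  by_cases hk : (A.round i).kind = .ls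
  · have hmem : (none : Option D) ∈ Set.range (solo n (none : Option D)) := ⟨⟨0, by omega⟩, rfl⟩
    simp only [Algorithm.RoundStep, hk, Algorithm.LsStep, if_neg huni]
    split_ifs
    · exact ⟨⟨0, by omega⟩, none, (one_none _).symm, rfl⟩
    · exact ⟨_, hmem, rfl⟩
    · exact ⟨_, hmem, fun p => Or.inl rfl⟩
  · refine A.roundStep_none_of_senders (T := Finset.univ) (by omega) hk ?_ ?_
    · rw [Finset.card_univ, Fintype.card_fin]
      exact mul_lt_of_lt_one_left hn0 φ.thrVal_lt_one
    · by_contra hne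
      obtain ⟨d, hd⟩ := Option.ne_none_iff_exists'.1 hne
      obtain ⟨x, hx, -⟩ := Round.exists_mem_of_update hd
      obtain ⟨p, -, hp, -⟩ := mem_defined_received.1 hx
      cases hp

end HeardOf

/-! ### Necessity: existence of executions -/

namespace HeardOf

variable {D : Type*} [LinearOrder D] {n : ℕ} {A : Algorithm} {π : PhasePred} {t : Fin n → ℕ}

lemma Algorithm.exists_path (π : PhasePred) (t : Fin n → ℕ) (hn : 0 < n) {i j : ℕ}
    {f : Fin n → Option D} (hij : i ≤ j)
    (hf : 1 ≤ i → (A.round i).kind = .lr → ∃ q d, f = one q d) :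
    ∃ g, A.Path π t i f j g ∧ (1 ≤ j → (A.round j).kind = .lr → ∃ q d, g = one q d) := by
  induction j, hij using Nat.le_induction with
  | base => exact ⟨f, .refl _ _, hf⟩
  | succ j hij ih =>
    obtain ⟨g, hg, hglr⟩ := ih
    have hn0 : (0 : ℝ) < n := by exact_mod_cast hn
    have hcard : (π (j + 1)).thrVal * n < (Finset.univ : Finset (Fin n)).card := by
      rw [Finset.card_univ, Fintype.card_fin]
      exact mul_lt_of_lt_one_left hn0 (π (j + 1)).thrVal_lt_one
    suffices ∃ g', A.RoundStep (j + 1) (π (j + 1)) t g g' ∧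
        ((A.round (j + 1)).kind = .lr → ∃ q d, g' = one q d) by
      obtain ⟨g', h1, h2⟩ := this
      exact ⟨g', hg.trans h1.path, fun _ => h2⟩
    cases hk : (A.round (j + 1)).kind with
    | every =>
      suffices ∃ g', A.EveryStep (j + 1) (π (j + 1)) t g g' by
        obtain ⟨g', hg'⟩ := this
        exact ⟨g', by simpa [Algorithm.RoundStep, hk] using hg', by simp⟩
      exact ⟨_, A.everyStep_of_senders (fun _ => Finset.univ) (fun _ => hcard) fun _ _ _ => rfl⟩
    | lr => exact ⟨_, A.lrStep_of_senders hk hcard ⟨0, hn⟩, fun _ => ⟨_, _, rfl⟩⟩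
    | ls =>
      simp only [Algorithm.RoundStep, hk, Algorithm.LsStep, Nat.add_sub_cancel]
      split_ifs with h1 h2 h3
      · exact ⟨_, rfl, by simp⟩
      · obtain ⟨q, d, hqd⟩ := hglr (by omega) h3.2
        exact ⟨_, ⟨q, d, hqd, rfl⟩, by simp⟩
      · exact ⟨_, ⟨_, ⟨⟨0, hn⟩, rfl⟩, rfl⟩, by simp⟩
      · exact ⟨solo n (g ⟨0, hn⟩), ⟨_, ⟨⟨0, hn⟩, rfl⟩, fun p => Or.inl rfl⟩, by simp⟩

lemma Algorithm.exists_phaseStep (hn : 0 < n) (m : ℕ) (π : PhasePred) (s : State n D) :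
    ∃ s', A.PhaseStep m π s s' := by
  obtain ⟨f, hf, hflr⟩ := A.exists_path π s.ts hn (f := fun p => some (s.inp p))
    (Nat.zero_le A.ir) (by omega)
  obtain ⟨g, hg, -⟩ := A.exists_path π s.ts hn A.ir_lt_r.le hflr
  exact ⟨_, hf.phaseStep m hg⟩

/-- Executions are constructed phase by phase, keeping an invariant. -/
lemma Algorithm.exists_execution (hImp : A.SporadicImpliesGlobal) {m : Fin A.k → ℕ}
    (hm : StrictMono m) {s₀ : State n D} (hts : ∀ p, s₀.ts p = 0) (hdec : ∀ p, s₀.dec p = none)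
    (Inv : ℕ → State n D → Prop) (h0 : Inv 0 s₀)
    (hspor : ∀ j s, Inv (m j) s → ∃ s', A.PhaseStep (m j + 1) (A.spor j) s s' ∧ Inv (m j + 1) s')
    (hglob : ∀ l s, (∀ j, m j ≠ l) → Inv l s →
      ∃ s', A.PhaseStep (l + 1) A.glob s s' ∧ Inv (l + 1) s') :
    ∃ σ : ℕ → State n D, A.IsExecution σ ∧ ∀ l, Inv l (σ l) := by
  classical
  have step : ∀ l s, Inv l s → ∃ s', ((∀ j, m j = l → A.PhaseStep (l + 1) (A.spor j) s s') ∧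
      ((∀ j, m j ≠ l) → A.PhaseStep (l + 1) A.glob s s')) ∧ Inv (l + 1) s' := by
    intro l s hs
    by_cases hl : ∃ j, m j = l
    · obtain ⟨j, rfl⟩ := hl
      obtain ⟨s', h1, h2⟩ := hspor j s hs
      exact ⟨s', ⟨fun j' hj' => hm.injective hj' ▸ h1, fun h => absurd rfl (h j)⟩, h2⟩
    · push Not at hl
      obtain ⟨s', h1, h2⟩ := hglob l s hl hs
      exact ⟨s', ⟨fun j hj => absurd hj (hl j), fun _ => h1⟩, h2⟩
  choose! next hnext hinv using step
  let σ : ℕ → State n D := fun l => Nat.rec s₀ (fun l s => next l s) l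
  have hσ : ∀ l, Inv l (σ l) := by
    intro l
    induction l with
    | zero => exact h0
    | succ l ih => exact hinv l _ ih
  refine ⟨σ, ⟨hts, hdec, m, hm, fun j => ?_, fun l hl => (hnext l _ (hσ l)).2 hl⟩, hσ⟩
  exact ((hnext (m j) _ (hσ _)).1 j rfl).congr fun i h1 h2 => (hImp.and_eq j h1 h2).symm

/-- If all processes start with the same value, then a round without `uni` instruction keeps them
from ever deciding. -/
theorem Algorithm.uni_ne_none_of_termination [Nonempty D] (hImp : A.SporadicImpliesGlobal)
    (h : A.Termination D) {i : ℕ} (h1 : 1 ≤ i) (hr : i ≤ A.r) : (A.round i).uni ≠ none := by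
  intro hi
  obtain ⟨a⟩ := ‹Nonempty D›
  have step : ∀ (m : ℕ) (π : PhasePred) (s : State 1 D),
      ((∀ p, s.inp p = a) ∧ ∀ p, s.dec p = none) →
      ∃ s', A.PhaseStep m π s s' ∧ ((∀ p, s'.inp p = a) ∧ ∀ p, s'.dec p = none) := by
    rintro m π s ⟨hs, hd⟩
    obtain ⟨s', hs'⟩ := A.exists_phaseStep one_pos m π s
    refine ⟨s', hs', ?_⟩
    obtain ⟨x, h0, hx, hinp, -, hdec⟩ := hs'
    have hval : ∀ p e, x 0 p = some e → e = a := fun p e hp => by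
      rw [h0, hs] at hp; exact (Option.some_inj.1 hp).symm
    have hir := values_eq_of_le hx (Nat.zero_le A.ir) A.ir_lt_r.le hval
    have hpred := values_eq_of_le hx (Nat.zero_le (i - 1)) (by omega) hval
    have hnone : ∀ p e, x i p = some e → False := by
      intro p e hp
      have hstep := hx i h1 hr
      by_cases hk : (A.round i).kind = .ls
      · simp only [Algorithm.RoundStep, hk, Algorithm.LsStep, hi, if_true] at hstep
        rw [hstep] at hp; cases hp
      · obtain ⟨H, hH, hu⟩ := hstep.exists_update hk hp
        rw [Round.update_eq_none_of_const (d := a) (fun y hy => ?_) (by simp [hi])] at hu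
        · cases hu
        · obtain ⟨q, hq, -⟩ := exists_sender hH hy
          exact hpred q _ hq
    have hlast := values_eq_of_le hx hr le_rfl hnone
    refine ⟨fun p => ?_, fun p => ?_⟩
    · rw [hinp]
      cases hp : x A.ir p with
      | none => exact hs p
      | some e => exact hir p e hp
    · rw [hdec, hd]
      cases hp : x A.r p with
      | none => rfl
      | some e => exact absurd hp fun h => hlast p e h
  obtain ⟨σ, hσ, hinv⟩ := A.exists_execution hImp (m := fun j => j) (fun _ _ h => h)
    (s₀ := ⟨fun _ => a, fun _ => 0, fun _ => none⟩) (fun _ => rfl) (fun _ => rfl)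
    (fun _ s => (∀ p, s.inp p = a) ∧ ∀ p, s.dec p = none) ⟨fun _ => rfl, fun _ => rfl⟩
    (fun j s => step _ _ s) (fun l s _ => step _ _ s)
  obtain ⟨l, hl⟩ := h 1 σ hσ
  exact hl 0 ((hinv l).2 0)

/-! ### Necessity: non-terminating executions -/

/-- Round `i` is not an `ls` round, it has a `mult` instruction, and equality is not required. -/
structure Algorithm.Mixing (A : Algorithm) (π : PhasePred) (i : ℕ) : Prop where
  kind : (A.round i).kind ≠ .ls
  mult : (A.round i).mult ≠ []
  equal : (π i).equal = false

/-- All tuples with entries `a` and `b` are possible after round `i`. -/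
def Algorithm.AllPatterns (A : Algorithm) (π : PhasePred) (t : Fin n → ℕ) (f₀ : Fin n → Option D)
    (i : ℕ) (a b : D) : Prop :=
  ∀ g : Fin n → D, (∀ p, g p = a ∨ g p = b) → A.Path π t 0 f₀ i fun p => some (g p)

lemma Algorithm.exists_path_flexible (hn : A.Large n) (hπ : π ∈ A.preds)
    (huni : ∀ i, 1 ≤ i → i ≤ A.r → (A.round i).uni ≠ none) {f₀ : Fin n → Option D} {a b : D}
    (hab : a < b) (hF : A.Flexible 1 (π 1) t f₀ a b) {i : ℕ} (hr : i + 1 ≤ A.r)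
    (hmix : ∀ k, 1 ≤ k → k ≤ i + 1 → A.Mixing π k)
    (hk : ∀ k, 1 ≤ k → k ≤ i → (A.round k).kind = .every) :
    ∃ f, A.Path π t 0 f₀ i f ∧ A.Flexible (i + 1) (π (i + 1)) t f a b := by
  induction i with
  | zero => exact ⟨f₀, .refl _ _, hF⟩
  | succ i ih =>
    obtain ⟨f, hf, hflex⟩ := ih (by omega) (fun k h1 h2 => hmix k h1 (by omega))
      fun k h1 h2 => hk k h1 (by omega)
    obtain ⟨g, hg, hgflex⟩ := A.exists_flexible (t := t) hn (by omega) hr hπ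
      (huni _ (by omega) hr) (hmix _ (by omega) le_rfl).mult hab
    exact ⟨_, hf.trans (hflex.roundStep (hk _ (by omega) le_rfl)
      (hmix _ (by omega) (by omega)).equal hg).path, hgflex⟩

/-- The situation before round `j`, if all preceding rounds are mixing: either value can be carried
to it, and if it is not an `ls` round, then all patterns of the two values are possible. -/
lemma Algorithm.reach_of_mixing (hL : A.LeaderAssumption) (hn : A.Large n) (hπ : π ∈ A.preds)
    (huni : ∀ i, 1 ≤ i → i ≤ A.r → (A.round i).uni ≠ none) {f₀ : Fin n → Option D} {a b : D}
    (hab : a < b) (hF : A.Flexible 1 (π 1) t f₀ a b) {j : ℕ} (h1 : 1 ≤ j) (hr : j + 1 ≤ A.r)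
    (hmix : ∀ k, 1 ≤ k → k ≤ j → A.Mixing π k) :
    (∀ e, e = a ∨ e = b → ∃ f, A.Path π t 0 f₀ j f ∧ A.Carries j e f) ∧
      ((A.round (j + 1)).kind = .ls ∨ A.AllPatterns π t f₀ j a b) := by
  have h4 := hn.four_le
  obtain ⟨i, rfl⟩ : ∃ i, j = i + 1 := ⟨j - 1, by omega⟩
  have hevery : ∀ k, 1 ≤ k → k ≤ i + 1 → (A.round k).kind = .every ∨
      (k = i + 1 ∧ (A.round (i + 2)).kind = .ls) := by
    intro k hk1 hk2
    cases hk : (A.round k).kind with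
    | every => exact Or.inl rfl
    | ls => exact absurd hk (hmix k hk1 hk2).kind
    | lr =>
      have := hL.lr_ls k hk1 (by omega) hk
      rcases hk2.eq_or_lt with rfl | hlt
      · exact Or.inr ⟨rfl, this⟩
      · exact absurd this (hmix (k + 1) (by omega) (by omega)).kind
  obtain ⟨f, hf, hflex⟩ := A.exists_path_flexible hn hπ huni hab hF (i := i) (by omega) hmix
    fun k h1 h2 => (hevery k h1 (by omega)).resolve_right (by omega)
  refine ⟨fun e he => ?_, ?_⟩
  · obtain ⟨T, hT1, hT2⟩ := hflex e he
    obtain ⟨f', hf', hc⟩ := A.exists_carries_of_senders (by omega) (by omega)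
      (hmix (i + 1) (by omega) le_rfl).kind hT1 hT2
    exact ⟨f', hf.trans hf'.path, hc⟩
  · rcases hevery (i + 1) (by omega) le_rfl with h | h
    · exact Or.inr fun g hg => hf.trans
        (hflex.roundStep h (hmix _ (by omega) le_rfl).equal hg).path
    · exact Or.inl h.2

/-- In the first round both values can be obtained if the smaller one is at least as recent. -/
lemma Algorithm.flexible_one (hr : 1 ≤ A.r) (huni : (A.round 1).uni ≠ none)
    (hM : (A.round 1).mult ≠ []) {φ : RoundPred} {g : Fin n → D} {a b : D} (hab : a < b)
    {W : Finset (Fin n)} (hW : W.Nonempty) (ha : ∀ p ∈ W, g p = a) (hb : ∀ p ∉ W, g p = b)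
    (hts : ∀ p ∈ W, ∀ q ∉ W, t q ≤ t p) (hU : (A.round 1).thrU * n < (Wᶜ).card)
    (hV : φ.thrVal * n < (Wᶜ).card) : A.Flexible 1 φ t (fun p => some (g p)) a b := by
  have hn : 0 < n := hW.choose.pos
  have hn0 : (0 : ℝ) < n := by exact_mod_cast hn
  rintro e (rfl | rfl)
  · obtain ⟨p, hp, hmax⟩ := Finset.exists_max_image W t hW
    obtain ⟨q, hq⟩ : (Wᶜ).Nonempty := by
      refine Finset.card_pos.1 ?_
      have := (mul_nonneg (Round.thrU_nonneg huni) hn0.le).trans_lt hU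
      exact_mod_cast this
    have hle : ∀ q, g p ≤ g q := fun q => by
      by_cases hq : q ∈ W
      · rw [ha p hp, ha q hq]
      · rw [ha p hp, hb q hq]; exact hab.le
    refine ⟨Finset.univ, ?_, ?_⟩
    · rw [Finset.card_univ, Fintype.card_fin]
      exact mul_lt_of_lt_one_left hn0 φ.thrVal_lt_one
    · rw [← ha p hp]
      refine A.obtain_maxts hr hM (Finset.mem_univ p) (Finset.mem_univ q) ?_ ?_
        (fun q _ => hle q) fun q _ => ?_
      · rw [ha p hp, hb q (Finset.mem_compl.1 hq)]; exact hab.ne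
      · rw [Finset.card_univ, Fintype.card_fin]
        exact mul_lt_of_lt_one_left hn0 (Round.thrM_lt_one _)
      · by_cases hqW : q ∈ W
        · exact hmax q hqW
        · exact hts p hp q hqW
  · exact ⟨Wᶜ, hV, A.obtain_const_some huni (fun p hp => hb p (Finset.mem_compl.1 hp)) hU⟩

lemma Algorithm.Carries.exists_path (hL : A.LeaderAssumption) (hn : A.Large n)
    (huni : ∀ i, 1 ≤ i → i ≤ A.r → (A.round i).uni ≠ none) (π : PhasePred) (t : Fin n → ℕ)
    {i j : ℕ} {d : D} {f : Fin n → Option D} (h : A.Carries i d f) (hij : i ≤ j) (hj : j ≤ A.r) :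
    ∃ g, A.Path π t i f j g ∧ A.Carries j d g := by
  induction j, hij using Nat.le_induction with
  | base => exact ⟨f, .refl _ _, h⟩
  | succ j hij ih =>
    obtain ⟨g, hg, hc⟩ := ih (by omega)
    obtain ⟨g', hg', hc'⟩ := hc.exists_succ (t := t) (φ := π (j + 1)) hL hn (by omega)
      (huni _ (by omega) hj)
    exact ⟨g', hg.trans hg'.path, hc'⟩

lemma Algorithm.path_none (hn : A.Large n)
    (huni : ∀ i, 1 ≤ i → i ≤ A.r → (A.round i).uni ≠ none) {i j : ℕ} (hij : i ≤ j)
    (hj : j ≤ A.r) : A.Path π t i (solo n (none : Option D)) j (solo n none) := by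
  induction j, hij using Nat.le_induction with
  | base => exact .refl _ _
  | succ j hij ih =>
    exact (ih (by omega)).trans (A.roundStep_none_none hn _ (huni _ (by omega) hj)).path

/-- If all values may be erased up to round `ir`, then the state may remain as it is. -/
lemma Algorithm.phaseStep_self (hn : A.Large n)
    (huni : ∀ i, 1 ≤ i → i ≤ A.r → (A.round i).uni ≠ none) {s : State n D} {k : ℕ}
    (hk : k ≤ A.ir) (h : A.Path π s.ts 0 (fun p => some (s.inp p)) k (solo n none)) (m : ℕ) :
    A.PhaseStep m π s s := by
  have hr := A.ir_lt_r
  have := (h.trans (A.path_none hn huni hk hr.le)).phaseStep m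
    (A.path_none hn huni hr.le le_rfl)
  convert this
  cases s
  simp [State.next, solo]

/-- If a value can be carried up to a round that is not c-solo-safe, then no decision need be
taken. -/
lemma Algorithm.Carries.exists_phaseStep (hL : A.LeaderAssumption) (hn : A.Large n)
    (hπ : π ∈ A.preds) (huni : ∀ i, 1 ≤ i → i ≤ A.r → (A.round i).uni ≠ none)
    {s : State n D} {j k : ℕ} {d : D} {f : Fin n → Option D}
    (hf : A.Path π s.ts 0 (fun p => some (s.inp p)) j f) (hc : A.Carries j d f) (hj : j ≤ A.ir)
    (hjk : j < k) (hk : k ≤ A.r) (hs : ¬ A.CSoloSafe π k) (m : ℕ) :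
    (k ≤ A.ir → A.PhaseStep m π s s) ∧
    ∃ s', A.PhaseStep m π s s' ∧ s'.dec = s.dec ∧ (s' = s ∨ ∀ p, s'.inp p = d) := by
  have hr := A.ir_lt_r
  obtain ⟨k, rfl⟩ : ∃ l, k = l + 1 := ⟨k - 1, by omega⟩
  have herase : ∀ {i g}, i ≤ k → A.Carries i d g → A.Path π s.ts i g (k + 1) (solo n none) := by
    intro i g hi hg
    obtain ⟨g', hg', hc'⟩ := hg.exists_path hL hn huni π s.ts hi (by omega)
    exact hg'.trans (hc'.roundStep_none hL hn (by omega) hπ (huni _ (by omega) hk) hs).path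
  have hself : k + 1 ≤ A.ir → A.PhaseStep m π s s := fun h =>
    A.phaseStep_self hn huni h (hf.trans (herase (by omega) hc)) m
  refine ⟨hself, ?_⟩
  by_cases hkir : k + 1 ≤ A.ir
  · exact ⟨s, hself hkir, rfl, Or.inl rfl⟩
  · obtain ⟨g, hg, hcg⟩ := hc.exists_path hL hn huni π s.ts hj hr.le
    refine ⟨_, (hf.trans hg).phaseStep m
      ((herase (by omega) hcg).trans (A.path_none hn huni hk le_rfl)), ?_, Or.inr fun p => ?_⟩
    · simp [State.next, solo]
    · simp [State.next, hcg.eq_solo hL.ir_kind, solo]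

/-- An initial state in which all values but one are equal. -/
def initAlmostSolo (p₀ : Fin n) (a b : D) : State n D :=
  ⟨almostSolo p₀ a b, fun _ => 0, fun _ => none⟩

lemma Algorithm.flexible_almostSolo (hn : A.Large n) (hπ : π ∈ A.preds)
    (huni : (A.round 1).uni ≠ none) (hM : (A.round 1).mult ≠ []) {a b : D} (hab : a < b)
    {p₀ : Fin n} (hts : ∀ q, t q ≤ t p₀) :
    A.Flexible 1 (π 1) t (fun p => some (almostSolo p₀ a b p)) a b := by
  have hr : 1 ≤ A.r := A.one_le_ir.trans A.ir_lt_r.le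
  have h4 := hn.four_le
  have hc : (({p₀}ᶜ : Finset (Fin n)).card : ℝ) = n - 1 := by
    rw [Finset.card_compl, Fintype.card_fin, Finset.card_singleton, Nat.cast_sub (by omega)]
    simp
  have hU := hn.add_three_le (A.thrU_mem_constants le_rfl hr) (A.round 1).thrU_lt_one
  have hV := hn.add_three_le (A.thrVal_mem_constants le_rfl hr hπ) (π 1).thrVal_lt_one
  refine A.flexible_one hr huni hM hab (W := {p₀}) ⟨p₀, by simp⟩ (fun p hp => ?_) (fun p hp => ?_)
    (fun p hp q _ => ?_) (by rw [hc]; linarith) (by rw [hc]; linarith)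
  · rw [Finset.mem_singleton.1 hp, almostSolo_self]
  · exact almostSolo_of_ne (by simpa using hp) _ _
  · rw [Finset.mem_singleton.1 hp]; exact hts q

/-- The two ways in which the symmetry between `a` and `b` is broken: a c-preserving round may
erase all values, and a c-equalizer after rounds that are not c-preserving may make all processes
agree. -/
lemma Algorithm.erase_or_equalize (hL : A.LeaderAssumption) (hR : A.Restrictions)
    (hn : A.Large n) (hπ : π ∈ A.preds)
    (huni : ∀ i, 1 ≤ i → i ≤ A.r → (A.round i).uni ≠ none) (hk1 : (A.round 1).kind ≠ .ls)
    {a b : D} (hab : a < b) (p₀ : Fin n) (hts : ∀ q, t q ≤ t p₀) :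
    (∃ k ≤ A.ir, A.Path π t 0 (fun p => some (almostSolo p₀ a b p)) k (solo n none)) ∨
    ∃ j, 1 ≤ j ∧ j ≤ A.ir ∧ (∀ k, 1 ≤ k → k ≤ j → ¬ A.CPreserving π k) ∧ (π j).CEqualizer ∧
      ∃ e f, A.Path π t 0 (fun p => some (almostSolo p₀ a b p)) j f ∧ A.Carries j e f := by
  classical
  have h4 := hn.four_le
  have hir := A.one_le_ir
  have hr := A.ir_lt_r
  have hlast : A.CPreserving π A.ir ∨ (π A.ir).CEqualizer := by
    by_cases hk : (A.round A.ir).kind = .ls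
    · by_cases hl : (π A.ir).leader = true
      · exact Or.inr (Or.inr hl)
      · exact Or.inl (by simpa [Algorithm.CPreserving, hk] using hl)
    · left
      unfold Algorithm.CPreserving
      split
      · contradiction
      · exact Or.inr (Or.inl hR.ir_mult)
  have hex : ∃ j, 1 ≤ j ∧ (A.CPreserving π j ∨ (π j).CEqualizer) := ⟨A.ir, hir, hlast⟩
  obtain ⟨hj1, hj⟩ := Nat.find_spec hex
  have hmin : ∀ k, 1 ≤ k → k < Nat.find hex → ¬ A.CPreserving π k ∧ ¬ (π k).CEqualizer :=
    fun k h1 h2 => by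
      have := Nat.find_min hex h2
      push Not at this
      exact this h1
  have hjir : Nat.find hex ≤ A.ir := Nat.find_min' hex ⟨hir, hlast⟩
  generalize Nat.find hex = j at hj1 hj hmin hjir
  have hmix : ∀ k, 1 ≤ k → k ≤ j - 1 → A.Mixing π k := by
    intro k h1 h2
    obtain ⟨hp, he⟩ := hmin k h1 (by omega)
    have hk : (A.round k).kind ≠ .ls := fun hk =>
      he (Or.inr (A.leader_of_not_cPreserving hp hk))
    exact ⟨hk, (A.mult_ne_nil_of_not_cPreserving hp hk).1,
      Bool.eq_false_iff.2 fun h => he (Or.inl h)⟩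
  have hbefore : j = 1 ∨ (2 ≤ j ∧
      (∃ f, A.Path π t 0 (fun p => some (almostSolo p₀ a b p)) (j - 1) f ∧
        A.Carries (j - 1) a f) ∧ ((A.round j).kind = .ls ∨
        A.AllPatterns π t (fun p => some (almostSolo p₀ a b p)) (j - 1) a b)) := by
    rcases hj1.eq_or_lt with h | h
    · exact Or.inl h.symm
    · right
      have := A.reach_of_mixing hL hn hπ huni hab
        (A.flexible_almostSolo hn hπ (huni 1 le_rfl (by omega))
          (hmix 1 le_rfl (by omega)).mult hab hts) (j := j - 1) (by omega) (by omega) hmix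
      rw [Nat.sub_add_cancel hj1] at this
      exact ⟨h, this.1 a (Or.inl rfl), this.2⟩
  obtain ⟨i, rfl⟩ : ∃ i, j = i + 1 := ⟨j - 1, by omega⟩
  rw [Nat.add_sub_cancel] at hbefore
  have huj := huni (i + 1) hj1 (by omega)
  by_cases hp : A.CPreserving π (i + 1)
  · left
    refine ⟨i + 1, hjir, ?_⟩
    have hkill := hp.roundStep_none (t := t) hn hj1 (by omega) hπ huj hab.ne p₀
    rcases hbefore with h | ⟨-, ⟨f, hf, -⟩, h | h⟩
    · obtain rfl : i = 0 := by omega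
      exact hkill.path
    · refine hf.trans (A.lsStep_none (by omega) h ?_).path
      simpa [Algorithm.CPreserving, h] using hp
    · exact (h _ fun p => almostSolo_eq _ _ _ _).trans hkill.path
  · right
    refine ⟨i + 1, hj1, hjir, fun k h1 h2 => ?_, hj.resolve_left hp, ?_⟩
    · rcases h2.eq_or_lt with rfl | h2
      · exact hp
      · exact (hmin k h1 h2).1
    rcases hbefore with h | ⟨-, ⟨f, hf, hc⟩, -⟩
    · obtain rfl : i = 0 := by omega
      obtain ⟨T, hT1, hT2⟩ := A.flexible_almostSolo hn hπ huj
        (A.mult_ne_nil_of_not_cPreserving hp hk1).1 hab hts a (Or.inl rfl)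
      obtain ⟨f, hf, hc⟩ := A.exists_carries_of_senders (by omega) le_rfl hk1 hT1 hT2
      exact ⟨a, f, hf.path, hc⟩
    · obtain ⟨f', hf', hc'⟩ := hc.exists_succ (t := t) (φ := π (i + 1)) hL hn (by omega) huj
      exact ⟨a, f', hf.trans hf'.path, hc'⟩

lemma Algorithm.phaseStep_almostSolo_of_not_unifier (hL : A.LeaderAssumption)
    (hR : A.Restrictions) (hn : A.Large n) (hπ : π ∈ A.preds)
    (huni : ∀ i, 1 ≤ i → i ≤ A.r → (A.round i).uni ≠ none) (hk1 : (A.round 1).kind ≠ .ls)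
    {a b : D} (hab : a < b) (p₀ : Fin n) (hU : ¬ A.StrongCUnifier π) (m : ℕ) :
    A.PhaseStep m π (initAlmostSolo p₀ a b) (initAlmostSolo p₀ a b) := by
  rcases A.erase_or_equalize (t := fun _ => 0) hL hR hn hπ huni hk1 hab p₀ (fun _ => le_rfl) with
    ⟨k, hk, h⟩ | ⟨j, hj1, hjir, hpres, heq, e, f, hf, hc⟩
  · exact A.phaseStep_self (s := initAlmostSolo p₀ a b) hn huni hk h m
  · obtain ⟨-, hthr⟩ := A.mult_ne_nil_of_not_cPreserving (hpres 1 le_rfl hj1) hk1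
    obtain ⟨k, hjk, hkir, hk⟩ : ∃ k, j + 1 ≤ k ∧ k ≤ A.ir ∧ ¬ A.CSoloSafe π k := by
      by_contra! hno
      exact hU ⟨⟨hthr.2, Or.inl hthr.1, j, hj1, hjir, heq,
        fun k h1 h2 => hpres k (by omega) h2, hno⟩, hthr.1⟩
    exact (Carries.exists_phaseStep (s := initAlmostSolo p₀ a b) hL hn hπ huni hf hc hjir
      (by omega) (hkir.trans A.ir_lt_r.le) hk m).1 hkir

lemma Algorithm.exists_phaseStep_almostSolo_of_not_decider (hL : A.LeaderAssumption)
    (hR : A.Restrictions) (hn : A.Large n) (hπ : π ∈ A.preds)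
    (huni : ∀ i, 1 ≤ i → i ≤ A.r → (A.round i).uni ≠ none) (hk1 : (A.round 1).kind ≠ .ls)
    {a b : D} (hab : a < b) (p₀ : Fin n) (hD : ¬ A.CDecider π) (m : ℕ) :
    ∃ s', A.PhaseStep m π (initAlmostSolo p₀ a b) s' ∧ (∀ p, s'.dec p = none) ∧
      (s' = initAlmostSolo p₀ a b ∨ ∃ d, ∀ p, s'.inp p = d) := by
  rcases A.erase_or_equalize (t := fun _ => 0) hL hR hn hπ huni hk1 hab p₀ (fun _ => le_rfl) with
    ⟨k, hk, h⟩ | ⟨j, hj1, hjir, hpres, -, e, f, hf, hc⟩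
  · exact ⟨_, A.phaseStep_self (s := initAlmostSolo p₀ a b) hn huni hk h m, fun _ => rfl,
      Or.inl rfl⟩
  · unfold Algorithm.CDecider at hD
    push Not at hD
    obtain ⟨k, hk1', hkr, hk⟩ := hD
    have hjk : j < k := by
      by_contra! hkj
      refine hk ?_
      have hp := hpres k hk1' hkj
      unfold Algorithm.CSoloSafe
      split
      · rename_i hls
        exact A.leader_of_not_cPreserving hp hls
      · rename_i hls
        exact ⟨Round.thrU_nonneg (huni k hk1' hkr), (A.mult_ne_nil_of_not_cPreserving hp hls).2.1⟩
    obtain ⟨s', h1, h2, h3⟩ := (Carries.exists_phaseStep (s := initAlmostSolo p₀ a b) hL hn hπ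
      huni hf hc hjir hjk hkr hk m).2
    exact ⟨s', h1, fun p => by rw [h2]; rfl, h3.imp id fun h => ⟨e, h⟩⟩

lemma Algorithm.exists_phaseStep_solo_of_not_decider (hL : A.LeaderAssumption) (hn : A.Large n)
    (hπ : π ∈ A.preds) (huni : ∀ i, 1 ≤ i → i ≤ A.r → (A.round i).uni ≠ none)
    (hD : ¬ A.CDecider π) {s : State n D} {d : D} (hs : ∀ p, s.inp p = d) (m : ℕ) :
    ∃ s', A.PhaseStep m π s s' ∧ s'.dec = s.dec ∧ ∀ p, s'.inp p = d := by
  unfold Algorithm.CDecider at hD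
  push Not at hD
  obtain ⟨k, hk1, hkr, hk⟩ := hD
  have hc : A.Carries 0 d fun p => some (s.inp p) :=
    Or.inr ⟨Or.inl rfl, funext fun p => by rw [hs]; rfl⟩
  obtain ⟨s', h1, h2, h3⟩ := (hc.exists_phaseStep hL hn hπ huni (.refl _ _) (Nat.zero_le _)
    hk1 hkr hk m).2
  refine ⟨s', h1, h2, ?_⟩
  rcases h3 with rfl | h3
  exacts [hs, h3]

lemma RoundPred.thrVal_mono {φ ψ : RoundPred} (h : ψ.thr ≤ φ.thr) : ψ.thrVal ≤ φ.thrVal := by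
  unfold RoundPred.thrVal
  cases hψ : ψ.thr with
  | bot =>
    cases hφ : φ.thr with
    | bot => exact le_rfl
    | coe c =>
      simp only [WithBot.recBotCoe_bot, WithBot.recBotCoe_coe]
      linarith [c.2.1]
  | coe u =>
    cases hφ : φ.thr with
    | bot => rw [hψ, hφ] at h; simp at h
    | coe c =>
      rw [hψ, hφ, WithBot.coe_le_coe] at h
      exact h

lemma Algorithm.CDecider.spor (hImp : A.SporadicImpliesGlobal) (h : A.CDecider A.glob)
    (j : Fin A.k) : A.CDecider (A.spor j) := by
  intro i h1 hr
  obtain ⟨-, hl, ht⟩ := hImp j i h1 hr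
  have := h i h1 hr
  unfold Algorithm.CSoloSafe at this ⊢
  split
  · rename_i hk
    rw [hk] at this
    exact hl this
  · rename_i hk
    split at this
    · contradiction
    · exact ⟨this.1, this.2.trans (RoundPred.thrVal_mono ht)⟩

/-- Without a strong c-unifier the initial state `initAlmostSolo` may remain as it is forever, and
without a c-decider after it no decision need be taken. -/
theorem Algorithm.exists_unifier_decider_of_termination [Nontrivial D]
    (hImp : A.SporadicImpliesGlobal) (hL : A.LeaderAssumption) (hR : A.Restrictions)
    (huni : ∀ i, 1 ≤ i → i ≤ A.r → (A.round i).uni ≠ none) (hk1 : (A.round 1).kind ≠ .ls)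
    (h : A.Termination D) :
    ∃ i j : Fin A.k, i ≤ j ∧ A.StrongCUnifier (A.spor i) ∧ A.CDecider (A.spor j) := by
  by_contra! hno
  obtain ⟨a, b, hab⟩ := exists_pair_lt D
  obtain ⟨n, hn⟩ := A.exists_large
  have h4 := hn.four_le
  have hgU : ¬ A.StrongCUnifier A.glob := fun hU => by
    obtain ⟨i, h1, hi, he, -⟩ := hU.1.2.2
    exact hR.no_equalizer i h1 (hi.trans A.ir_lt_r.le) he
  have hgπ : A.glob ∈ A.preds := Or.inl rfl
  have hsπ : ∀ j, A.spor j ∈ A.preds := fun j => Or.inr ⟨j, rfl⟩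
  let p₀ : Fin n := ⟨0, by omega⟩
  let Inv : ℕ → State n D → Prop := fun l s => (∀ p, s.dec p = none) ∧
    (s = initAlmostSolo p₀ a b ∨
      (∃ i : Fin A.k, i.val < l ∧ A.StrongCUnifier (A.spor i)) ∧ ∃ d, ∀ p, s.inp p = d)
  suffices ∃ σ : ℕ → State n D, A.IsExecution σ ∧ ∀ l, Inv l (σ l) by
    obtain ⟨σ, hσ, hinv⟩ := this
    obtain ⟨l, hl⟩ := h n σ hσ
    exact hl p₀ ((hinv l).1 p₀)
  refine A.exists_execution hImp (m := fun j => j) (fun _ _ h => h)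
    (s₀ := initAlmostSolo p₀ a b) (fun _ => rfl) (fun _ => rfl) Inv
    ⟨fun _ => rfl, Or.inl rfl⟩ ?_ ?_
  · rintro j s ⟨hdec, rfl | ⟨⟨i, hi, hU⟩, d, hd⟩⟩
    · by_cases hU : A.StrongCUnifier (A.spor j)
      · obtain ⟨s', h1, h2, h3⟩ := A.exists_phaseStep_almostSolo_of_not_decider hL hR hn (hsπ j)
          huni hk1 hab p₀ (hno j j le_rfl hU) (j + 1)
        exact ⟨s', h1, h2, h3.imp id fun h => ⟨⟨j, by simp, hU⟩, h⟩⟩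
      · exact ⟨_, A.phaseStep_almostSolo_of_not_unifier hL hR hn (hsπ j) huni hk1 hab p₀ hU _,
          fun _ => rfl, Or.inl rfl⟩
    · obtain ⟨s', h1, h2, h3⟩ := A.exists_phaseStep_solo_of_not_decider hL hn (hsπ j) huni
        (hno i j (Fin.le_def.2 hi.le) hU) hd (j + 1)
      exact ⟨s', h1, fun p => by rw [h2, hdec], Or.inr ⟨⟨i, by omega, hU⟩, d, h3⟩⟩
  · rintro l s - ⟨hdec, rfl | ⟨⟨i, hi, hU⟩, d, hd⟩⟩
    · exact ⟨_, A.phaseStep_almostSolo_of_not_unifier hL hR hn hgπ huni hk1 hab p₀ hgU _,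
          fun _ => rfl, Or.inl rfl⟩
    · obtain ⟨s', h1, h2, h3⟩ := A.exists_phaseStep_solo_of_not_decider hL hn hgπ huni
        (fun h => hno i i le_rfl hU (h.spor hImp i)) hd (l + 1)
      exact ⟨s', h1, fun p => by rw [h2, hdec], Or.inr ⟨⟨i, by omega, hU⟩, d, h3⟩⟩

/-- Without a `mult` instruction in the first round, nobody need obtain a value from a mixed
state. -/
theorem Algorithm.mult_ne_nil_of_termination [Nontrivial D]
    (hImp : A.SporadicImpliesGlobal)
    (huni : ∀ i, 1 ≤ i → i ≤ A.r → (A.round i).uni ≠ none) (hk1 : (A.round 1).kind ≠ .ls)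
    (h : A.Termination D) : (A.round 1).mult ≠ [] := by
  intro hM
  obtain ⟨a, b, hab⟩ := exists_pair_lt D
  obtain ⟨n, hn⟩ := A.exists_large
  have h4 := hn.four_le
  have hir := A.one_le_ir
  have hr := A.ir_lt_r
  let p₀ : Fin n := ⟨0, by omega⟩
  have step : ∀ π ∈ A.preds, ∀ m,
      A.PhaseStep m π (initAlmostSolo p₀ a b) (initAlmostSolo p₀ a b) := by
    intro π hπ m
    have hp : A.CPreserving π 1 := by
      unfold Algorithm.CPreserving
      split
      · contradiction
      · exact Or.inr (Or.inl hM)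
    exact A.phaseStep_self (s := initAlmostSolo p₀ a b) hn huni hir
      (RoundStep.path (hp.roundStep_none hn le_rfl (by omega) hπ (huni 1 le_rfl (by omega))
        hab.ne p₀)) m
  obtain ⟨σ, hσ, hinv⟩ := A.exists_execution hImp (m := fun j => j) (fun _ _ h => h)
    (s₀ := initAlmostSolo p₀ a b) (fun _ => rfl) (fun _ => rfl)
    (fun _ s => s = initAlmostSolo p₀ a b) rfl
    (fun j s hs => ⟨s, hs ▸ step _ (Or.inr ⟨j, rfl⟩) _, hs⟩)
    (fun l s _ hs => ⟨s, hs ▸ step _ (Or.inl rfl) _, hs⟩)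
  obtain ⟨l, hl⟩ := h n σ hσ
  exact hl p₀ (by rw [hinv l]; rfl)

end HeardOf

/-! ### Necessity: disagreement -/

namespace HeardOf

variable {D : Type*} {n : ℕ} {A : Algorithm}

/-- The tuple in which the processes in `X` have value `e` and the others are undefined. -/
def pattern (e : D) (X : Finset (Fin n)) : Fin n → Option D :=
  fun p => if p ∈ X then some e else none

lemma pattern_of_mem {e : D} {X : Finset (Fin n)} {p : Fin n} (h : p ∈ X) :
    pattern e X p = some e := if_pos h

lemma pattern_of_notMem {e : D} {X : Finset (Fin n)} {p : Fin n} (h : p ∉ X) :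
    pattern e X p = none := if_neg h

lemma pattern_eq (e : D) (X : Finset (Fin n)) (p : Fin n) :
    pattern e X p = some e ∨ pattern e X p = none := by
  by_cases h : p ∈ X
  exacts [Or.inl (pattern_of_mem h), Or.inr (pattern_of_notMem h)]

lemma filter_isSome_pattern (e : D) (X T : Finset (Fin n)) :
    (T.filter fun p => (pattern e X p).isSome) = T ∩ X := by
  ext p
  by_cases h : p ∈ X <;> simp [pattern, h]

lemma one_eq_pattern (q : Fin n) (e : D) : one q (some e) = pattern e {q} := by
  funext p
  simp [one_apply, pattern]

/-- The number of occurrences of a value in round `i` is critical: the `uni` instruction applies if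
all of them are received, but not if one is missing.  In an `ls` round one occurrence is enough. -/
def Algorithm.Critical (A : Algorithm) (i : ℕ) (X : Finset (Fin n)) : Prop :=
  X.Nonempty ∧ ((A.round i).kind ≠ .ls → X.card = ⌊(A.round i).thrU * n⌋₊ + 1)

lemma Algorithm.Large.floor_le {A : Algorithm} (hn : A.Large n) {i : ℕ} (h1 : 1 ≤ i)
    (hr : i ≤ A.r) (huni : (A.round i).uni ≠ none) : ⌊(A.round i).thrU * n⌋₊ + 3 ≤ n := by
  have hfl := Nat.floor_le (mul_nonneg ((A.round i).thrU_nonneg huni) (Nat.cast_nonneg (α := ℝ) n))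
  have := hn.add_three_le (A.thrU_mem_constants h1 hr) (A.round i).thrU_lt_one
  have : (⌊(A.round i).thrU * n⌋₊ : ℝ) + 3 ≤ n := by linarith
  exact_mod_cast this

lemma Algorithm.exists_critical_subset (hn : A.Large n) {i : ℕ} (h1 : 1 ≤ i) (hr : i ≤ A.r)
    (huni : (A.round i).uni ≠ none) (p₀ : Fin n) :
    ∃ X : Finset (Fin n), p₀ ∉ X ∧ X.card = ⌊(A.round i).thrU * n⌋₊ + 1 ∧ A.Critical i X := by
  have hle := hn.floor_le h1 hr huni
  obtain ⟨X, hX, hXc⟩ := Finset.exists_subset_card_eq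
    (s := ({p₀}ᶜ : Finset (Fin n))) (n := ⌊(A.round i).thrU * n⌋₊ + 1)
    (by rw [Finset.card_compl, Fintype.card_fin, Finset.card_singleton]; omega)
  exact ⟨X, fun h => by simpa using hX h, hXc, Finset.card_pos.1 (by omega), fun _ => hXc⟩

/-- If an `lr` round precedes, then a single occurrence is critical. -/
lemma Algorithm.exists_critical (hL : A.LeaderAssumption) (hn : A.Large n) {i : ℕ} (h1 : 1 ≤ i)
    (hr : i + 1 ≤ A.r) (huni : (A.round (i + 1)).uni ≠ none) :
    ∃ X : Finset (Fin n), A.Critical (i + 1) X ∧ ((A.round i).kind = .lr → ∃ q, X = {q}) := by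
  have h4 := hn.four_le
  by_cases hk : (A.round i).kind = .lr
  · exact ⟨{⟨0, by omega⟩}, ⟨by simp, fun h => absurd (hL.lr_ls i h1 hr hk) h⟩, fun _ => ⟨_, rfl⟩⟩
  · obtain ⟨X, -, -, hX⟩ := A.exists_critical_subset hn (by omega) hr huni ⟨0, by omega⟩
    exact ⟨X, hX, fun h => absurd h hk⟩

variable [LinearOrder D] {t : Fin n → ℕ}

/-- From a critical number of occurrences of `e`, every pattern of `e` and the undefined value is
possible, as far as the type of the round allows. -/
lemma Algorithm.roundStep_pattern (hn : A.Large n) {i : ℕ} (h1 : 1 ≤ i) (hr : i ≤ A.r)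
    (huni : (A.round i).uni ≠ none) (heq : ¬ (A.glob i).CEqualizer) {X Y : Finset (Fin n)}
    (hX : A.Critical i X) (hY : (A.round i).kind = .lr → ∃ q, Y = {q}) (e : D) :
    A.RoundStep i (A.glob i) t (pattern e X) (pattern e Y) := by
  classical
  have h4 := hn.four_le
  obtain ⟨⟨x, hx⟩, hXc⟩ := hX
  by_cases hk : (A.round i).kind = .ls
  · have hl : ¬ (A.glob i).leader = true := fun h => heq (Or.inr h)
    simp only [Algorithm.RoundStep, hk, Algorithm.LsStep, if_neg huni, if_neg hl]
    exact ⟨some e, ⟨x, pattern_of_mem hx⟩, fun p => pattern_eq e Y p⟩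
  have hXc := hXc hk
  have h0 := mul_nonneg ((A.round i).thrU_nonneg huni) (Nat.cast_nonneg (α := ℝ) n)
  have hV := hn.add_three_le (A.thrVal_mem_constants h1 hr (Or.inl rfl)) (A.glob i).thrVal_lt_one
  have hall : A.obtain i t (pattern e X) Finset.univ = some e := by
    refine A.obtain_const huni (fun p _ => pattern_eq e X p) ?_
    rw [filter_isSome_pattern, Finset.univ_inter, hXc]
    exact_mod_cast Nat.lt_floor_add_one _
  have hmiss : A.obtain i t (pattern e X) (Finset.univ.erase x) = none := by
    refine A.obtain_none_of_const (fun p _ => pattern_eq e X p) ?_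
    rw [filter_isSome_pattern, Finset.erase_inter, Finset.univ_inter, Finset.card_erase_of_mem hx,
      hXc, Nat.add_sub_cancel]
    exact Nat.floor_le h0
  have huniv : (A.glob i).thrVal * n < (Finset.univ : Finset (Fin n)).card := by
    rw [Finset.card_univ, Fintype.card_fin]; linarith
  have herase : (A.glob i).thrVal * n < ((Finset.univ : Finset (Fin n)).erase x).card := by
    rw [Finset.card_erase_of_mem (Finset.mem_univ x), Finset.card_univ, Fintype.card_fin,
      Nat.cast_sub (by omega)]
    push_cast
    linarith
  cases hkk : (A.round i).kind with
  | every =>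
    simp only [Algorithm.RoundStep, hkk]
    have := A.everyStep_of_senders (i := i) (φ := A.glob i) (t := t) (f := pattern e X)
      (fun p => if p ∈ Y then Finset.univ else Finset.univ.erase x)
      (fun p => by split_ifs <;> assumption) fun h => absurd (Or.inl h) heq
    convert this using 2 with p
    by_cases hp : p ∈ Y
    · rw [pattern_of_mem hp, if_pos hp, hall]
    · rw [pattern_of_notMem hp, if_neg hp, hmiss]
  | lr =>
    obtain ⟨q, rfl⟩ := hY hkk
    have := A.lrStep_of_senders (t := t) (f := pattern e X) hkk huniv q
    rwa [hall, one_eq_pattern] at this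
  | ls => exact absurd hkk hk

/-- Under the global predicate all patterns of `e` and the undefined value are possible after
round `i`, as far as the type of the round allows. -/
def Algorithm.Spreads (A : Algorithm) (t : Fin n → ℕ) (f₀ : Fin n → Option D) (i : ℕ) (e : D) :
    Prop :=
  ∀ X : Finset (Fin n), ((A.round i).kind = .lr → ∃ q, X = {q}) →
    A.Path A.glob t 0 f₀ i (pattern e X)

lemma Algorithm.path_pattern (hL : A.LeaderAssumption) (hR : A.Restrictions) (hn : A.Large n)
    (huni : ∀ i, 1 ≤ i → i ≤ A.r → (A.round i).uni ≠ none) {i j : ℕ}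
    {X Y : Finset (Fin n)} (hX : A.Critical (i + 1) X) (hij : i + 1 ≤ j) (hj : j ≤ A.r)
    (hY : (A.round j).kind = .lr → ∃ q, Y = {q}) (e : D) :
    A.Path A.glob t i (pattern e X) j (pattern e Y) := by
  induction j, hij using Nat.le_induction generalizing Y with
  | base => exact (A.roundStep_pattern hn (by omega) hj (huni _ (by omega) hj)
      (hR.no_equalizer _ (by omega) hj) hX hY e).path
  | succ j hij ih =>
    obtain ⟨Z, hZ, hZlr⟩ := A.exists_critical hL hn (by omega) hj (huni _ (by omega) hj)
    exact (ih (by omega) hZlr).trans (A.roundStep_pattern hn (by omega) hj (huni _ (by omega) hj)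
      (hR.no_equalizer _ (by omega) hj) hZ hY e).path

lemma Algorithm.Spreads.mono (hL : A.LeaderAssumption) (hR : A.Restrictions) (hn : A.Large n)
    (huni : ∀ i, 1 ≤ i → i ≤ A.r → (A.round i).uni ≠ none) {f₀ : Fin n → Option D} {i j : ℕ}
    {e : D} (h : A.Spreads t f₀ i e) (h1 : 1 ≤ i) (hij : i ≤ j) (hj : j ≤ A.r) :
    A.Spreads t f₀ j e := by
  rcases hij.eq_or_lt with rfl | hlt
  · exact h
  · intro Y hY
    obtain ⟨Z, hZ, hZlr⟩ := A.exists_critical hL hn h1 (by omega) (huni _ (by omega) (by omega))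
    exact (h Z hZlr).trans (A.path_pattern hL hR hn huni hZ hlt hj hY e)

lemma Algorithm.Spreads.phaseStep (hL : A.LeaderAssumption) (hR : A.Restrictions) (hn : A.Large n)
    (huni : ∀ i, 1 ≤ i → i ≤ A.r → (A.round i).uni ≠ none) {s : State n D} {e : D}
    (h : A.Spreads s.ts (fun p => some (s.inp p)) A.ir e) {X : Finset (Fin n)}
    (hX : A.Critical (A.ir + 1) X) (Y : Finset (Fin n)) (m : ℕ) :
    A.PhaseStep m A.glob s (s.next m (pattern e X) (pattern e Y)) :=
  (h X fun hk => absurd hk hL.ir_kind).phaseStep m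
    (A.path_pattern hL hR hn huni hX A.ir_lt_r le_rfl (fun hk => absurd hk hL.last_kind) e)

/-- An `ls` round without `φ_ls` may spread any value. -/
lemma Algorithm.spreads_of_ls {i : ℕ} {f f₀ : Fin n → Option D} {e : D}
    (hf : A.Path A.glob t 0 f₀ i f) (huni : (A.round (i + 1)).uni ≠ none)
    (heq : ¬ (A.glob (i + 1)).CEqualizer) (hk : (A.round (i + 1)).kind = .ls)
    (he : some e ∈ Set.range f) : A.Spreads t f₀ (i + 1) e := by
  refine fun X _ => hf.trans (Algorithm.RoundStep.path ?_)
  have hl : ¬ (A.glob (i + 1)).leader = true := fun h => heq (Or.inr h)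
  simp only [Algorithm.RoundStep, hk, Algorithm.LsStep, if_neg huni, if_neg hl]
  exact ⟨some e, he, fun p => pattern_eq e X p⟩

/-- A round without `mult` instruction may spread the value of all but one processes. -/
lemma Algorithm.roundStep_pattern_of_mult_eq_nil (hn : A.Large n) {i : ℕ} (h1 : 1 ≤ i)
    (hr : i ≤ A.r) (huni : (A.round i).uni ≠ none) (heq : ¬ (A.glob i).CEqualizer)
    (hk : (A.round i).kind ≠ .ls) (hM : (A.round i).mult = []) {Y : Finset (Fin n)}
    (hY : (A.round i).kind = .lr → ∃ q, Y = {q}) {d e : D} (hde : d ≠ e) (p₀ : Fin n) :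
    A.RoundStep i (A.glob i) t (fun p => some (almostSolo p₀ d e p)) (pattern e Y) := by
  classical
  have h4 := hn.four_le
  have hV := hn.add_three_le (A.thrVal_mem_constants h1 hr (Or.inl rfl)) (A.glob i).thrVal_lt_one
  have hU := hn.add_three_le (A.thrU_mem_constants h1 hr) (A.round i).thrU_lt_one
  have hc : (({p₀}ᶜ : Finset (Fin n)).card : ℝ) = n - 1 := by
    rw [Finset.card_compl, Fintype.card_fin, Finset.card_singleton, Nat.cast_sub (by omega)]
    simp
  obtain ⟨p₁, hp₁⟩ : ∃ p₁, p₁ ∈ ({p₀}ᶜ : Finset (Fin n)) := by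
    apply Finset.card_pos.1
    rw [Finset.card_compl, Fintype.card_fin, Finset.card_singleton]
    omega
  have hp₁' : p₁ ≠ p₀ := by simpa using hp₁
  have hsome : A.obtain i t (fun p => some (almostSolo p₀ d e p)) {p₀}ᶜ = some e :=
    A.obtain_const_some huni (fun p hp => almostSolo_of_ne (by simpa using hp) _ _)
      (by rw [hc]; linarith)
  have hnone : A.obtain i t (fun p => some (almostSolo p₀ d e p)) Finset.univ = none :=
    A.obtain_none_of_mixed h1 hr (Finset.mem_univ p₀) (Finset.mem_univ p₁)
      (by rwa [almostSolo_self, almostSolo_of_ne hp₁']) fun h => absurd hM h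
  have huniv : (A.glob i).thrVal * n < (Finset.univ : Finset (Fin n)).card := by
    rw [Finset.card_univ, Fintype.card_fin]; linarith
  have hcompl : (A.glob i).thrVal * n < ({p₀}ᶜ : Finset (Fin n)).card := by rw [hc]; linarith
  cases hkk : (A.round i).kind with
  | every =>
    simp only [Algorithm.RoundStep, hkk]
    have := A.everyStep_of_senders (i := i) (φ := A.glob i) (t := t)
      (f := fun p => some (almostSolo p₀ d e p)) (fun p => if p ∈ Y then {p₀}ᶜ else Finset.univ)
      (fun p => by split_ifs <;> assumption) fun h => absurd (Or.inl h) heq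
    convert this using 2 with p
    by_cases hp : p ∈ Y
    · rw [pattern_of_mem hp, if_pos hp, hsome]
    · rw [pattern_of_notMem hp, if_neg hp, hnone]
  | lr =>
    obtain ⟨q, rfl⟩ := hY hkk
    have := A.lrStep_of_senders (t := t) (f := fun p => some (almostSolo p₀ d e p)) hkk hcompl q
    rwa [hsome, one_eq_pattern] at this
  | ls => exact absurd hkk hk

/-- From a state in which both of two values can be obtained in the first round, each of them can be
spread, since round `ir` has no `mult` instruction. -/
lemma Algorithm.spreads_of_flexible (hL : A.LeaderAssumption) (hR : A.Restrictions)
    (hn : A.Large n) (huni : ∀ i, 1 ≤ i → i ≤ A.r → (A.round i).uni ≠ none)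
    (hM : (A.round 1).mult ≠ []) {f₀ : Fin n → Option D} {a b : D} (hab : a < b)
    (hF : A.Flexible 1 (A.glob 1) t f₀ a b) {e : D} (he : e = a ∨ e = b) :
    A.Spreads t f₀ A.ir e := by
  classical
  have h4 := hn.four_le
  have hir := A.one_le_ir
  have hr := A.ir_lt_r
  have hex : ∃ j, 1 ≤ j ∧ (A.round j).mult = [] := ⟨A.ir, hir, hR.ir_mult⟩
  obtain ⟨hj1, hj⟩ := Nat.find_spec hex
  have hmin : ∀ k, 1 ≤ k → k < Nat.find hex → (A.round k).mult ≠ [] :=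
    fun k h1 h2 h3 => Nat.find_min hex h2 ⟨h1, h3⟩
  have hjir : Nat.find hex ≤ A.ir := Nat.find_min' hex ⟨hir, hR.ir_mult⟩
  generalize Nat.find hex = j at hj1 hj hmin hjir
  obtain ⟨i, rfl⟩ : ∃ i, j = i + 1 := ⟨j - 1, by omega⟩
  have hi : 1 ≤ i := by
    rcases Nat.eq_zero_or_pos i with rfl | h
    · exact absurd hj hM
    · exact h
  have hmix : ∀ k, 1 ≤ k → k ≤ i → A.Mixing A.glob k := fun k h1 h2 =>
    ⟨fun hk => hmin k h1 (by omega) (hL.ls_mult k h1 (by omega) hk), hmin k h1 (by omega),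
      Bool.eq_false_iff.2 fun h => hR.no_equalizer k h1 (by omega) (Or.inl h)⟩
  have huj := huni (i + 1) hj1 (by omega)
  have heq := hR.no_equalizer (i + 1) hj1 (by omega)
  suffices A.Spreads t f₀ (i + 1) e from this.mono hL hR hn huni hj1 hjir hr.le
  obtain ⟨hcarry, hpat⟩ := A.reach_of_mixing hL hn (Or.inl rfl) huni hab hF hi (by omega) hmix
  by_cases hk : (A.round (i + 1)).kind = .ls
  · obtain ⟨f, hf, hc⟩ := hcarry e he
    refine A.spreads_of_ls hf huj heq hk ?_
    rcases hc with ⟨-, -, q, rfl⟩ | ⟨-, rfl⟩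
    · exact ⟨q, by simp [one_apply]⟩
    · exact ⟨⟨0, by omega⟩, rfl⟩
  · intro X hX
    obtain ⟨d, hd, hde⟩ : ∃ d, (d = a ∨ d = b) ∧ d ≠ e := by
      rcases he with rfl | rfl
      exacts [⟨b, Or.inr rfl, hab.ne'⟩, ⟨a, Or.inl rfl, hab.ne⟩]
    let p₀ : Fin n := ⟨0, by omega⟩
    refine (hpat.resolve_left hk (almostSolo p₀ d e) fun p => ?_).trans
      (A.roundStep_pattern_of_mult_eq_nil hn hj1 (by omega) huj heq hk hj hX hde p₀).path
    rcases almostSolo_eq p₀ p d e with h | h <;> rw [h]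
    exacts [hd, he]

/-- Two phases under the global predicate that lead to different decisions violate agreement: they
can be completed to an execution. -/
lemma Algorithm.not_agreement (hImp : A.SporadicImpliesGlobal) {s₀ s₁ s₂ : State n D}
    (hts : ∀ p, s₀.ts p = 0) (hdec : ∀ p, s₀.dec p = none) (h1 : A.PhaseStep 1 A.glob s₀ s₁)
    (h2 : A.PhaseStep 2 A.glob s₁ s₂) {p q : Fin n} {d e : D} (hp : s₂.dec p = some d)
    (hq : s₂.dec q = some e) (hde : d ≠ e) : ¬ A.Agreement D := by
  intro hA
  obtain ⟨σ, hσ, hinv⟩ := A.exists_execution hImp (m := fun j => j + 2)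
    (fun i j h => Nat.add_lt_add_right h 2) hts hdec
    (fun l s => (l = 0 → s = s₀) ∧ (l = 1 → s = s₁) ∧ (l = 2 → s = s₂))
    ⟨fun _ => rfl, by omega, by omega⟩
    (fun j s _ => by
      obtain ⟨s', hs'⟩ := A.exists_phaseStep p.pos (j + 2 + 1) (A.spor j) s
      exact ⟨s', hs', by omega, by omega, by omega⟩)
    (fun l s _ ⟨hl0, hl1, _⟩ => by
      match l with
      | 0 => exact ⟨s₁, hl0 rfl ▸ h1, by omega, fun _ => rfl, by omega⟩
      | 1 => exact ⟨s₂, hl1 rfl ▸ h2, by omega, by omega, fun _ => rfl⟩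
      | l + 2 =>
        obtain ⟨s', hs'⟩ := A.exists_phaseStep p.pos (l + 2 + 1) A.glob s
        exact ⟨s', hs', by omega, by omega, by omega⟩)
  have hs := (hinv 2).2.2 rfl
  rcases hA n σ hσ 2 p q with h | h | h <;> rw [hs] at h
  · exact hde (Option.some_inj.1 (hp.symm.trans (h.trans hq)))
  · rw [hp] at h; cases h
  · rw [hq] at h; cases h

/-- If a value can be decided in a phase, and another process can then decide on
another value, then agreement is violated. -/
lemma Algorithm.Spreads.not_agreement (hImp : A.SporadicImpliesGlobal) (hL : A.LeaderAssumption)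
    (hR : A.Restrictions) (hn : A.Large n)
    (huni : ∀ i, 1 ≤ i → i ≤ A.r → (A.round i).uni ≠ none) {s : State n D}
    (hts : ∀ p, s.ts p = 0) (hdec : ∀ p, s.dec p = none) {e : D}
    (h : A.Spreads s.ts (fun p => some (s.inp p)) A.ir e) {X : Finset (Fin n)}
    (hX : A.Critical (A.ir + 1) X) {p q : Fin n} (hpq : p ≠ q) {s' : State n D} {d : D}
    {f g : Fin n → Option D} (hs' : s' = s.next 1 (pattern e X) (pattern e {p}))
    (hf : A.Path A.glob s'.ts 0 (fun p => some (s'.inp p)) A.ir f)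
    (hg : A.Path A.glob s'.ts A.ir f A.r g) (hd : g q = some d) (hde : d ≠ e) :
    ¬ A.Agreement D := by
  refine A.not_agreement hImp hts hdec (h.phaseStep hL hR hn huni hX {p} 1)
    (hs' ▸ hf.phaseStep 2 hg) (p := q) (q := p) ?_ ?_ hde
  · simp [State.next, hdec, pattern, hpq.symm, hd]
  · simp [State.next, hdec, pattern]

/-- If no timestamps are used in the first round, then any value can be spread in any phase. -/
theorem Algorithm.kind_one_ne_ls_of_agreement [Nontrivial D] (hImp : A.SporadicImpliesGlobal)
    (hL : A.LeaderAssumption) (hR : A.Restrictions)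
    (huni : ∀ i, 1 ≤ i → i ≤ A.r → (A.round i).uni ≠ none) (h : A.Agreement D) :
    (A.round 1).kind ≠ .ls := by
  intro hk
  obtain ⟨a, b, hab⟩ := exists_pair_lt D
  obtain ⟨n, hn⟩ := A.exists_large
  have h4 := hn.four_le
  have hir := A.one_le_ir
  have hr := A.ir_lt_r
  let p₀ : Fin n := ⟨0, by omega⟩
  let p₁ : Fin n := ⟨1, by omega⟩
  have hne : p₁ ≠ p₀ := by simp [p₀, p₁]
  have hspread : ∀ (s : State n D) p, A.Spreads s.ts (fun p => some (s.inp p)) A.ir (s.inp p) :=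
    fun s p => (A.spreads_of_ls
      (f := fun p => some (s.inp p)) (.refl 0 _) (huni 1 le_rfl (by omega))
      (hR.no_equalizer 1 le_rfl (by omega)) hk ⟨p, rfl⟩).mono hL hR hn huni le_rfl hir hr.le
  obtain ⟨X, hpX, -, hX⟩ := A.exists_critical_subset hn (i := A.ir + 1) (by omega) hr
    (huni _ (by omega) hr) p₀
  have h1 := hspread (initAlmostSolo p₀ a b) p₁
  have he1 : (initAlmostSolo p₀ a b).inp p₁ = b := almostSolo_of_ne hne a b
  rw [he1] at h1
  refine h1.not_agreement hImp hL hR hn huni (fun _ => rfl) (fun _ => rfl) hX hne rfl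
    (hspread _ p₀ X fun hk => absurd hk hL.ir_kind)
    (A.path_pattern (Y := {p₀}) hL hR hn huni hX hr le_rfl (fun hk => absurd hk hL.last_kind) _)
    (pattern_of_mem (by simp)) ?_ h
  simp [State.next, pattern, hpX, initAlmostSolo, almostSolo_self, hab.ne]

/-- If round `ir + 1` is an `ls` round, then a value adopted by a single process may be decided. -/
theorem Algorithm.kind_ir_succ_ne_ls_of_agreement [Nontrivial D] (hImp : A.SporadicImpliesGlobal)
    (hL : A.LeaderAssumption) (hR : A.Restrictions)
    (huni : ∀ i, 1 ≤ i → i ≤ A.r → (A.round i).uni ≠ none) (hM : (A.round 1).mult ≠ [])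
    (h : A.Agreement D) : (A.round (A.ir + 1)).kind ≠ .ls := by
  intro hk
  obtain ⟨a, b, hab⟩ := exists_pair_lt D
  obtain ⟨n, hn⟩ := A.exists_large
  have h4 := hn.four_le
  have hir := A.one_le_ir
  have hr := A.ir_lt_r
  let p₀ : Fin n := ⟨0, by omega⟩
  let p₁ : Fin n := ⟨1, by omega⟩
  have hne : p₁ ≠ p₀ := by simp [p₀, p₁]
  have hX : A.Critical (A.ir + 1) {p₀} := ⟨⟨p₀, by simp⟩, fun h => absurd hk h⟩
  have hspread : ∀ s : State n D, s.inp = almostSolo p₀ a b → (∀ q, s.ts q ≤ s.ts p₀) →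
      ∀ e, e = a ∨ e = b → A.Spreads s.ts (fun p => some (s.inp p)) A.ir e := by
    intro s hs hts e he
    rw [hs]
    exact A.spreads_of_flexible hL hR hn huni hM hab
      (A.flexible_almostSolo hn (Or.inl rfl) (huni 1 le_rfl (by omega)) hM hab hts) he
  refine (hspread (initAlmostSolo p₀ a b) rfl (fun _ => le_rfl) a (Or.inl rfl)).not_agreement
    hImp hL hR hn huni (fun _ => rfl) (fun _ => rfl) hX hne.symm rfl
    (hspread _ (funext fun p => ?_) (fun q => ?_) b (Or.inr rfl) {p₀}
      fun hk => absurd hk hL.ir_kind)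
    (A.path_pattern (Y := {p₁}) hL hR hn huni hX hr le_rfl (fun hk => absurd hk hL.last_kind) _)
    (pattern_of_mem (by simp)) hab.ne' h
  · by_cases hp : p = p₀ <;> simp [State.next, pattern, hp, initAlmostSolo, almostSolo]
  · by_cases hq : q = p₀ <;> simp [State.next, pattern, hq, initAlmostSolo]

/-- If, after a phase in which `e` may have been decided, a first round under the global predicate
may lead to another value, then that value may be decided, too. -/
lemma Algorithm.Spreads.not_agreement_of_obtain (hImp : A.SporadicImpliesGlobal)
    (hL : A.LeaderAssumption) (hR : A.Restrictions) (hn : A.Large n)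
    (huni : ∀ i, 1 ≤ i → i ≤ A.r → (A.round i).uni ≠ none) (hk1 : (A.round 1).kind ≠ .ls)
    {s : State n D} (hts : ∀ p, s.ts p = 0) (hdec : ∀ p, s.dec p = none) {e : D}
    (h : A.Spreads s.ts (fun p => some (s.inp p)) A.ir e) {X : Finset (Fin n)}
    (hX : A.Critical (A.ir + 1) X) {s' : State n D} (p₀ : Fin n)
    (hs' : s' = s.next 1 (pattern e X) (pattern e {p₀})) {T : Finset (Fin n)} {d : D}
    (hT : (A.glob 1).thrVal * n < T.card)
    (hd : A.obtain 1 s'.ts (fun p => some (s'.inp p)) T = some d) (hde : d ≠ e) :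
    ¬ A.Agreement D := by
  have h4 := hn.four_le
  obtain ⟨f₁, hf₁, hc₁⟩ := A.exists_carries_of_senders (by omega) le_rfl hk1 hT hd
  obtain ⟨f, hf, hc⟩ := hc₁.exists_path hL hn huni A.glob s'.ts A.one_le_ir A.ir_lt_r.le
  obtain ⟨g, hg, hcg⟩ := hc.exists_path hL hn huni A.glob s'.ts A.ir_lt_r.le le_rfl
  obtain ⟨q, hq⟩ : ∃ q, q ≠ p₀ := by
    have : Nontrivial (Fin n) := Fin.nontrivial_iff_two_le.2 (by omega)
    exact exists_ne p₀
  exact h.not_agreement hImp hL hR hn huni hts hdec hX hq.symm hs' (hf₁.path.trans hf) hg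
    (d := d) (by rw [hcg.eq_solo hL.last_kind]; rfl) hde

/-- There must not be enough processes for the `mult` instructions of the first round apart from
those whose value led to a decision. -/
theorem Algorithm.const_mult_of_agreement [Nontrivial D] (hImp : A.SporadicImpliesGlobal)
    (hL : A.LeaderAssumption) (hT : A.ThresholdAssumption) (hR : A.Restrictions)
    (huni : ∀ i, 1 ≤ i → i ≤ A.r → (A.round i).uni ≠ none) (hk1 : (A.round 1).kind ≠ .ls)
    (hM : (A.round 1).mult ≠ []) (h : A.Agreement D) :
    1 - (A.round (A.ir + 1)).thrU ≤ (A.round 1).thrM := by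
  classical
  by_contra! hlt
  obtain ⟨a, b, hab⟩ := exists_pair_lt D
  obtain ⟨n, hn⟩ := A.exists_large
  have h4 := hn.four_le
  have hir := A.one_le_ir
  have hr := A.ir_lt_r
  let p₀ : Fin n := ⟨0, by omega⟩
  have huir := huni (A.ir + 1) (by omega) hr
  obtain ⟨X, hpX, hXc, hX⟩ := A.exists_critical_subset hn (i := A.ir + 1) (by omega) hr huir p₀
  have hfl := Nat.floor_le (mul_nonneg ((A.round (A.ir + 1)).thrU_nonneg huir)
    (Nat.cast_nonneg (α := ℝ) n))
  have hle := hn.floor_le (i := A.ir + 1) (by omega) hr huir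
  have hgap := hn.2 _ (A.thrM_mem_constants le_rfl (by omega)) _
    (Or.inl (Or.inr (Or.inr rfl))) hlt
  have hVM := (hT 1 le_rfl (by omega) (by omega)).2 hM
  have hc : Xᶜ.card = n - (⌊(A.round (A.ir + 1)).thrU * n⌋₊ + 1) := by
    rw [Finset.card_compl, Fintype.card_fin, hXc]
  have hcR : (A.round 1).thrM * n < (Xᶜ).card := by
    rw [hc, Nat.cast_sub (by omega)]
    push_cast
    linarith
  obtain ⟨q, hq, hqp⟩ : ∃ q ∈ Xᶜ, q ≠ p₀ := Finset.exists_mem_ne (by omega) p₀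
  have hqX := Finset.mem_compl.1 hq
  have hpXc := Finset.mem_compl.2 hpX
  -- the decided value is the larger one, so that the smaller one prevails without it
  refine (A.spreads_of_flexible hL hR hn huni hM hab
    (A.flexible_almostSolo (p₀ := p₀) hn (Or.inl rfl) (huni 1 le_rfl (by omega)) hM hab
      (fun _ => le_rfl)) (Or.inr rfl)).not_agreement_of_obtain (s := initAlmostSolo p₀ a b)
    hImp hL hR hn huni hk1 (fun _ => rfl) (fun _ => rfl) hX p₀ rfl (T := Xᶜ) (d := a) ?_ ?_ hab.ne h
  · exact (mul_le_mul_of_nonneg_right hVM (Nat.cast_nonneg n)).trans_lt hcR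
  · have hinp : ∀ p ∉ X, ((initAlmostSolo p₀ a b).next 1 (pattern b X) (pattern b {p₀})).inp p =
        almostSolo p₀ a b p := fun p hp => by
      simp [State.next, pattern_of_notMem hp, initAlmostSolo]
    have hts : ∀ p ∉ X, ((initAlmostSolo p₀ a b).next 1 (pattern b X) (pattern b {p₀})).ts p = 0 :=
      fun p hp => by simp [State.next, pattern_of_notMem hp, initAlmostSolo]
    have hp₀ := (hinp p₀ hpX).trans (almostSolo_self p₀ a b)
    refine (A.obtain_maxts (by omega) hM hpXc hq ?_ hcR ?_ ?_).trans (congrArg some hp₀)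
    · rw [hp₀, hinp q hqX, almostSolo_of_ne hqp]; exact hab.ne
    · intro q hq
      rw [hp₀, hinp q (Finset.mem_compl.1 hq)]
      rcases almostSolo_eq p₀ q a b with h | h <;> rw [h]
      exact hab.le
    · intro q hq
      rw [hts q (Finset.mem_compl.1 hq), hts p₀ hpX]

/-- There must not be enough processes for the `uni` instruction of the first round apart from
those whose value led to a decision. -/
theorem Algorithm.const_uni_of_agreement [Nontrivial D] (hImp : A.SporadicImpliesGlobal)
    (hL : A.LeaderAssumption) (hT : A.ThresholdAssumption) (hR : A.Restrictions)
    (huni : ∀ i, 1 ≤ i → i ≤ A.r → (A.round i).uni ≠ none) (hk1 : (A.round 1).kind ≠ .ls)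
    (hM : (A.round 1).mult ≠ []) (h : A.Agreement D) :
    1 - (A.round (A.ir + 1)).thrU ≤ (A.round 1).thrU := by
  classical
  by_contra! hlt
  obtain ⟨a, b, hab⟩ := exists_pair_lt D
  obtain ⟨n, hn⟩ := A.exists_large
  have h4 := hn.four_le
  have hir := A.one_le_ir
  have hr := A.ir_lt_r
  let p₀ : Fin n := ⟨0, by omega⟩
  have hu1 := huni 1 le_rfl (by omega)
  have huir := huni (A.ir + 1) (by omega) hr
  obtain ⟨X, -, hXc, hX⟩ := A.exists_critical_subset hn (i := A.ir + 1) (by omega) hr huir p₀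
  have hfl := Nat.floor_le (mul_nonneg ((A.round (A.ir + 1)).thrU_nonneg huir)
    (Nat.cast_nonneg (α := ℝ) n))
  have hle := hn.floor_le (i := A.ir + 1) (by omega) hr huir
  have hgap := hn.2 _ (A.thrU_mem_constants le_rfl (by omega)) _
    (Or.inl (Or.inr (Or.inr rfl))) hlt
  have hVU := (hT 1 le_rfl (by omega) (by omega)).1 hu1
  have hcR : (A.round 1).thrU * n < (Xᶜ).card := by
    rw [Finset.card_compl, Fintype.card_fin, hXc, Nat.cast_sub (by omega)]
    push_cast
    linarith
  have hcV := (mul_le_mul_of_nonneg_right hVU (Nat.cast_nonneg n)).trans_lt hcR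
  let s : State n D := ⟨fun p => if p ∈ X then a else b, fun _ => 0, fun _ => none⟩
  have hflex : A.Flexible 1 (A.glob 1) s.ts (fun p => some (s.inp p)) a b :=
    A.flexible_one (by omega) hu1 hM hab hX.1 (fun p hp => if_pos hp) (fun p hp => if_neg hp)
      (fun _ _ _ _ => le_rfl) hcR hcV
  refine (A.spreads_of_flexible hL hR hn huni hM hab hflex (Or.inl rfl)).not_agreement_of_obtain
    hImp hL hR hn huni hk1 (fun _ => rfl) (fun _ => rfl) hX p₀ rfl (T := Xᶜ) (d := b) hcV
    (A.obtain_const_some hu1 (fun p hp => ?_) hcR) hab.ne' h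
  have hp := Finset.mem_compl.1 hp
  simp [State.next, pattern_of_notMem hp, s, hp]

end HeardOf

theorem theorem4 (D : Type*) [LinearOrder D] [Nontrivial D] (A : HeardOf.Algorithm)
    (hImp : A.SporadicImpliesGlobal) (hLeader : A.LeaderAssumption)
    (hThr : A.ThresholdAssumption) (hRestr : A.Restrictions) :
    A.SolvesConsensus D ↔
      (A.round 1).kind ≠ HeardOf.RoundKind.ls ∧
      (A.round (A.ir + 1)).kind ≠ HeardOf.RoundKind.ls ∧
      A.TSafe ∧
      ∃ i j : Fin A.k, i ≤ j ∧ A.StrongCUnifier (A.spor i) ∧ A.CDecider (A.spor j) := by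
  constructor
  · rintro ⟨hA, hT⟩
    have huni : ∀ i, 1 ≤ i → i ≤ A.r → (A.round i).uni ≠ none := fun i =>
      A.uni_ne_none_of_termination hImp hT
    have hk1 := A.kind_one_ne_ls_of_agreement hImp hLeader hRestr huni hA
    have hM := A.mult_ne_nil_of_termination hImp huni hk1 hT
    exact ⟨hk1, A.kind_ir_succ_ne_ls_of_agreement hImp hLeader hRestr huni hM hA,
      ⟨huni, hM, A.const_mult_of_agreement hImp hLeader hThr hRestr huni hk1 hM hA,
        A.const_uni_of_agreement hImp hLeader hThr hRestr huni hk1 hM hA⟩,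
      A.exists_unifier_decider_of_termination hImp hLeader hRestr huni hk1 hT⟩
  · rintro ⟨hk1, hkir, hS, i, j, hij, hU, hD⟩
    exact ⟨A.agreement_of_tSafe hS hRestr hk1 hkir,
      A.termination_of_unifier_decider hImp hLeader hS hk1 hij hU hD⟩
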